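/- All Hilbert spaces are complex, inner products $\langle\cdot,\cdot\rangle$ are linear in the first argument, $\mathcal X\otimes\mathcal Y$ is the Hilbert space tensor product, and sesquilinear forms are linear in the first and antilinear in the second argument. **A.** Let $V^{\rm int}$, $\mathcal Z$ and, for $l=1,\dots,L$, $\mathcal X^1_l,\mathcal X^2_l,\mathcal Y^1_l,\mathcal Y^2_l$ be Hilbert spaces with continuous dense embeddings $\mathcal X^2_l\subset\mathcal X^1_l$, $\mathcal Y^2_l\subset\mathcal Y^1_l$. Let $V^{\rm ext}=\bigoplus_{l}V^{\rm ext}_l$ be the orthogonal sum of the Hilbert spaces $V^{\rm ext}_l=\mathcal X^2_l\otimes\mathcal Y^1_l\cap\mathcal X^1_l\otimes\mathcal Y^2_l$, where the inner product of $V_l^{\rm ext}$ is the sum of the inner products of $\mathcal X^2_l\otimes\mathcal Y^1_l$ and $\mathcal X^1_l\otimes\mathcal Y^2_l$. Let ${\rm tr}_-:V^{\rm int}\to\mathcal Z$ and ${\rm tr}_+:V^{\rm ext}\to\mathcal Z$ be bounded, linear and surjective, and let $\mathcal V=\{(u^{\rm int},u^{\rm ext})\in V^{\rm int}\oplus V^{\rm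 ext}: {\rm tr}_-u^{\rm int}={\rm tr}_+u^{\rm ext}\}$. Let $\Lambda\subset\mathbb C$ be open and, for $\kappa\in\Lambda$, let $s^{\rm int}_\kappa$, $s^{\rm ext}_\kappa$ be bounded sesquilinear forms on $V^{\rm int}$ and $V^{\rm ext}$. Put $s_\kappa(u,v)=s^{\rm int}_\kappa(u^{\rm int},v^{\rm int})+s^{\rm ext}_\kappa(u^{\rm ext},v^{\rm ext})=\langle T_\kappa u,v\rangle_{\mathcal V}$ for $u,v\in\mathcal V$. **B, C and E.** Suppose that each $\kappa_0\in\Lambda$ has a neighbourhood $\widehat\Lambda\subset\Lambda$ for which there are a sequence $(\varphi_n)_{n\ge1}$ in $\bigoplus_l\mathcal Y^2_l$, indices $l(n)$, an integer $M\ge0$, constants $C_s,\alpha>0$, numbers $\theta_1,\dots,\theta_M\in\mathbb C$ of modulus $1$ and a compact linear operator $K$ on $V^{\rm int}$ such that the following holds for every $\kappa\in\widehat\Lambda$. The $\varphi_n$ form a complete orthogonal system of $\bigoplus_l\mathcal Y^2_l$, and $\varphi_n$ vanishes in all summands except the $l(n)$-th. For $n\neq m$ the spaces $\mathcal V_n=(\mathcal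 X^1_{l(n)}\otimes{\rm span}\{\varphi_n\})\cap V^{\rm ext}$ and $\mathcal V_m$ are orthogonal in $V^{\rm ext}$ and with respect to $s_\kappa^{\rm ext}$, and ${\rm tr}_+(\mathcal V_n)$ and ${\rm tr}_+(\mathcal V_m)$ are orthogonal in $\mathcal Z$; $\dim{\rm tr}_+(\mathcal V_n)<\infty$; $V^{\rm ext}$ and $\mathcal Z$ are the closed linear spans of $\bigcup_n\mathcal V_n$ and of $\bigcup_n{\rm tr}_+(\mathcal V_n)$. For all $u,v\in\mathcal V_n$, $$|s^{\rm ext}_\kappa(u,v)|\le C_s\|u\|\|v\|,\qquad \operatorname{Re}(\theta_ns^{\rm ext}_\kappa(u,u))\ge\alpha\|u\|^2\ (n\le M),\qquad \operatorname{Re}s^{\rm ext}_\kappa(u,u)\ge\alpha\|u\|^2\ (n>M),$$ and $\operatorname{Re}s^{\rm int}_\kappa(u,u)+\operatorname{Re}\langle Ku,u\rangle\ge\alpha\|u\|^2$ for all $u\in V^{\rm int}$. Suppose moreover that $\kappa\mapsto T_\kappa$ is holomorphic on $\Lambda$ in the operator norm. **D.** Let $V^{\rm int}_h\subset V^{\rm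 int}$ and $\mathcal Y_{h,l}\subset\mathcal Y^2_l$ ($h>0$) be finite dimensional subspaces which decrease in $h$, and $\mathcal X_{N,l}\subset\mathcal X^2_l$ ($N\in\mathbb N$) closed (for example, finite dimensional) subspaces which increase in $N$, such that $\bigcup_hV^{\rm int}_h$, $\bigcup_h\mathcal Y_{h,l}$ and $\bigcup_N\mathcal X_{N,l}$ are dense in $V^{\rm int}$, $\mathcal Y^2_l$ and $\mathcal X^2_l$. With $V^{\rm ext}_{h,N}=\bigoplus_l\mathcal X_{N,l}\otimes\mathcal Y_{h,l}$ let ${\rm tr}_+(V^{\rm ext}_{h,N})={\rm tr}_-(V^{\rm int}_h)$ for all $h,N$, and put $\mathcal V_{h,N}=\mathcal V\cap(V^{\rm int}_h\oplus V^{\rm ext}_{h,N})$. Suppose there are bounded operators ${\rm tr}_-^\dagger:\mathcal Z\to V^{\rm int}$ and ${\rm tr}_{h,-}^\dagger:\mathcal Z\to V^{\rm int}_h$ with ${\rm tr}_-{\rm tr}_-^\dagger={\rm Id}$, ${\rm tr}_-{\rm tr}_{h,-}^\dagger{\rm tr}_-u={\rm tr}_-u$ for $u\in V_h^{\rm int}$,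 and $\lim_{h\to0}\|{\rm tr}_-^\dagger g-{\rm tr}_{h,-}^\dagger g\|=0$ for all $g\in\mathcal Z$. **Theorem.** Let $\Sigma$ be the set of $\kappa\in\Lambda$ for which some $u\in\mathcal V\setminus\{0\}$ satisfies $s_\kappa(u,v)=0$ for all $v\in\mathcal V$, and let $\Sigma_{h,N}$ be the set of $\kappa\in\Lambda$ for which some $u\in\mathcal V_{h,N}\setminus\{0\}$ satisfies $s_\kappa(u,v)=0$ for all $v\in\mathcal V_{h,N}$. Assume that every connected component of $\Lambda$ contains some $\kappa$ for which $T_\kappa$ is invertible (if $\Lambda$ is connected: that $T_\kappa$ is invertible for some $\kappa\in\Lambda$). Then $\Sigma$ is discrete and has no accumulation points in $\Lambda$. Let ${\rm dist}(A,B)=\max\{\sup_{a\in A}\inf_{b\in B}|a-b|,\sup_{b\in B}\inf_{a\in A}|a-b|\}\in[0,\infty]$ (with $\sup\emptyset=0$, $\inf\emptyset=\infty$). For every compact $\Lambda'\subset\Lambda$ whose boundary contains no point of $\Sigma$, $$\lim_{h\to0,\,N\to\infty}{\rm dist}(\Sigma\cap\Lambda',\Sigma_{h,N}\cap\Lambda')=0,$$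 and for every compact $\Lambda'\subset\Lambda$ without exception, $$\lim_{h\to0,\,N\to\infty}\ \sup_{\kappa\in\Sigma_{h,N}\cap\Lambda'}\ \inf_{\kappa'\in\Sigma\cap\Lambda'}|\kappa-\kappa'|=0,\qquad \lim_{h\to0,\,N\to\infty}\ \sup_{\kappa\in\Sigma\cap\Lambda'}\ \inf_{\kappa'\in\Sigma_{h,N}}|\kappa-\kappa'|=0.$$ -/

import Mathlib

open Filter Topology Set
open scoped TensorProduct

namespace Waveguide

noncomputable section

/-! ### Hilbert space tensor products -/

section Tensor

variable {E F E' F' : Type*}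
  [NormedAddCommGroup E] [InnerProductSpace ℂ E] [NormedAddCommGroup F] [InnerProductSpace ℂ F]
  [NormedAddCommGroup E'] [InnerProductSpace ℂ E'] [NormedAddCommGroup F'] [InnerProductSpace ℂ F']

/-- The Hilbert space tensor product: the completion of the algebraic tensor product for the inner
product with `⟪x ⊗ y, x' ⊗ y'⟫ = ⟪x, x'⟫ ⟪y, y'⟫`. -/
abbrev HTensor (E F : Type*) [NormedAddCommGroup E] [InnerProductSpace ℂ E]
    [NormedAddCommGroup F] [InnerProductSpace ℂ F] : Type _ :=
  UniformSpace.Completion (E ⊗[ℂ] F)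

/-- The pure tensors, as a continuous bilinear map `E → F → E ⊗ F`. -/
def HTensor.tmulL (E F : Type*) [NormedAddCommGroup E] [InnerProductSpace ℂ E]
    [NormedAddCommGroup F] [InnerProductSpace ℂ F] : E →L[ℂ] F →L[ℂ] HTensor E F :=
  (ContinuousLinearMap.compL ℂ F (E ⊗[ℂ] F) (HTensor E F)
    (UniformSpace.Completion.toComplL (𝕜 := ℂ) (E := E ⊗[ℂ] F))).comp (TensorProduct.mkL ℂ E F)

theorem HTensor.tmulL_apply (x : E) (y : F) :
    HTensor.tmulL E F x y = ((x ⊗ₜ[ℂ] y : E ⊗[ℂ] F) : HTensor E F) := rfl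

/-- The tensor product `A ⊗ B` of two bounded operators. -/
def HTensor.map (A : E →L[ℂ] E') (B : F →L[ℂ] F') : HTensor E F →L[ℂ] HTensor E' F' :=
  (TensorProduct.mapL A B).completion

theorem HTensor.map_tmulL (A : E →L[ℂ] E') (B : F →L[ℂ] F') (x : E) (y : F) :
    HTensor.map A B (HTensor.tmulL E F x y) = HTensor.tmulL E' F' (A x) (B y) := by
  simp [HTensor.map, HTensor.tmulL_apply]

end Tensor

/-- A continuous dense embedding: a bounded injective linear map with dense range. -/
structure IsDenseInclusion {E F : Type*} [NormedAddCommGroup E] [InnerProductSpace ℂ E]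
    [NormedAddCommGroup F] [InnerProductSpace ℂ F] (ι : E →L[ℂ] F) : Prop where
  injective : Function.Injective ι
  denseRange : DenseRange ι

/-! ### The space of a single waveguide -/

section SingleWaveguide

variable {X1 X2 Y1 Y2 : Type*}
  [NormedAddCommGroup X1] [InnerProductSpace ℂ X1] [NormedAddCommGroup X2] [InnerProductSpace ℂ X2]
  [NormedAddCommGroup Y1] [InnerProductSpace ℂ Y1] [NormedAddCommGroup Y2] [InnerProductSpace ℂ Y2]

/-- For embeddings `X2 ⊂ X1` and `Y2 ⊂ Y1`, the intersection `X2 ⊗ Y1 ∩ X1 ⊗ Y2` of two subspaces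
of `X1 ⊗ Y1`. An element is given by its representatives `a` in `X2 ⊗ Y1` and `b` in `X1 ⊗ Y2`, which
have the same image in `X1 ⊗ Y1`; the inner product is the sum of those of `X2 ⊗ Y1` and `X1 ⊗ Y2`. -/
def waveguideSubmodule (ιX : X2 →L[ℂ] X1) (ιY : Y2 →L[ℂ] Y1) :
    Submodule ℂ (WithLp 2 (HTensor X2 Y1 × HTensor X1 Y2)) :=
  ((HTensor.map ιX (ContinuousLinearMap.id ℂ Y1)).comp
      (WithLp.fstL 2 ℂ (HTensor X2 Y1) (HTensor X1 Y2)) -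
    (HTensor.map (ContinuousLinearMap.id ℂ X1) ιY).comp
      (WithLp.sndL 2 ℂ (HTensor X2 Y1) (HTensor X1 Y2))).ker

/-- The Hilbert space `X2 ⊗ Y1 ∩ X1 ⊗ Y2`. -/
def WaveguideSpace (ιX : X2 →L[ℂ] X1) (ιY : Y2 →L[ℂ] Y1) : Type _ :=
  ↥(waveguideSubmodule ιX ιY)

instance (ιX : X2 →L[ℂ] X1) (ιY : Y2 →L[ℂ] Y1) : NormedAddCommGroup (WaveguideSpace ιX ιY) :=
  inferInstanceAs (NormedAddCommGroup ↥(waveguideSubmodule ιX ιY))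

instance (ιX : X2 →L[ℂ] X1) (ιY : Y2 →L[ℂ] Y1) : InnerProductSpace ℂ (WaveguideSpace ιX ιY) :=
  inferInstanceAs (InnerProductSpace ℂ ↥(waveguideSubmodule ιX ιY))

instance (ιX : X2 →L[ℂ] X1) (ιY : Y2 →L[ℂ] Y1) : CompleteSpace (WaveguideSpace ιX ιY) :=
  have : CompleteSpace ↥(waveguideSubmodule ιX ιY) :=
    (ContinuousLinearMap.isClosed_ker _).completeSpace_coe
  inferInstanceAs (CompleteSpace ↥(waveguideSubmodule ιX ιY))

/-- The pair of representatives of an element of `X2 ⊗ Y1 ∩ X1 ⊗ Y2`. -/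
def WaveguideSpace.incl (ιX : X2 →L[ℂ] X1) (ιY : Y2 →L[ℂ] Y1) :
    WaveguideSpace ιX ιY →L[ℂ] WithLp 2 (HTensor X2 Y1 × HTensor X1 Y2) :=
  (waveguideSubmodule ιX ιY).subtypeL

/-- The inclusion of `X2 ⊗ Y1 ∩ X1 ⊗ Y2` into `X1 ⊗ Y1`. -/
def toTensor (ιX : X2 →L[ℂ] X1) (ιY : Y2 →L[ℂ] Y1) : WaveguideSpace ιX ιY →L[ℂ] HTensor X1 Y1 :=
  ((HTensor.map ιX (ContinuousLinearMap.id ℂ Y1)).comp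
    (WithLp.fstL 2 ℂ (HTensor X2 Y1) (HTensor X1 Y2))).comp (WaveguideSpace.incl ιX ιY)

/-- The pure tensor `x ⊗ y` with `x ∈ X2`, `y ∈ Y2`, as an element of `X2 ⊗ Y1 ∩ X1 ⊗ Y2`. -/
def pureTensor (ιX : X2 →L[ℂ] X1) (ιY : Y2 →L[ℂ] Y1) (x : X2) (y : Y2) : WaveguideSpace ιX ιY :=
  ⟨WithLp.toLp 2 (HTensor.tmulL X2 Y1 x (ιY y), HTensor.tmulL X1 Y2 (ιX x) y), by
    simp [waveguideSubmodule, HTensor.map_tmulL]⟩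

/-- The algebraic tensor product `X ⊗ Y` of subspaces `X ⊂ X2`, `Y ⊂ Y2`: the linear span of the
tensors `x ⊗ y` with `x ∈ X`, `y ∈ Y`. -/
def tensorSubmodule (ιX : X2 →L[ℂ] X1) (ιY : Y2 →L[ℂ] Y1) (X : Submodule ℂ X2)
    (Y : Submodule ℂ Y2) : Submodule ℂ (WaveguideSpace ιX ιY) :=
  Submodule.span ℂ {w | ∃ x ∈ X, ∃ y ∈ Y, w = pureTensor ιX ιY x y}

end SingleWaveguide

/-! ### The exterior space -/

section Exterior

variable {L : ℕ} {X1 X2 Y1 Y2 : Fin L → Type*}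
  [∀ l, NormedAddCommGroup (X1 l)] [∀ l, InnerProductSpace ℂ (X1 l)]
  [∀ l, NormedAddCommGroup (X2 l)] [∀ l, InnerProductSpace ℂ (X2 l)]
  [∀ l, NormedAddCommGroup (Y1 l)] [∀ l, InnerProductSpace ℂ (Y1 l)]
  [∀ l, NormedAddCommGroup (Y2 l)] [∀ l, InnerProductSpace ℂ (Y2 l)]

/-- The exterior space: the orthogonal direct sum over `l` of the spaces
`X2 l ⊗ Y1 l ∩ X1 l ⊗ Y2 l`. -/
abbrev ExtSpace (ιX : ∀ l, X2 l →L[ℂ] X1 l) (ιY : ∀ l, Y2 l →L[ℂ] Y1 l) : Type _ :=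
  PiLp 2 (fun l => WaveguideSpace (ιX l) (ιY l))

instance (ιX : ∀ l, X2 l →L[ℂ] X1 l) (ιY : ∀ l, Y2 l →L[ℂ] Y1 l) :
    NormedAddCommGroup (ExtSpace ιX ιY) :=
  PiLp.normedAddCommGroup 2 _

instance (ιX : ∀ l, X2 l →L[ℂ] X1 l) (ιY : ∀ l, Y2 l →L[ℂ] Y1 l) :
    InnerProductSpace ℂ (ExtSpace ιX ιY) :=
  PiLp.innerProductSpace _

instance (ιX : ∀ l, X2 l →L[ℂ] X1 l) (ιY : ∀ l, Y2 l →L[ℂ] Y1 l) :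
    CompleteSpace (ExtSpace ιX ιY) :=
  inferInstance

/-- The modal space `X1 (l n) ⊗ span {φ n} ∩ ExtSpace`, for a vector `φ n ∈ ⨁ l, Y2 l` supported in
the summand `l n`: the exterior functions which vanish in the other waveguides and have the form
`u ⊗ φ n` with `u ∈ X1 (l n)` in the waveguide `l n`. -/
def modalSpace (ιX : ∀ l, X2 l →L[ℂ] X1 l) (ιY : ∀ l, Y2 l →L[ℂ] Y1 l)
    (φ : ℕ → PiLp 2 Y2) (lidx : ℕ → Fin L) (n : ℕ) : Submodule ℂ (ExtSpace ιX ιY) :=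
  (LinearMap.range
      ((HTensor.tmulL (X1 (lidx n)) (Y1 (lidx n))).flip
        (ιY (lidx n) (φ n (lidx n)))).toLinearMap).comap
    ((toTensor (ιX (lidx n)) (ιY (lidx n))).comp
      (PiLp.proj 2 (fun l => WaveguideSpace (ιX l) (ιY l)) (lidx n) (𝕜 := ℂ))).toLinearMap ⊓
  ⨅ j ∈ {j : Fin L | j ≠ lidx n},
    (PiLp.proj 2 (fun l => WaveguideSpace (ιX l) (ιY l)) j (𝕜 := ℂ)).ker

/-- The discrete exterior space `⨁ l, X l ⊗ Y l`. -/
def discreteExt (ιX : ∀ l, X2 l →L[ℂ] X1 l) (ιY : ∀ l, Y2 l →L[ℂ] Y1 l)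
    (X : ∀ l, Submodule ℂ (X2 l)) (Y : ∀ l, Submodule ℂ (Y2 l)) :
    Submodule ℂ (ExtSpace ιX ιY) :=
  ⨅ l, (tensorSubmodule (ιX l) (ιY l) (X l) (Y l)).comap
    (PiLp.proj 2 (fun l => WaveguideSpace (ιX l) (ιY l)) l (𝕜 := ℂ)).toLinearMap

end Exterior

/-! ### The coupled space, sesquilinear forms and eigenvalues -/

section Coupled

variable {Vint Vext Z : Type*}
  [NormedAddCommGroup Vint] [InnerProductSpace ℂ Vint]
  [NormedAddCommGroup Vext] [InnerProductSpace ℂ Vext]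
  [NormedAddCommGroup Z] [InnerProductSpace ℂ Z]

/-- The pairs `(uint, uext)` with equal traces, inside the orthogonal sum `Vint ⊕ Vext`. -/
def coupledSubmodule (trm : Vint →L[ℂ] Z) (trp : Vext →L[ℂ] Z) :
    Submodule ℂ (WithLp 2 (Vint × Vext)) :=
  (trm.comp (WithLp.fstL 2 ℂ Vint Vext) - trp.comp (WithLp.sndL 2 ℂ Vint Vext)).ker

/-- The Hilbert space of pairs `(uint, uext)` with equal traces. -/
def CoupledSpace (trm : Vint →L[ℂ] Z) (trp : Vext →L[ℂ] Z) : Type _ :=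
  ↥(coupledSubmodule trm trp)

instance (trm : Vint →L[ℂ] Z) (trp : Vext →L[ℂ] Z) : NormedAddCommGroup (CoupledSpace trm trp) :=
  inferInstanceAs (NormedAddCommGroup ↥(coupledSubmodule trm trp))

instance (trm : Vint →L[ℂ] Z) (trp : Vext →L[ℂ] Z) : InnerProductSpace ℂ (CoupledSpace trm trp) :=
  inferInstanceAs (InnerProductSpace ℂ ↥(coupledSubmodule trm trp))

instance [CompleteSpace Vint] [CompleteSpace Vext] (trm : Vint →L[ℂ] Z) (trp : Vext →L[ℂ] Z) :
    CompleteSpace (CoupledSpace trm trp) :=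
  have : CompleteSpace ↥(coupledSubmodule trm trp) :=
    (ContinuousLinearMap.isClosed_ker _).completeSpace_coe
  inferInstanceAs (CompleteSpace ↥(coupledSubmodule trm trp))

/-- The inclusion into the orthogonal sum `Vint ⊕ Vext`. -/
def CoupledSpace.incl (trm : Vint →L[ℂ] Z) (trp : Vext →L[ℂ] Z) :
    CoupledSpace trm trp →L[ℂ] WithLp 2 (Vint × Vext) :=
  (coupledSubmodule trm trp).subtypeL

/-- The interior component. -/
def intPart (trm : Vint →L[ℂ] Z) (trp : Vext →L[ℂ] Z) : CoupledSpace trm trp →L[ℂ] Vint :=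
  (WithLp.fstL 2 ℂ Vint Vext).comp (CoupledSpace.incl trm trp)

/-- The exterior component. -/
def extPart (trm : Vint →L[ℂ] Z) (trp : Vext →L[ℂ] Z) : CoupledSpace trm trp →L[ℂ] Vext :=
  (WithLp.sndL 2 ℂ Vint Vext).comp (CoupledSpace.incl trm trp)

/-- The bounded sesquilinear form `s(u, v) = sint(uint, vint) + sext(uext, vext)` (linear in `u`,
antilinear in `v`). -/
def coupledForm (trm : Vint →L[ℂ] Z) (trp : Vext →L[ℂ] Z)
    (sint : Vint →L[ℂ] Vint →L⋆[ℂ] ℂ) (sext : Vext →L[ℂ] Vext →L⋆[ℂ] ℂ) :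
    CoupledSpace trm trp →L[ℂ] CoupledSpace trm trp →L⋆[ℂ] ℂ :=
  sint.bilinearComp (intPart trm trp) (intPart trm trp) +
    sext.bilinearComp (extPart trm trp) (extPart trm trp)

theorem coupledForm_apply (trm : Vint →L[ℂ] Z) (trp : Vext →L[ℂ] Z)
    (sint : Vint →L[ℂ] Vint →L⋆[ℂ] ℂ) (sext : Vext →L[ℂ] Vext →L⋆[ℂ] ℂ)
    (u v : CoupledSpace trm trp) :
    coupledForm trm trp sint sext u v =
      sint (intPart trm trp u) (intPart trm trp v) +
        sext (extPart trm trp u) (extPart trm trp v) := rfl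

/-- The subspace of the coupled space whose interior component lies in `A` and whose exterior
component lies in `B`. -/
def discreteCoupled (trm : Vint →L[ℂ] Z) (trp : Vext →L[ℂ] Z)
    (A : Submodule ℂ Vint) (B : Submodule ℂ Vext) : Submodule ℂ (CoupledSpace trm trp) :=
  A.comap (intPart trm trp).toLinearMap ⊓ B.comap (extPart trm trp).toLinearMap

end Coupled

section Eigenvalues

variable {V : Type*} [NormedAddCommGroup V] [InnerProductSpace ℂ V]

/-- The operator `T` with `s(u, v) = ⟪T u, v⟫` (inner product linear in its first argument), in the
convention of `inner`, which is linear in its second argument: `s u v = inner ℂ v (T u)`. -/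
def formOperator [CompleteSpace V] (s : V →L[ℂ] V →L⋆[ℂ] ℂ) : V →L[ℂ] V :=
  ContinuousLinearMap.adjoint (InnerProductSpace.continuousLinearMapOfBilin s.flip)

theorem inner_formOperator [CompleteSpace V] (s : V →L[ℂ] V →L⋆[ℂ] ℂ) (u v : V) :
    inner ℂ v (formOperator s u) = s u v := by
  simp [formOperator, ContinuousLinearMap.adjoint_inner_right]

/-- The `κ ∈ Λ` for which the form `s κ`, restricted to the subspace `W`, has an eigenvector: some
`u ∈ W`, `u ≠ 0`, with `s κ u v = 0` for all `v ∈ W`. -/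
def eigenvalueSet (Λ : Set ℂ) (s : ℂ → V →L[ℂ] V →L⋆[ℂ] ℂ) (W : Submodule ℂ V) : Set ℂ :=
  {κ | κ ∈ Λ ∧ ∃ u ∈ W, u ≠ 0 ∧ ∀ v ∈ W, s κ u v = 0}

end Eigenvalues

/-! ### Standing assumptions -/

section Assumptions

variable {L : ℕ} {X1 X2 Y1 Y2 : Fin L → Type*}
  [∀ l, NormedAddCommGroup (X1 l)] [∀ l, InnerProductSpace ℂ (X1 l)]
  [∀ l, NormedAddCommGroup (X2 l)] [∀ l, InnerProductSpace ℂ (X2 l)]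
  [∀ l, NormedAddCommGroup (Y1 l)] [∀ l, InnerProductSpace ℂ (Y1 l)]
  [∀ l, NormedAddCommGroup (Y2 l)] [∀ l, InnerProductSpace ℂ (Y2 l)]
  {Vint Z : Type*}
  [NormedAddCommGroup Vint] [InnerProductSpace ℂ Vint]
  [NormedAddCommGroup Z] [InnerProductSpace ℂ Z]

/-- Separation of the exterior space by the orthogonal system `φ`. The index `n` runs over
`0, 1, 2, …`. -/
structure SeparationAssumption (ιX : ∀ l, X2 l →L[ℂ] X1 l) (ιY : ∀ l, Y2 l →L[ℂ] Y1 l)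
    (trp : ExtSpace ιX ιY →L[ℂ] Z) (sext : ExtSpace ιX ιY →L[ℂ] ExtSpace ιX ιY →L⋆[ℂ] ℂ)
    (φ : ℕ → PiLp 2 Y2) (lidx : ℕ → Fin L) : Prop where
  /-- `φ` is an orthogonal system in `⨁ l, Y2 l` (zero vectors are not excluded) -/
  orthogonal : ∀ n m, n ≠ m → inner ℂ (φ n) (φ m) = 0
  /-- and it is complete there. -/
  complete : (Submodule.span ℂ (Set.range φ)).topologicalClosure = ⊤
  /-- `φ n` is supported in the summand `lidx n`. -/
  support : ∀ n j, j ≠ lidx n → φ n j = 0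
  /-- The modal spaces are orthogonal in the exterior space, -/
  modal_orthogonal : ∀ n m, n ≠ m → ∀ u ∈ modalSpace ιX ιY φ lidx n,
    ∀ v ∈ modalSpace ιX ιY φ lidx m, inner ℂ u v = 0
  /-- with respect to the exterior sesquilinear form, -/
  form_orthogonal : ∀ n m, n ≠ m → ∀ u ∈ modalSpace ιX ιY φ lidx n,
    ∀ v ∈ modalSpace ιX ιY φ lidx m, sext u v = 0
  /-- and their traces are orthogonal in the trace space. -/
  trace_orthogonal : ∀ n m, n ≠ m → ∀ u ∈ modalSpace ιX ιY φ lidx n,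
    ∀ v ∈ modalSpace ιX ιY φ lidx m, inner ℂ (trp u) (trp v) = 0
  trace_finite : ∀ n,
    FiniteDimensional ℂ ((modalSpace ιX ιY φ lidx n).map trp.toLinearMap)
  /-- The exterior space is the Hilbert space direct sum of the modal spaces, -/
  modal_dense : (⨆ n, modalSpace ιX ιY φ lidx n).topologicalClosure = ⊤
  /-- and the trace space is the Hilbert space direct sum of their traces. -/
  trace_dense :
    (⨆ n, (modalSpace ιX ιY φ lidx n).map trp.toLinearMap).topologicalClosure = ⊤

/-- Boundedness and coercivity. The forms `s_n(u, v) = sext(u ⊗ φ n, v ⊗ φ n)` on the space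
`𝒳_n = {u | u ⊗ φ n ∈ ExtSpace}` with `‖u‖ = ‖u ⊗ φ n‖` are written as forms on the modal space, whose
elements are the `u ⊗ φ n`. The first `M` modes are those with `n < M`. -/
structure CoercivityAssumption (ιX : ∀ l, X2 l →L[ℂ] X1 l) (ιY : ∀ l, Y2 l →L[ℂ] Y1 l)
    (sint : Vint →L[ℂ] Vint →L⋆[ℂ] ℂ) (sext : ExtSpace ιX ιY →L[ℂ] ExtSpace ιX ιY →L⋆[ℂ] ℂ)
    (φ : ℕ → PiLp 2 Y2) (lidx : ℕ → Fin L)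
    (M : ℕ) (Cs α : ℝ) (θ : ℕ → ℂ) (K : Vint →L[ℂ] Vint) : Prop where
  Cs_pos : 0 < Cs
  alpha_pos : 0 < α
  norm_theta : ∀ n < M, ‖θ n‖ = 1
  bounded : ∀ n, ∀ u ∈ modalSpace ιX ιY φ lidx n, ∀ v ∈ modalSpace ιX ιY φ lidx n,
    ‖sext u v‖ ≤ Cs * ‖u‖ * ‖v‖
  coercive_guided : ∀ n < M, ∀ u ∈ modalSpace ιX ιY φ lidx n,
    α * ‖u‖ ^ 2 ≤ (θ n * sext u u).re
  coercive_evanescent : ∀ n, M ≤ n → ∀ u ∈ modalSpace ιX ιY φ lidx n,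
    α * ‖u‖ ^ 2 ≤ (sext u u).re
  compact : IsCompactOperator K
  garding : ∀ u : Vint, α * ‖u‖ ^ 2 ≤ (sint u u).re + (inner ℂ u (K u)).re

/-- The discrete subspaces `Vh h ⊂ Vint`, `Yh h l ⊂ Y2 l` (for `h > 0`) and `XN N l ⊂ X2 l`. -/
structure DiscreteAssumption (ιX : ∀ l, X2 l →L[ℂ] X1 l) (ιY : ∀ l, Y2 l →L[ℂ] Y1 l)
    (trm : Vint →L[ℂ] Z) (trp : ExtSpace ιX ιY →L[ℂ] Z)
    (Vh : ℝ → Submodule ℂ Vint) (Yh : ℝ → ∀ l, Submodule ℂ (Y2 l))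
    (XN : ℕ → ∀ l, Submodule ℂ (X2 l)) : Prop where
  finite_V : ∀ h, 0 < h → FiniteDimensional ℂ (Vh h)
  finite_Y : ∀ h, 0 < h → ∀ l, FiniteDimensional ℂ (Yh h l)
  /-- Closed subspaces; in particular, all finite dimensional subspaces are allowed. -/
  closed_X : ∀ N l, IsClosed (XN N l : Set (X2 l))
  nested_V : ∀ h h', 0 < h → h ≤ h' → Vh h' ≤ Vh h
  nested_Y : ∀ h h', 0 < h → h ≤ h' → ∀ l, Yh h' l ≤ Yh h l
  nested_X : ∀ N N', N ≤ N' → ∀ l, XN N l ≤ XN N' l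
  dense_V : Dense (⋃ h ∈ Set.Ioi (0 : ℝ), (Vh h : Set Vint))
  dense_Y : ∀ l, Dense (⋃ h ∈ Set.Ioi (0 : ℝ), (Yh h l : Set (Y2 l)))
  dense_X : ∀ l, Dense (⋃ N, (XN N l : Set (X2 l)))
  trace_eq : ∀ h, 0 < h → ∀ N,
    (discreteExt ιX ιY (XN N) (Yh h)).map trp.toLinearMap = (Vh h).map trm.toLinearMap
  /-- A bounded right inverse of the interior trace, and discrete versions of it which converge
  pointwise to it as `h → 0`. -/
  exists_right_inverse : ∃ (trDag : Z →L[ℂ] Vint) (trhDag : ℝ → Z →L[ℂ] Vint),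
    (∀ g, trm (trDag g) = g) ∧
    (∀ h, 0 < h → ∀ g, trhDag h g ∈ Vh h) ∧
    (∀ h, 0 < h → ∀ u ∈ Vh h, trm (trhDag h (trm u)) = trm u) ∧
    ∀ g, Tendsto (fun h => ‖trDag g - trhDag h g‖) (𝓝[>] 0) (𝓝 0)

end Assumptions

end

end Waveguide

open Waveguide

/-! The operator `A κ` of the coupled form is coercive up to two obstructions: the compact `K` in
the interior, and the finitely many modes `n < M`, on which the exterior form is coercive only after
a rotation by `θ n`. Let `T` multiply the mode `n` by `conj (θ n)` for `n < M` and fix all other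
modes. Since distinct modes are orthogonal both in the exterior space and for the form, `Re sext(u,
T u) ≥ α‖u‖²`. As it stands `T` violates the trace condition, so it is extended to pairs by `(a, b)
↦ (a + D tr₊(T b - b), T b)` with `D` a right inverse of the interior trace. The correction has
finite rank, because only finitely many modes change and each has a finite dimensional trace space.
Hence a Gårding inequality `Re ⟨A u, T u⟩ ≥ α‖u‖² - Re ⟨C u, u⟩` with `C` compact holds, and `T` is
invertible, its inverse being built from `θ n` in the same way. So `A κ` is invertible as soon as it
is injective, and the analytic Fredholm theorem makes the eigenvalues isolated.

The discrete spaces need not be invariant under `T`: `φ n` need not lie in the discrete cross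
section space, and `D` need not map into the discrete interior space. Two replacements cure this.
Each of the finitely many `φ n` is replaced by an approximation `y n` in the discrete space, so that
`u` becomes `u + ∑ (c n - 1) u_n ⊗ y n`; the coefficient `u_n` of a discrete `u` lies again in the
discrete space because the discretisation is a tensor product. And `D` is replaced by its discrete
versions, which converge only pointwise, but this becomes norm convergence on the finite dimensional
range to which they are applied. The modified operators `Tk` (and `Rk` for the inverse) preserve the
discrete spaces and converge to `T` (and `T⁻¹`) in operator norm. This is what a Gårding inequality
needs in order to survive Galerkin projection.

Two consequences give the theorem. Normalised discrete vectors with small discrete residual have a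
subsequence converging to a kernel vector; so near a non-eigenvalue the method is uniformly stable
and there are no spurious eigenvalues. Conversely, suppose a disc around an isolated eigenvalue
contained no discrete one. Then the inverses of the compressed operators would be holomorphic on the
disc and, by stability on the circle, uniformly bounded there; the maximum principle carries the
bound to the centre, where approximations of the eigenvector violate it. The set convergence follows
by compactness. -/

namespace Waveguide

/-! ### Lax-Milgram, the Fredholm alternative and Gårding inequalities with a twist `T` -/

section Fredholm

variable {V : Type*} [NormedAddCommGroup V] [InnerProductSpace ℂ V]

/-- A bounded coercive operator is bounded below. -/
theorem norm_le_of_coercive (B : V →L[ℂ] V) {α : ℝ}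
    (hB : ∀ u, α * ‖u‖ ^ 2 ≤ (inner ℂ u (B u)).re) (u : V) : α * ‖u‖ ≤ ‖B u‖ := by
  rcases eq_or_ne u 0 with rfl | hu
  · simp
  have h := (hB u).trans ((Complex.re_le_norm _).trans (norm_inner_le_norm u (B u)))
  have hu' : 0 < ‖u‖ := norm_pos_iff.2 hu
  nlinarith

/-- The Lax-Milgram lemma for complex Hilbert spaces. -/
theorem isUnit_of_coercive [CompleteSpace V] (B : V →L[ℂ] V) {α : ℝ} (hα : 0 < α)
    (hB : ∀ u, α * ‖u‖ ^ 2 ≤ (inner ℂ u (B u)).re) : IsUnit B := by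
  have hal : AntilipschitzWith (Real.toNNReal α⁻¹) B := by
    refine B.antilipschitz_of_bound fun u => ?_
    rw [Real.coe_toNNReal _ (inv_pos.2 hα).le, ← div_eq_inv_mul, le_div_iff₀ hα, mul_comm]
    exact norm_le_of_coercive B hB u
  rw [ContinuousLinearMap.isUnit_iff_bijective]
  refine ⟨hal.injective, ?_⟩
  have hcl : IsClosed (B.range : Set V) := by
    simpa using! hal.isClosed_range B.uniformContinuous
  have : CompleteSpace B.range := hcl.completeSpace_coe
  rw [← ContinuousLinearMap.coe_coe, ← LinearMap.range_eq_top]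
  rw [← Submodule.orthogonal_eq_bot_iff, Submodule.eq_bot_iff]
  intro w hw
  have h0 : inner ℂ w (B w) = 0 := Submodule.inner_left_of_mem_orthogonal
    (LinearMap.mem_range_self (B : V →ₗ[ℂ] V) w) hw
  have h1 := hB w
  rw [h0] at h1
  simp only [Complex.zero_re] at h1
  have h2 : ‖w‖ ^ 2 ≤ 0 := by
    by_contra! h
    nlinarith
  exact norm_eq_zero.1 (pow_eq_zero_iff (two_ne_zero) |>.1 (le_antisymm h2 (sq_nonneg _)))

/-- The operator `A` satisfies a Gårding inequality after composition with the invertible operator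
`T`, up to the compact operator `C`. -/
structure TGarding (A T C : V →L[ℂ] V) (α : ℝ) : Prop where
  pos : 0 < α
  isUnit : IsUnit T
  compact : IsCompactOperator C
  garding : ∀ u, α * ‖u‖ ^ 2 ≤ (inner ℂ (T u) (A u)).re + (inner ℂ u (C u)).re

/-- The identity minus a compact operator is invertible if it is injective. -/
theorem isUnit_one_sub_of_compact [CompleteSpace V] {K : V →L[ℂ] V} (hK : IsCompactOperator K)
    (hinj : ∀ u, K u = u → u = 0) : IsUnit (1 - K) := by
  rcases hK.hasEigenvalue_or_mem_resolventSet (one_ne_zero (α := ℂ)) with h | h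
  · obtain ⟨v, hv⟩ := h.exists_hasEigenvector
    exact absurd (hinj v (by simpa using hv.apply_eq_smul)) hv.2
  · simpa [spectrum.mem_resolventSet_iff] using h

theorem TGarding.isUnit_adjoint_comp_add [CompleteSpace V] {A T C : V →L[ℂ] V} {α : ℝ}
    (h : TGarding A T C α) : IsUnit (ContinuousLinearMap.adjoint T * A + C) := by
  refine isUnit_of_coercive _ h.pos fun u => ?_
  simpa [inner_add_right, ContinuousLinearMap.adjoint_inner_right] using h.garding u

theorem isUnit_adjoint [CompleteSpace V] {T : V →L[ℂ] V} (h : IsUnit T) :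
    IsUnit (ContinuousLinearMap.adjoint T) := by
  rw [← ContinuousLinearMap.star_eq_adjoint]
  exact h.star

/-- With `B = T* A + C`, which is coercive, `A = (T*)⁻¹ B (1 - B⁻¹ C)`. The last factor is the
identity minus a compact operator, so the Fredholm alternative applies to it. -/
theorem TGarding.isUnit_of_injective [CompleteSpace V] {A T C : V →L[ℂ] V} {α : ℝ}
    (h : TGarding A T C α) (hinj : ∀ u, A u = 0 → u = 0) : IsUnit A := by
  obtain ⟨B, hB⟩ := h.isUnit_adjoint_comp_add
  obtain ⟨D, hD⟩ := isUnit_adjoint h.isUnit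
  have hA : A = ↑D⁻¹ * (B * (1 - ↑B⁻¹ * C)) := by
    rw [mul_sub, mul_one, ← mul_assoc (B : V →L[ℂ] V), Units.mul_inv, one_mul, hB, hD.symm,
      add_sub_cancel_right, ← mul_assoc, Units.inv_mul, one_mul]
  have hu : IsUnit (1 - (↑B⁻¹ : V →L[ℂ] V) * C) := by
    refine isUnit_one_sub_of_compact (h.compact.clm_comp (↑B⁻¹ : V →L[ℂ] V)) fun u hu => ?_
    apply hinj
    rw [hA]
    have : (1 - (↑B⁻¹ : V →L[ℂ] V) * C) u = 0 := by
      rw [_root_.sub_apply, hu]; simp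
    simp only [_root_.mul_apply_eq_comp, this, map_zero]
  rw [hA]
  exact D⁻¹.isUnit.mul (B.isUnit.mul hu)

end Fredholm

/-! ### The analytic Fredholm theorem -/

section AnalyticFredholm

variable {V : Type*} [NormedAddCommGroup V] [InnerProductSpace ℂ V]

/-- A compact operator into a Hilbert space is approximated by its compositions with orthogonal
projections of finite rank. -/
theorem exists_finiteDimensional_norm_sub_le {C : V →L[ℂ] V} (hC : IsCompactOperator C)
    {ε : ℝ} (hε : 0 < ε) : ∃ (E : Submodule ℂ V) (_ : FiniteDimensional ℂ E),
      ∀ u, ‖C u - E.starProjection (C u)‖ ≤ ε * ‖u‖ := by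
  obtain ⟨K, hK, hCK⟩ := hC.image_closedBall_subset_compact 1
  -- The span of a finite `ε`-net of the image of the unit ball works: the orthogonal projection of
  -- `C x` is at least as close to `C x` as the nearest net point.
  obtain ⟨t, ht, hKt⟩ := Metric.totallyBounded_iff.1 hK.totallyBounded ε hε
  have hfin : FiniteDimensional ℂ (Submodule.span ℂ t) := FiniteDimensional.span_of_finite ℂ ht
  refine ⟨Submodule.span ℂ t, hfin, fun u => ?_⟩
  have key : ‖C - (Submodule.span ℂ t).starProjection * C‖ ≤ ε := by
    refine ContinuousLinearMap.opNorm_le_of_unit_norm hε.le fun x hx => ?_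
    have hx' : C x ∈ K := hCK ⟨x, by simp [hx], rfl⟩
    obtain ⟨y, hy, hxy⟩ := mem_iUnion₂.1 (hKt hx')
    have h1 : ‖C x - (Submodule.span ℂ t).starProjection (C x)‖ ≤ ‖C x - y‖ := by
      rw [(Submodule.span ℂ t).starProjection_minimal]
      exact ciInf_le ⟨0, by rintro _ ⟨z, rfl⟩; exact norm_nonneg _⟩
        (⟨y, Submodule.subset_span hy⟩ : Submodule.span ℂ t)
    refine h1.trans ?_
    rw [← dist_eq_norm]
    exact (Metric.mem_ball.1 hxy).le
  exact ((C - (Submodule.span ℂ t).starProjection * C).le_opNorm u).trans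
    (mul_le_mul_of_nonneg_right key (norm_nonneg _))

/-- The determinant of a holomorphic family of operators on a finite dimensional space is
holomorphic. -/
theorem differentiableAt_det {E : Type*} [NormedAddCommGroup E] [NormedSpace ℂ E]
    [FiniteDimensional ℂ E] {M : ℂ → E →L[ℂ] E} {κ : ℂ} (hM : DifferentiableAt ℂ M κ) :
    DifferentiableAt ℂ (fun κ => LinearMap.det (M κ : E →ₗ[ℂ] E)) κ := by
  let b := Module.finBasis ℂ E
  have h : ∀ κ, LinearMap.det (M κ : E →ₗ[ℂ] E) =
      ∑ σ : Equiv.Perm (Fin (Module.finrank ℂ E)), ((Equiv.Perm.sign σ : ℤ) : ℂ) *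
        ∏ i, (LinearMap.toContinuousLinearMap (b.coord (σ i))) (M κ (b i)) := by
    intro κ
    rw [← LinearMap.det_toMatrix b, Matrix.det_apply']
    simp [LinearMap.toMatrix_apply]
  simp_rw [h]
  refine DifferentiableAt.fun_sum fun σ _ => DifferentiableAt.const_mul ?_ _
  refine DifferentiableAt.fun_finsetProd fun i _ => ?_
  exact (LinearMap.toContinuousLinearMap (b.coord (σ i))).differentiableAt.comp κ
    (hM.clm_apply (differentiableAt_const _))

/-- Local form of the analytic Fredholm theorem. -/
theorem eventually_isUnit_or_eventually_not_isUnit [CompleteSpace V] {A : ℂ → V →L[ℂ] V} {κ₀ : ℂ}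
    (hA : ∀ᶠ κ in 𝓝 κ₀, DifferentiableAt ℂ A κ)
    (hG : ∀ᶠ κ in 𝓝 κ₀, ∃ T C α, TGarding (A κ) T C α) :
    (∀ᶠ κ in 𝓝[≠] κ₀, IsUnit (A κ)) ∨ ∀ᶠ κ in 𝓝 κ₀, ¬ IsUnit (A κ) := by
  obtain ⟨T, C, α, h⟩ := hG.self_of_nhds
  obtain ⟨E, _, hE⟩ := exists_finiteDimensional_norm_sub_le h.compact (half_pos h.pos)
  -- `T`, `C` and `E` are frozen at `κ₀`. Replacing `C` by its finite rank part costs half of `α`,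
  -- so `G κ₀` is still coercive, and `G κ` stays invertible for `κ` near `κ₀`.
  let G : ℂ → V →L[ℂ] V := fun κ => ContinuousLinearMap.adjoint T * A κ + E.starProjection * C
  have hG0 : IsUnit (G κ₀) := by
    refine isUnit_of_coercive _ (half_pos h.pos) fun u => ?_
    have h1 := h.garding u
    have h2 : (inner ℂ u (C u)).re - (inner ℂ u (E.starProjection (C u))).re ≤
        α / 2 * ‖u‖ ^ 2 := by
      rw [← Complex.sub_re, ← inner_sub_right]
      refine (Complex.re_le_norm _).trans ((norm_inner_le_norm _ _).trans ?_)
      nlinarith [mul_le_mul_of_nonneg_left (hE u) (norm_nonneg u)]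
    simp only [G, _root_.add_apply, _root_.mul_apply_eq_comp, inner_add_right,
      ContinuousLinearMap.adjoint_inner_right, Complex.add_re]
    linarith
  have hGd : ∀ᶠ κ in 𝓝 κ₀, DifferentiableAt ℂ G κ := by
    filter_upwards [hA] with κ hκ
    exact (hκ.const_mul _).add_const _
  have hGu : ∀ᶠ κ in 𝓝 κ₀, IsUnit (G κ) :=
    hGd.self_of_nhds.continuousAt.eventually (Units.isOpen.mem_nhds hG0)
  -- Reduction to finite dimensions: `A κ u = 0` means `G κ u = P C u` with `P` the projection onto
  -- `E`, that is, `y = G κ u` lies in `E` and is fixed by `P C (G κ)⁻¹`. So the kernels of `A κ`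
  -- and `M κ` correspond, and the determinant of `M κ` detects singularity.
  let M : ℂ → E →L[ℂ] E := fun κ =>
    1 - (E.orthogonalProjectionOnto ∘L C) ∘L (Ring.inverse (G κ) ∘L E.subtypeL)
  have hM : ∀ᶠ κ in 𝓝 κ₀, DifferentiableAt ℂ M κ := by
    filter_upwards [hGd, hGu] with κ h1 h2
    have h3 : DifferentiableAt ℂ (fun κ => Ring.inverse (G κ)) κ := h1.inverse h2
    have h4 : DifferentiableAt ℂ (fun κ => Ring.inverse (G κ) ∘L E.subtypeL) κ :=
      h3.clm_comp (differentiableAt_const _)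
    have h5 : DifferentiableAt ℂ (fun κ =>
        (E.orthogonalProjectionOnto ∘L C) ∘L (Ring.inverse (G κ) ∘L E.subtypeL)) κ :=
      (differentiableAt_const _).clm_comp h4
    exact DifferentiableAt.sub (𝕜 := ℂ) (E := ℂ) (F := E →L[ℂ] E)
      (differentiableAt_const (1 : E →L[ℂ] E)) h5
  have hf : AnalyticAt ℂ (fun κ => LinearMap.det (M κ : E →ₗ[ℂ] E)) κ₀ := by
    obtain ⟨s, hs, hs'⟩ := eventually_iff_exists_mem.1 hM
    exact DifferentiableOn.analyticAt
      (fun κ hκ => (differentiableAt_det (hs' κ hκ)).differentiableWithinAt) hs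
  -- The Gårding inequality at the nearby `κ` itself, not only at `κ₀`, turns non-invertibility of
  -- `A κ` into a nonzero kernel vector.
  have key : ∀ᶠ κ in 𝓝 κ₀, LinearMap.det (M κ : E →ₗ[ℂ] E) = 0 ↔ ¬ IsUnit (A κ) := by
    filter_upwards [hGu, hG] with κ h1 ⟨T', C', α', h'⟩
    have hinv1 : ∀ u, Ring.inverse (G κ) (G κ u) = u := fun u => by
      rw [← _root_.mul_apply_eq_comp, Ring.inverse_mul_cancel _ h1]; rfl
    have hinv2 : ∀ u, G κ (Ring.inverse (G κ) u) = u := fun u => by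
      rw [← _root_.mul_apply_eq_comp, Ring.mul_inverse_cancel _ h1]; rfl
    constructor
    · intro hdet hu
      obtain ⟨y, hy, hy0⟩ := (Submodule.ne_bot_iff _).1
        (LinearMap.bot_lt_ker_of_det_eq_zero hdet).ne'
      have hy1 : E.orthogonalProjectionOnto (C (Ring.inverse (G κ) (y : V))) = y := by
        have : M κ y = 0 := hy
        exact (sub_eq_zero.1 this).symm
      set u := Ring.inverse (G κ) (y : V) with hudef
      have hGu : ContinuousLinearMap.adjoint T (A κ u) + E.starProjection (C u) = y := hinv2 y
      have hPu : E.starProjection (C u) = y := by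
        rw [Submodule.starProjection_apply, hy1]
      have h0 : ContinuousLinearMap.adjoint T (A κ u) = 0 := by
        rw [hPu] at hGu; simpa using hGu
      have hA0 : A κ u = 0 :=
        (ContinuousLinearMap.isUnit_iff_bijective.1 (isUnit_adjoint h.isUnit)).1 (by simpa using h0)
      have hu0 : u = 0 := (ContinuousLinearMap.isUnit_iff_bijective.1 hu).1 (by simpa using hA0)
      apply hy0
      have : (y : V) = 0 := by rw [← hinv2 (y : V), ← hudef, hu0, map_zero]
      exact_mod_cast this
    · intro hu
      by_contra hdet
      apply hu
      refine h'.isUnit_of_injective fun u hu0 => ?_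
      have hGu : G κ u = E.starProjection (C u) := by simp [G, hu0]
      have hyu : Ring.inverse (G κ) (E.orthogonalProjectionOnto (C u) : V) = u := by
        rw [← Submodule.starProjection_apply, ← hGu, hinv1]
      have hMy : M κ (E.orthogonalProjectionOnto (C u)) = 0 := by
        simp only [M, _root_.sub_apply, ContinuousLinearMap.comp_apply, Submodule.subtypeL_apply]
        rw [hyu]; simp
      have hker : LinearMap.ker (M κ : E →ₗ[ℂ] E) = ⊥ := by
        by_contra hne
        exact hdet (by
          by_contra hd
          exact hne (LinearMap.ker_eq_bot_of_injective
            ((LinearMap.isUnit_iff_isUnit_det _).2 (isUnit_iff_ne_zero.2 hd) |> fun h =>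
              ((Module.End.isUnit_iff _).1 h).1)))
      have hy0 : E.orthogonalProjectionOnto (C u) = 0 := by
        have : E.orthogonalProjectionOnto (C u) ∈ LinearMap.ker (M κ : E →ₗ[ℂ] E) := hMy
        rw [hker] at this
        simpa using this
      rw [← hyu, hy0]; simp
  rcases hf.eventually_eq_zero_or_eventually_ne_zero with h0 | h0
  · right
    filter_upwards [h0, key] with κ h1 h2 using h2.1 h1
  · left
    filter_upwards [h0, key.filter_mono nhdsWithin_le_nhds] with κ h1 h2
    by_contra h3
    exact h1 (h2.2 h3)

/-- The analytic Fredholm theorem: invertibility in one point of each connected component implies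
that the singular points are isolated. -/
theorem eventually_isUnit [CompleteSpace V] {A : ℂ → V →L[ℂ] V} {Λ : Set ℂ} (hΛ : IsOpen Λ)
    (hA : DifferentiableOn ℂ A Λ) (hG : ∀ κ ∈ Λ, ∃ T C α, TGarding (A κ) T C α)
    (hinv : ∀ κ₀ ∈ Λ, ∃ κ ∈ connectedComponentIn Λ κ₀, IsUnit (A κ)) {κ₀ : ℂ} (hκ₀ : κ₀ ∈ Λ) :
    ∀ᶠ κ in 𝓝[≠] κ₀, IsUnit (A κ) := by
  have dich : ∀ κ ∈ Λ, (∀ᶠ κ' in 𝓝[≠] κ, IsUnit (A κ')) ∨ ∀ᶠ κ' in 𝓝 κ, ¬ IsUnit (A κ') := by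
    intro κ hκ
    have hmem := hΛ.mem_nhds hκ
    refine eventually_isUnit_or_eventually_not_isUnit ?_ ?_
    · filter_upwards [hΛ.mem_nhds hκ] with κ' hκ'
      exact hA.differentiableAt (hΛ.mem_nhds hκ')
    · filter_upwards [hΛ.mem_nhds hκ] with κ' hκ' using hG κ' hκ'
  set D := connectedComponentIn Λ κ₀ with hD
  have hDc : IsPreconnected D := isPreconnected_connectedComponentIn
  have hDΛ : D ⊆ Λ := connectedComponentIn_subset _ _
  -- `P` and `Q` are open, disjoint and cover the component, so connectedness and the one invertible
  -- point rule out `P`. The neighbourhood built into `Q` makes its openness immediate.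
  let P : Set ℂ := {κ | ∀ᶠ κ' in 𝓝 κ, ¬ IsUnit (A κ')}
  let Q : Set ℂ := {κ | ∃ W ∈ 𝓝 κ, ∀ κ' ∈ W, κ' ∈ Λ ∧ ∀ᶠ κ'' in 𝓝[≠] κ', IsUnit (A κ'')}
  have hPo : IsOpen P := isOpen_setOfPred_eventually_nhds
  have hQo : IsOpen Q := by
    rw [isOpen_iff_mem_nhds]
    rintro κ ⟨W, hW, hW'⟩
    filter_upwards [eventually_mem_nhds_iff.2 hW] with κ' hκ'
    exact ⟨W, hκ', hW'⟩
  have hQ : ∀ κ ∈ Λ, (∀ᶠ κ' in 𝓝[≠] κ, IsUnit (A κ')) → κ ∈ Q := by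
    intro κ hκ hev
    obtain ⟨W, hWo, hκW, hW⟩ := mem_nhdsWithin.1 hev |> fun ⟨u, h1, h2, h3⟩ =>
      (⟨u ∩ Λ, h1.inter hΛ, ⟨h2, hκ⟩, fun x hx hne => h3 ⟨hx.1, hne⟩⟩ :
        ∃ W : Set ℂ, IsOpen W ∧ κ ∈ W ∧ ∀ x ∈ W, x ≠ κ → IsUnit (A x))
    refine ⟨W ∩ Λ, (hWo.inter hΛ).mem_nhds ⟨hκW, hκ⟩, fun κ' hκ' => ⟨hκ'.2, ?_⟩⟩
    rcases dich κ' hκ'.2 with h | h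
    · exact h
    exfalso
    -- Every point of `W` other than `κ` is invertible, so the second alternative at `κ'` would
    -- leave `κ` as the only point near `κ'`; but `ℂ` has no isolated points.
    have h1 : ∀ᶠ x in 𝓝 κ', x = κ := by
      filter_upwards [h, hWo.mem_nhds hκ'.1] with x hx hxW
      by_contra hne
      exact hx (hW x hxW hne)
    have h2 : κ' = κ := h1.self_of_nhds
    subst h2
    have h3 : ∀ᶠ x in 𝓝[≠] κ', False := by
      filter_upwards [h1.filter_mono nhdsWithin_le_nhds, self_mem_nhdsWithin] with x hx hx'
      exact hx' hx
    exact absurd h3 (by simpa using (inferInstance : (𝓝[≠] κ').NeBot).ne)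
  have hQP : Disjoint P Q := by
    rw [Set.disjoint_left]
    rintro κ hP ⟨W, hW, hW'⟩
    have h2 := (hW' κ (mem_of_mem_nhds hW)).2
    have h3 : ∀ᶠ x in 𝓝[≠] κ, False := by
      filter_upwards [h2, Filter.Eventually.filter_mono nhdsWithin_le_nhds hP] with x hx hx'
      exact hx' hx
    exact absurd h3 (by simpa using (inferInstance : (𝓝[≠] κ).NeBot).ne)
  have hcov : D ⊆ P ∪ Q := fun κ hκ => (dich κ (hDΛ hκ)).symm.imp id (hQ κ (hDΛ hκ))
  obtain ⟨κ₁, hκ₁, hu⟩ := hinv κ₀ hκ₀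
  have hmem : κ₀ ∈ D := mem_connectedComponentIn hκ₀
  rcases hcov hmem with h | h
  · exfalso
    have hκ₁Q : κ₁ ∈ Q := (hcov hκ₁).resolve_left fun hP : ∀ᶠ κ' in 𝓝 κ₁, ¬ IsUnit (A κ') =>
      hP.self_of_nhds hu
    obtain ⟨x, -, hx⟩ := hDc P Q hPo hQo hcov ⟨κ₀, hmem, h⟩ ⟨κ₁, hκ₁, hκ₁Q⟩
    exact Set.disjoint_left.1 hQP hx.1 hx.2
  · obtain ⟨W, hW, hW'⟩ := h
    exact (hW' κ₀ (mem_of_mem_nhds hW)).2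

end AnalyticFredholm

/-! ### Stability of Galerkin approximations -/

section Galerkin

variable {V : Type*} [NormedAddCommGroup V] [InnerProductSpace ℂ V]

/-- The Gårding inequality for `A` with the invertible operator `T` and the compact operator `C`,
together with approximations of `T` and of `T⁻¹ = R` which preserve the subspaces `W k`. -/
structure GalerkinGarding (A T R C : V →L[ℂ] V) (α : ℝ) (W : ℕ → Submodule ℂ V)
    (Tk Rk : ℕ → V →L[ℂ] V) : Prop where
  pos : 0 < α
  mul_eq_one : T * R = 1
  mul_eq_one' : R * T = 1
  compact : IsCompactOperator C
  garding : ∀ u, α * ‖u‖ ^ 2 ≤ (inner ℂ (T u) (A u)).re + (inner ℂ u (C u)).re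
  tendsto : Tendsto Tk atTop (𝓝 T)
  tendsto' : Tendsto Rk atTop (𝓝 R)
  mem : ∀ᶠ k in atTop, ∀ u ∈ W k, Tk k u ∈ W k
  mem' : ∀ᶠ k in atTop, ∀ u ∈ W k, Rk k u ∈ W k

/-- Every vector is a limit of elements of the subspaces `W k`. -/
def ApproximatesAll (W : ℕ → Submodule ℂ V) : Prop :=
  ∀ v, ∃ w : ℕ → V, (∀ᶠ k in atTop, w k ∈ W k) ∧ Tendsto w atTop (𝓝 v)

variable {A T R C : V →L[ℂ] V} {α : ℝ} {W : ℕ → Submodule ℂ V} {Tk Rk : ℕ → V →L[ℂ] V}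

theorem GalerkinGarding.tGarding (h : GalerkinGarding A T R C α W Tk Rk) : TGarding A T C α :=
  ⟨h.pos, ⟨⟨T, R, h.mul_eq_one, h.mul_eq_one'⟩, rfl⟩, h.compact, h.garding⟩

/-- A bounded sequence of approximate Galerkin eigenvectors has a limit point, which is an
eigenvector. -/
theorem GalerkinGarding.exists_ne_zero_of_seq [CompleteSpace V]
    (h : GalerkinGarding A T R C α W Tk Rk) (hd : ApproximatesAll W) {φ : ℕ → ℕ}
    (hφ : StrictMono φ) {u : ℕ → V} (huW : ∀ n, u n ∈ W (φ n)) (hu1 : ∀ n, ‖u n‖ = 1)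
    (hu : ∀ n, ∀ v ∈ W (φ n), ‖inner ℂ v (A (u n))‖ ≤ 1 / ((n : ℝ) + 1) * ‖v‖) :
    ∃ w, w ≠ 0 ∧ A w = 0 := by
  obtain ⟨K, hK, hCK⟩ := h.compact.image_closedBall_subset_compact 1
  obtain ⟨g, -, ψ, hψ, hg⟩ := hK.tendsto_subseq (x := fun n => C (u n))
    fun n => hCK ⟨u n, by simp [hu1], rfl⟩
  have hB := h.tGarding.isUnit_adjoint_comp_add
  -- Heuristically `T* A (u n)` tends to `0` weakly, so `B (u n)` has the same limit `g` as `C (u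
  -- n)` along the subsequence. This makes `B⁻¹ g` the candidate limit.
  obtain ⟨w, hw⟩ := (ContinuousLinearMap.isUnit_iff_bijective.1 hB).2 g
  obtain ⟨w', hw'W, hw'⟩ := hd w
  have hχ : Tendsto (φ ∘ ψ) atTop atTop := (hφ.comp hψ).tendsto_atTop
  have hε : Tendsto (fun n => 1 / ((ψ n : ℝ) + 1)) atTop (𝓝 0) :=
    tendsto_one_div_add_atTop_nhds_zero_nat.comp hψ.tendsto_atTop
  have hw'χ := hw'.comp hχ
  have hTχ := h.tendsto.comp hχ
  set B := ContinuousLinearMap.adjoint T * A + C with hBdef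
  have hBu : ∀ x, B x = ContinuousLinearMap.adjoint T (A x) + C x := fun x => rfl
  -- The four terms bound, in order: the error of `Tk`, the residual tested with an element of the
  -- discrete space, the error in `C (u n) → g`, and the error of approximating `w` by `w'`.
  let b : ℕ → ℝ := fun n =>
    ‖T - Tk (φ (ψ n))‖ * (1 + ‖w' (φ (ψ n))‖) * ‖A‖ +
    1 / ((ψ n : ℝ) + 1) * (‖Tk (φ (ψ n))‖ * (1 + ‖w' (φ (ψ n))‖)) +
    (1 + ‖w' (φ (ψ n))‖) * ‖C (u (ψ n)) - g‖ + ‖w' (φ (ψ n)) - w‖ * (‖B‖ + ‖g‖)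
  have hb : Tendsto b atTop (𝓝 0) := by
    have h1 : Tendsto (fun n => ‖T - Tk (φ (ψ n))‖) atTop (𝓝 0) := by
      simpa using (hTχ.const_sub T).norm
    have h2 : Tendsto (fun n => 1 + ‖w' (φ (ψ n))‖) atTop (𝓝 (1 + ‖w‖)) :=
      hw'χ.norm.const_add 1
    have h3 : Tendsto (fun n => ‖C (u (ψ n)) - g‖) atTop (𝓝 0) := by
      simpa using (hg.sub_const g).norm
    have h4 : Tendsto (fun n => ‖w' (φ (ψ n)) - w‖) atTop (𝓝 0) := by
      simpa using (hw'χ.sub_const w).norm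
    have h5 : Tendsto (fun n => ‖Tk (φ (ψ n))‖) atTop (𝓝 ‖T‖) := hTχ.norm
    simpa [b] using ((((h1.mul h2).mul_const ‖A‖).add (hε.mul (h5.mul h2))).add (h2.mul h3)).add
      (h4.mul_const (‖B‖ + ‖g‖))
  have hle : ∀ᶠ n in atTop, α * ‖u (ψ n) - w‖ ^ 2 ≤ b n := by
    filter_upwards [hχ.eventually hw'W, hχ.eventually h.mem] with n hn1 hn2
    simp only [Function.comp_apply] at hn1 hn2
    set x := u (ψ n) with hx
    set y := w' (φ (ψ n)) with hy
    have hxy : ‖x - y‖ ≤ 1 + ‖y‖ := (norm_sub_le _ _).trans (by rw [hu1])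
    have hxyW : x - y ∈ W (φ (ψ n)) := (W _).sub_mem (huW _) hn1
    have h0 : α * ‖x - w‖ ^ 2 ≤ (inner ℂ (x - w) (B (x - w))).re := by
      have := h.garding (x - w)
      rwa [← ContinuousLinearMap.adjoint_inner_right, ← Complex.add_re, ← inner_add_right,
        ← hBu] at this
    -- The residual bound applies only to discrete test vectors. Therefore `x - w` is split at the
    -- discrete `y` and `T` is replaced by `Tk`, which makes `Tk (x - y)` admissible.
    have h1 : inner ℂ (x - w) (B (x - w)) = inner ℂ ((T - Tk (φ (ψ n))) (x - y)) (A x) +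
        inner ℂ (Tk (φ (ψ n)) (x - y)) (A x) + inner ℂ (x - y) (C x - g) +
        inner ℂ (y - w) (B x - g) := by
      have e1 : B (x - w) = B x - g := by rw [map_sub, hw]
      have e2 : x - w = (x - y) + (y - w) := by abel
      have e3 : inner ℂ (T (x - y)) (A x) =
          inner ℂ (x - y) (ContinuousLinearMap.adjoint T (A x)) :=
        (ContinuousLinearMap.adjoint_inner_right _ _ _).symm
      rw [e1, e2, inner_add_left, ← inner_add_left ((T - Tk (φ (ψ n))) (x - y)),
        _root_.sub_apply, sub_add_cancel, e3, ← inner_add_right, hBu, add_sub_assoc]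
    rw [h1] at h0
    refine h0.trans ((Complex.re_le_norm _).trans ?_)
    refine (norm_add_le _ _).trans (add_le_add ((norm_add_le _ _).trans
      (add_le_add ((norm_add_le _ _).trans (add_le_add ?_ ?_)) ?_)) ?_)
    · refine (norm_inner_le_norm _ _).trans (mul_le_mul ?_ ?_ (norm_nonneg _) (by positivity))
      · exact (ContinuousLinearMap.le_opNorm _ _).trans (by gcongr)
      · simpa [hx, hu1] using A.le_opNorm x
    · refine (hu _ _ (hn2 _ hxyW)).trans ?_
      gcongr
      exact (ContinuousLinearMap.le_opNorm _ _).trans (by gcongr)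
    · exact (norm_inner_le_norm _ _).trans (by gcongr)
    · refine (norm_inner_le_norm _ _).trans ?_
      gcongr
      refine (norm_sub_le _ _).trans ?_
      gcongr
      simpa [hx, hu1] using B.le_opNorm x
  have hlim : Tendsto (fun n => u (ψ n)) atTop (𝓝 w) := by
    rw [tendsto_iff_norm_sub_tendsto_zero]
    have h1 : Tendsto (fun n => ‖u (ψ n) - w‖ ^ 2) atTop (𝓝 0) := by
      refine squeeze_zero' (Eventually.of_forall fun n => sq_nonneg _)
        (hle.mono fun n hn => (le_div_iff₀' h.pos).2 hn) ?_
      simpa using hb.div_const α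
    simpa using h1.sqrt
  refine ⟨w, ?_, ?_⟩
  · have : ‖w‖ = 1 := tendsto_nhds_unique hlim.norm (by simp [hu1])
    rw [← norm_ne_zero_iff, this]
    exact one_ne_zero
  -- Each `v` is a limit of discrete test vectors, on which the residuals tend to zero.
  · refine ext_inner_left ℂ fun v => ?_
    obtain ⟨v', hv'W, hv'⟩ := hd v
    have h1 : Tendsto (fun n => inner ℂ (v' (φ (ψ n))) (A (u (ψ n)))) atTop
        (𝓝 (inner ℂ v (A w))) :=
      (hv'.comp hχ).inner ((A.continuous.tendsto _).comp hlim)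
    have h2 : Tendsto (fun n => inner ℂ (v' (φ (ψ n))) (A (u (ψ n)))) atTop (𝓝 0) := by
      refine squeeze_zero_norm' ?_ (by simpa using hε.mul (hv'.comp hχ).norm)
      filter_upwards [hχ.eventually hv'W] with n hn
      simpa using hu _ _ hn
    rw [inner_zero_right]
    exact tendsto_nhds_unique h1 h2

/-- Stability of the Galerkin method for an injective operator. -/
theorem GalerkinGarding.exists_stable [CompleteSpace V] (h : GalerkinGarding A T R C α W Tk Rk)
    (hd : ApproximatesAll W) (hinj : ∀ u, A u = 0 → u = 0) :
    ∃ c > 0, ∀ᶠ k in atTop, ∀ u ∈ W k,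
      (∀ v ∈ W k, ‖inner ℂ v (A u)‖ ≤ c * ‖u‖ * ‖v‖) → u = 0 := by
  -- If no constant works, each `1 / (n + 1)` fails for arbitrarily large `k`. A strictly increasing
  -- choice of such `k`, after normalisation, gives a sequence of approximate kernel vectors.
  by_contra! hcon
  have hP : ∀ n : ℕ, ∃ᶠ k in atTop, ∃ u ∈ W k,
      (∀ v ∈ W k, ‖inner ℂ v (A u)‖ ≤ 1 / ((n : ℝ) + 1) * ‖u‖ * ‖v‖) ∧ u ≠ 0 :=
    fun n => hcon _ (by positivity)
  obtain ⟨φ, hφ, hφP⟩ := extraction_forall_of_frequently hP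
  choose u huW hu hu0 using hφP
  obtain ⟨w, hw0, hw⟩ := h.exists_ne_zero_of_seq hd hφ
    (u := fun n => ((‖u n‖⁻¹ : ℝ) : ℂ) • u n)
    (fun n => (W _).smul_mem _ (huW n)) (fun n => by
      rw [norm_smul, Complex.norm_real, norm_inv, norm_norm,
        inv_mul_cancel₀ (norm_ne_zero_iff.2 (hu0 n)) ])
    (fun n v hv => by
      have hpos := norm_pos_iff.2 (hu0 n)
      rw [map_smul, inner_smul_right, norm_mul, Complex.norm_real, norm_inv, norm_norm,
        inv_mul_le_iff₀ hpos]
      refine (hu n v hv).trans (le_of_eq ?_)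
      ring)
  exact hw0 (hinj w hw)

/-- The compression of an operator to a subspace. -/
noncomputable def compress (A : V →L[ℂ] V) (W : Submodule ℂ V) [W.HasOrthogonalProjection] :
    W →L[ℂ] W :=
  W.orthogonalProjectionOnto ∘L (A ∘L W.subtypeL)

theorem inner_compress (A : V →L[ℂ] V) (W : Submodule ℂ V) [W.HasOrthogonalProjection] (u v : W) :
    inner ℂ v (compress A W u) = inner ℂ (v : V) (A u) := by
  simp [compress]

theorem norm_compress_apply_le (A : V →L[ℂ] V) (W : Submodule ℂ V) [W.HasOrthogonalProjection]
    (u : W) : ‖compress A W u‖ ≤ ‖A u‖ :=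
  W.norm_orthogonalProjectionOnto_apply_le _

theorem differentiableAt_compress {A : ℂ → V →L[ℂ] V} {κ : ℂ} (hA : DifferentiableAt ℂ A κ)
    (W : Submodule ℂ V) [W.HasOrthogonalProjection] :
    DifferentiableAt ℂ (fun κ => compress (A κ) W) κ := by
  have h1 : DifferentiableAt ℂ (fun κ => A κ ∘L W.subtypeL) κ :=
    hA.clm_comp (differentiableAt_const _)
  exact (differentiableAt_const _).clm_comp h1

/-- A Gårding inequality is inherited by compressions to subspaces which are preserved by an
approximately invertible operator `T'`. -/
theorem tGarding_compress (A C : V →L[ℂ] V) (hC : IsCompactOperator C) {T' R' : V →L[ℂ] V}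
    {α : ℝ} (hα : 0 < α) (W : Submodule ℂ V) [CompleteSpace W] [W.HasOrthogonalProjection]
    (hT : ∀ u ∈ W, T' u ∈ W) (hR : ∀ u ∈ W, R' u ∈ W) (h1 : ‖1 - T' * R'‖ < 1)
    (h2 : ‖1 - R' * T'‖ < 1)
    (hG : ∀ u ∈ W, α * ‖u‖ ^ 2 ≤ (inner ℂ (T' u) (A u)).re + (inner ℂ u (C u)).re) :
    ∃ T C α, TGarding (compress A W) T C α := by
  let T : W →L[ℂ] W := (T' ∘L W.subtypeL).codRestrict W fun u => hT u u.2
  let R : W →L[ℂ] W := (R' ∘L W.subtypeL).codRestrict W fun u => hR u u.2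
  -- `R'` inverts `T'` only approximately, but both restrict to `W`, where the products stay within
  -- distance less than one of the identity. Invertibility of `T * R` makes `T` surjective, that of
  -- `R * T` makes it injective.
  have hTR : IsUnit (T * R) := by
    have : ‖1 - T * R‖ < 1 := by
      refine lt_of_le_of_lt (ContinuousLinearMap.opNorm_le_bound _ (norm_nonneg _) fun u => ?_) h1
      exact (1 - T' * R').le_opNorm (u : V)
    simpa using isUnit_one_sub_of_norm_lt_one (R := W →L[ℂ] W) this
  have hRT : IsUnit (R * T) := by
    have : ‖1 - R * T‖ < 1 := by
      refine lt_of_le_of_lt (ContinuousLinearMap.opNorm_le_bound _ (norm_nonneg _) fun u => ?_) h2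
      exact (1 - R' * T').le_opNorm (u : V)
    simpa using isUnit_one_sub_of_norm_lt_one (R := W →L[ℂ] W) this
  have hTu : IsUnit T := by
    rw [ContinuousLinearMap.isUnit_iff_bijective] at hTR hRT ⊢
    exact ⟨fun x y hxy => hRT.1 (congrArg R hxy), fun x => (hTR.2 x).imp' R fun _ h => h⟩
  refine ⟨T, compress C W, α, hα, hTu, ?_, fun u => ?_⟩
  · exact (hC.comp_clm W.subtypeL).clm_comp W.orthogonalProjectionOnto
  · rw [inner_compress, inner_compress]
    exact hG u u.2

/-- Uniform discrete Gårding inequalities for all operators close to `A`. -/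
theorem GalerkinGarding.eventually_tGarding_compress (h : GalerkinGarding A T R C α W Tk Rk) :
    ∃ ε > 0, ∀ᶠ k in atTop, ∀ [CompleteSpace (W k)] [(W k).HasOrthogonalProjection],
      ∀ A' : V →L[ℂ] V, ‖A' - A‖ < ε → ∃ T' C' α', TGarding (compress A' (W k)) T' C' α' := by
  have hpos := h.pos
  have hc : 0 < 4 * (‖T‖ + 1) := by positivity
  have hd : 0 < 4 * (‖A‖ + 1) := by positivity
  -- Replacing `T` by `Tk k` and `A` by `A'` each costs at most a quarter of `α`, which leaves `α /
  -- 2`. The summand one bounds `‖Tk k‖` eventually and keeps denominators positive.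
  refine ⟨α / (4 * (‖T‖ + 1)), by positivity, ?_⟩
  have h1 : ∀ᶠ k in atTop, ‖1 - Tk k * Rk k‖ < 1 := by
    have : Tendsto (fun k => ‖1 - Tk k * Rk k‖) atTop (𝓝 0) := by
      simpa [h.mul_eq_one] using ((h.tendsto.mul h.tendsto').const_sub 1).norm
    exact this.eventually_lt_const one_pos
  have h2 : ∀ᶠ k in atTop, ‖1 - Rk k * Tk k‖ < 1 := by
    have : Tendsto (fun k => ‖1 - Rk k * Tk k‖) atTop (𝓝 0) := by
      simpa [h.mul_eq_one'] using ((h.tendsto'.mul h.tendsto).const_sub 1).norm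
    exact this.eventually_lt_const one_pos
  have h3 : ∀ᶠ k in atTop, ‖Tk k - T‖ < α / (4 * (‖A‖ + 1)) :=
    (tendsto_iff_norm_sub_tendsto_zero.1 h.tendsto).eventually_lt_const (by positivity)
  have h4 : ∀ᶠ k in atTop, ‖Tk k‖ < ‖T‖ + 1 := h.tendsto.norm.eventually_lt_const (by linarith)
  filter_upwards [h1, h2, h3, h4, h.mem, h.mem'] with k h1 h2 h3 h4 h5 h6 _ _ A' hA'
  refine tGarding_compress A' C h.compact (half_pos h.pos) (W k) h5 h6 h1 h2 fun u _ => ?_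
  have e : inner ℂ (T u) (A u) = inner ℂ (Tk k u) (A' u) - inner ℂ ((Tk k - T) u) (A u) -
      inner ℂ (Tk k u) ((A' - A) u) := by
    simp only [_root_.sub_apply, inner_sub_left, inner_sub_right]
    ring
  have h7 := h.garding u
  have h8 : ‖inner ℂ ((Tk k - T) u) (A u)‖ ≤ α / 4 * ‖u‖ ^ 2 := by
    refine (norm_inner_le_norm _ _).trans ((mul_le_mul (ContinuousLinearMap.le_opNorm _ _)
      (ContinuousLinearMap.le_opNorm _ _) (norm_nonneg _) (by positivity)).trans ?_)
    have : ‖Tk k - T‖ * ‖A‖ ≤ α / 4 := by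
      have := (lt_div_iff₀ hd).1 h3
      nlinarith [norm_nonneg (Tk k - T)]
    nlinarith [sq_nonneg ‖u‖]
  have h9 : ‖inner ℂ (Tk k u) ((A' - A) u)‖ ≤ α / 4 * ‖u‖ ^ 2 := by
    refine (norm_inner_le_norm _ _).trans ((mul_le_mul (ContinuousLinearMap.le_opNorm _ _)
      (ContinuousLinearMap.le_opNorm _ _) (norm_nonneg _) (by positivity)).trans ?_)
    have : ‖Tk k‖ * ‖A' - A‖ ≤ α / 4 := by
      have := (lt_div_iff₀ hc).1 hA'
      nlinarith [norm_nonneg (A' - A), norm_nonneg (Tk k)]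
    nlinarith [sq_nonneg ‖u‖]
  rw [e, Complex.sub_re, Complex.sub_re] at h7
  have h10 := (abs_le.1 (Complex.abs_re_le_norm (inner ℂ ((Tk k - T) u) (A u)))).1
  have h11 := (abs_le.1 (Complex.abs_re_le_norm (inner ℂ (Tk k u) ((A' - A) u)))).1
  linarith

end Galerkin

/-! ### Convergence of Galerkin eigenvalues near a fixed parameter -/

section Eigenvalues

variable {V : Type*} [NormedAddCommGroup V] [InnerProductSpace ℂ V] [CompleteSpace V]
  {A : ℂ → V →L[ℂ] V} {Λ : Set ℂ} {W : ℕ → Submodule ℂ V}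

/-- Uniform stability in a neighbourhood of a parameter with injective operator. -/
theorem exists_stable_nhds (hΛ : IsOpen Λ) (hA : ContinuousOn A Λ) (hd : ApproximatesAll W)
    (hG : ∀ κ ∈ Λ, ∃ T R C α Tk Rk, GalerkinGarding (A κ) T R C α W Tk Rk) {κ₀ : ℂ}
    (hκ₀ : κ₀ ∈ Λ) (hinj : ∀ u, A κ₀ u = 0 → u = 0) :
    ∃ U ∈ 𝓝 κ₀, ∃ c > 0, ∀ᶠ k in atTop, ∀ κ ∈ U, ∀ u ∈ W k,
      (∀ v ∈ W k, ‖inner ℂ v (A κ u)‖ ≤ c * ‖u‖ * ‖v‖) → u = 0 := by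
  obtain ⟨T, R, C, α, Tk, Rk, h⟩ := hG κ₀ hκ₀
  obtain ⟨c, hc, hst⟩ := h.exists_stable hd hinj
  have hcont : Tendsto A (𝓝 κ₀) (𝓝 (A κ₀)) := hA.continuousAt (hΛ.mem_nhds hκ₀)
  refine ⟨{κ | ‖A κ - A κ₀‖ < c / 2},
    (tendsto_iff_norm_sub_tendsto_zero.1 hcont).eventually_lt_const (half_pos hc), c / 2,
    half_pos hc, ?_⟩
  filter_upwards [hst] with k hk κ hκ u hu huv
  refine hk u hu fun v hv => ?_
  have e : inner ℂ v (A κ₀ u) = inner ℂ v (A κ u) - inner ℂ v ((A κ - A κ₀) u) := by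
    simp
  rw [e]
  refine (norm_sub_le _ _).trans ?_
  have h1 : ‖inner ℂ v ((A κ - A κ₀) u)‖ ≤ c / 2 * ‖u‖ * ‖v‖ := by
    refine (norm_inner_le_norm _ _).trans ?_
    rw [mul_comm]
    gcongr
    exact (ContinuousLinearMap.le_opNorm _ _).trans (by gcongr)
  linarith [huv v hv]

/-- An isolated eigenvalue is approximated by Galerkin eigenvalues. -/
theorem eventually_exists_galerkin_eigenvalue (hΛ : IsOpen Λ) (hA : DifferentiableOn ℂ A Λ)
    (hd : ApproximatesAll W) (hW : ∀ᶠ k in atTop, IsClosed (W k : Set V))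
    (hG : ∀ κ ∈ Λ, ∃ T R C α Tk Rk, GalerkinGarding (A κ) T R C α W Tk Rk) {κ₀ : ℂ}
    (hκ₀ : κ₀ ∈ Λ) {u₀ : V} (hu₀ : u₀ ≠ 0) (hAu₀ : A κ₀ u₀ = 0)
    (hiso : ∀ᶠ κ in 𝓝[≠] κ₀, ∀ u, A κ u = 0 → u = 0) {ε : ℝ} (hε : 0 < ε) :
    ∀ᶠ k in atTop, ∃ κ ∈ Λ, dist κ κ₀ < ε ∧
      ∃ u ∈ W k, u ≠ 0 ∧ ∀ v ∈ W k, inner ℂ v (A κ u) = 0 := by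
  obtain ⟨δ, hδ, hδΛ⟩ := Metric.isOpen_iff.1 hΛ κ₀ hκ₀
  obtain ⟨δ', hδ', hδi⟩ := Metric.mem_nhdsWithin_iff.1 hiso
  obtain ⟨r, hr, hrlt⟩ := exists_between (lt_min (lt_min hδ hδ') hε)
  have hrδ : r < δ := hrlt.trans_le ((min_le_left _ _).trans (min_le_left _ _))
  have hrδ' : r < δ' := hrlt.trans_le ((min_le_left _ _).trans (min_le_right _ _))
  have hrε : r < ε := hrlt.trans_le (min_le_right _ _)
  have hballΛ : Metric.closedBall κ₀ r ⊆ Λ := (Metric.closedBall_subset_ball hrδ).trans hδΛ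
  -- There are no eigenvalues on the circle, so the local stability constants combine by compactness
  -- into one that does not depend on `k`.
  have hsph : ∃ c > 0, ∀ᶠ k in atTop, ∀ κ ∈ Metric.sphere κ₀ r, ∀ u ∈ W k,
      (∀ v ∈ W k, ‖inner ℂ v (A κ u)‖ ≤ c * ‖u‖ * ‖v‖) → u = 0 := by
    refine (isCompact_sphere κ₀ r).induction_on (p := fun s => ∃ c > 0, ∀ᶠ k in atTop, ∀ κ ∈ s,
      ∀ u ∈ W k, (∀ v ∈ W k, ‖inner ℂ v (A κ u)‖ ≤ c * ‖u‖ * ‖v‖) → u = 0)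
      ⟨1, one_pos, by simp⟩ ?_ ?_ ?_
    · rintro s t hst ⟨c, hc, h⟩
      exact ⟨c, hc, h.mono fun k hk κ hκ => hk κ (hst hκ)⟩
    · rintro s t ⟨c, hc, h⟩ ⟨c', hc', h'⟩
      refine ⟨min c c', lt_min hc hc', ?_⟩
      filter_upwards [h, h'] with k hk hk' κ hκ u hu huv
      rcases hκ with hκ | hκ
      · exact hk κ hκ u hu fun v hv => (huv v hv).trans (by gcongr; exact min_le_left _ _)
      · exact hk' κ hκ u hu fun v hv => (huv v hv).trans (by gcongr; exact min_le_right _ _)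
    · intro κ hκ
      have hne : κ ≠ κ₀ := by
        rintro rfl
        simp only [Metric.mem_sphere, dist_self] at hκ
        exact hr.ne hκ
      obtain ⟨U, hU, c, hc, h⟩ := exists_stable_nhds hΛ hA.continuousOn hd hG
        (hballΛ (Metric.sphere_subset_closedBall hκ))
        (hδi ⟨Metric.mem_ball.2 ((Metric.mem_sphere.1 hκ).trans_lt hrδ'), hne⟩)
      exact ⟨U, mem_nhdsWithin_of_mem_nhds hU, c, hc, h⟩
  -- The spaces `W k` may be infinite dimensional, so a Gårding inequality is needed to conclude
  -- that an injective compression is invertible. Compactness gives it on the whole disc for all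
  -- large `k` at once.
  have hfred : ∀ᶠ k in atTop, ∀ κ ∈ Metric.closedBall κ₀ r, ∀ [CompleteSpace (W k)]
      [(W k).HasOrthogonalProjection], ∃ T C α, TGarding (compress (A κ) (W k)) T C α := by
    refine (isCompact_closedBall κ₀ r).induction_on (p := fun s => ∀ᶠ k in atTop, ∀ κ ∈ s,
      ∀ [CompleteSpace (W k)] [(W k).HasOrthogonalProjection],
        ∃ T C α, TGarding (compress (A κ) (W k)) T C α) (by simp) ?_ ?_ ?_
    · intro s t hst h
      exact h.mono fun k hk κ hκ => hk κ (hst hκ)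
    · intro s t h h'
      filter_upwards [h, h'] with k hk hk' κ hκ
      exact hκ.elim (fun h => hk κ h) fun h => hk' κ h
    · intro κ hκ
      obtain ⟨T, R, C, α, Tk, Rk, h⟩ := hG κ (hballΛ hκ)
      obtain ⟨η, hη, hk⟩ := h.eventually_tGarding_compress
      have hcont : Tendsto A (𝓝 κ) (𝓝 (A κ)) :=
        hA.continuousOn.continuousAt (hΛ.mem_nhds (hballΛ hκ))
      refine ⟨{κ' | ‖A κ' - A κ‖ < η}, mem_nhdsWithin_of_mem_nhds
        ((tendsto_iff_norm_sub_tendsto_zero.1 hcont).eventually_lt_const hη), ?_⟩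
      filter_upwards [hk] with k hk κ' hκ' _ _
      exact hk (A κ') hκ'
  obtain ⟨c, hc, hsph⟩ := hsph
  obtain ⟨w, hwW, hw⟩ := hd u₀
  -- The discrete approximations of the eigenvector have small residual at the centre; this is what
  -- contradicts a uniform bound of the inverse there.
  have hsmall : ∀ᶠ k in atTop, ‖A κ₀ (w k)‖ < c * ‖w k‖ := by
    have h1 : Tendsto (fun k => ‖A κ₀ (w k)‖) atTop (𝓝 0) := by
      simpa [hAu₀] using (((A κ₀).continuous.tendsto _).comp hw).norm
    exact h1.eventually_lt (hw.norm.const_mul c) (mul_pos hc (norm_pos_iff.2 hu₀))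
  filter_upwards [hsph, hfred, hW, hwW, hsmall] with k hsph hfred hW hwW hsmall
  have : CompleteSpace (W k) := hW.completeSpace_coe
  by_contra! hcon
  have hinj : ∀ κ ∈ Metric.closedBall κ₀ r, IsUnit (compress (A κ) (W k)) := by
    intro κ hκ
    obtain ⟨T, C, α, h⟩ := hfred κ hκ
    refine h.isUnit_of_injective fun u hu => ?_
    by_contra hne
    obtain ⟨v, hv, hne'⟩ := hcon κ (hballΛ hκ) ((Metric.mem_closedBall.1 hκ).trans_lt hrε) u u.2
      (by simpa using hne)
    apply hne'
    rw [← inner_compress (A κ) (W k) u ⟨v, hv⟩, hu, inner_zero_right]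
  -- Without discrete eigenvalues in the disc the compressed inverse is holomorphic on it, and
  -- stability on the circle bounds it there by `c⁻¹`.
  let F : ℂ → W k →L[ℂ] W k := fun κ => Ring.inverse (compress (A κ) (W k))
  have hF : ∀ κ ∈ Metric.closedBall κ₀ r, DifferentiableAt ℂ F κ := fun κ hκ =>
    DifferentiableAt.inverse (𝕜 := ℂ) (R := W k →L[ℂ] W k)
      (differentiableAt_compress (hA.differentiableAt (hΛ.mem_nhds (hballΛ hκ))) (W k)) (hinj κ hκ)
  have hFd : DiffContOnCl ℂ F (Metric.ball κ₀ r) := by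
    refine DifferentiableOn.diffContOnCl fun κ hκ => ?_
    rw [closure_ball κ₀ hr.ne'] at hκ
    exact (hF κ hκ).differentiableWithinAt
  have hFb : ∀ κ ∈ frontier (Metric.ball κ₀ r), ‖F κ‖ ≤ c⁻¹ := by
    intro κ hκ
    rw [frontier_ball κ₀ hr.ne'] at hκ
    have hu := hinj κ (Metric.sphere_subset_closedBall hκ)
    refine ContinuousLinearMap.opNorm_le_bound _ (inv_pos.2 hc).le fun x => ?_
    have hx : compress (A κ) (W k) (F κ x) = x := by
      rw [← _root_.mul_apply_eq_comp, Ring.mul_inverse_cancel _ hu]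
      rfl
    rw [← div_eq_inv_mul, le_div_iff₀' hc]
    by_contra! hlt
    have h0 : (F κ x : V) = 0 := by
      refine hsph κ hκ _ (F κ x).2 fun v hv => ?_
      rw [← inner_compress (A κ) (W k) (F κ x) ⟨v, hv⟩, hx]
      refine (norm_inner_le_norm _ _).trans ?_
      rw [mul_comm]
      exact mul_le_mul_of_nonneg_right hlt.le (norm_nonneg _)
    have h1 : F κ x = 0 := by exact_mod_cast h0
    rw [h1] at hlt
    simp only [norm_zero, mul_zero] at hlt
    exact absurd hlt (norm_nonneg x).not_gt
  -- The maximum principle carries the bound to the eigenvalue itself, where stability is not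
  -- available directly.
  have hF0 : ‖F κ₀‖ ≤ c⁻¹ := Complex.norm_le_of_forall_mem_frontier_norm_le Metric.isBounded_ball
    hFd hFb (subset_closure (Metric.mem_ball_self hr))
  have hw' : F κ₀ (compress (A κ₀) (W k) ⟨w k, hwW⟩) = ⟨w k, hwW⟩ := by
    rw [← _root_.mul_apply_eq_comp,
      Ring.inverse_mul_cancel _ (hinj κ₀ (Metric.mem_closedBall_self hr.le))]
    rfl
  have h1 : ‖w k‖ ≤ c⁻¹ * ‖A κ₀ (w k)‖ := by
    calc ‖w k‖ = ‖F κ₀ (compress (A κ₀) (W k) ⟨w k, hwW⟩)‖ := by rw [hw']; rfl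
      _ ≤ ‖F κ₀‖ * ‖compress (A κ₀) (W k) ⟨w k, hwW⟩‖ := ContinuousLinearMap.le_opNorm _ _
      _ ≤ c⁻¹ * ‖A κ₀ (w k)‖ := mul_le_mul hF0 (norm_compress_apply_le _ _ _) (norm_nonneg _)
        (inv_pos.2 hc).le
  rw [← div_eq_inv_mul, le_div_iff₀' hc] at h1
  exact absurd hsmall h1.not_gt

end Eigenvalues

/-! ### From pointwise avoidance and approximation to convergence of sets -/

section SetConvergence

variable {X : Type*} [PseudoEMetricSpace X] {Λ S : Set X} {Sk : ℕ → Set X}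

theorem isDiscrete_and_not_accPt (hSΛ : S ⊆ Λ) (hiso : ∀ κ ∈ Λ, ∀ᶠ κ' in 𝓝[≠] κ, κ' ∉ S) :
    IsDiscrete S ∧ ∀ κ ∈ Λ, ¬ AccPt κ (𝓟 S) := by
  have h : ∀ κ ∈ Λ, 𝓝[≠] κ ⊓ 𝓟 S = ⊥ := fun κ hκ => by
    have := hiso κ hκ
    rwa [← disjoint_iff, disjoint_principal_right]
  exact ⟨isDiscrete_iff_nhdsNE.2 fun κ hκ => h κ (hSΛ hκ),
    fun κ hκ hacc => hacc.ne (h κ hκ)⟩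

/-- If the sets `Sk k` eventually avoid a neighbourhood of each point outside `S`, then their points
in a compact set approach `S`. -/
theorem eventually_infEDist_le_of_avoid
    (havoid : ∀ κ ∈ Λ, κ ∉ S → ∃ U ∈ 𝓝 κ, ∀ᶠ k in atTop, ∀ κ' ∈ U, κ' ∉ Sk k)
    {K : Set X} (hK : IsCompact K) (hKΛ : K ⊆ Λ) {ε : ENNReal} (hε : 0 < ε) :
    ∀ᶠ k in atTop, ∀ κ ∈ Sk k ∩ K, Metric.infEDist κ (S ∩ K) ≤ ε := by
  -- The part of `K` at distance at least `ε` from `S ∩ K` is compact and free of `S`; finitely many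
  -- avoiding neighbourhoods cover it.
  have hcl : IsClosed {κ | ε ≤ Metric.infEDist κ (S ∩ K)} :=
    isClosed_le continuous_const Metric.continuous_infEDist
  have h : ∀ᶠ k in atTop, ∀ κ ∈ K ∩ {κ | ε ≤ Metric.infEDist κ (S ∩ K)}, κ ∉ Sk k := by
    refine (hK.inter_right hcl).induction_on (p := fun s => ∀ᶠ k in atTop, ∀ κ ∈ s, κ ∉ Sk k)
      (by simp) (fun s t hst h => h.mono fun k hk κ hκ => hk κ (hst hκ)) ?_ ?_
    · intro s t h h'
      filter_upwards [h, h'] with k hk hk' κ hκ using hκ.elim (hk κ) (hk' κ)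
    · rintro κ ⟨hκK, hκ⟩
      obtain ⟨U, hU, h⟩ := havoid κ (hKΛ hκK) fun hκS => by
        have h0 : Metric.infEDist κ (S ∩ K) = 0 := Metric.infEDist_zero_of_mem ⟨hκS, hκK⟩
        exact hε.not_ge (h0 ▸ hκ)
      exact ⟨U, mem_nhdsWithin_of_mem_nhds hU, h⟩
  filter_upwards [h] with k hk κ hκ
  by_contra! hlt
  exact hk κ ⟨hκ.2, hlt.le⟩ hκ.1

/-- A property which holds eventually for each point of a set without accumulation points holds
eventually for all its points in a compact set. -/
theorem eventually_forall_of_isolated (hiso : ∀ κ ∈ Λ, ∀ᶠ κ' in 𝓝[≠] κ, κ' ∉ S)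
    {K : Set X} (hK : IsCompact K) (hKΛ : K ⊆ Λ) {P : ℕ → X → Prop}
    (hP : ∀ κ ∈ S ∩ K, ∀ᶠ k in atTop, P k κ) : ∀ᶠ k in atTop, ∀ κ ∈ S ∩ K, P k κ := by
  have h : ∀ᶠ k in atTop, ∀ κ ∈ K, κ ∈ S ∩ K → P k κ := by
    refine hK.induction_on (p := fun s => ∀ᶠ k in atTop, ∀ κ ∈ s, κ ∈ S ∩ K → P k κ)
      (by simp) (fun s t hst h => h.mono fun k hk κ hκ => hk κ (hst hκ)) ?_ ?_
    · intro s t h h'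
      filter_upwards [h, h'] with k hk hk' κ hκ using hκ.elim (hk κ) (hk' κ)
    · intro κ hκ
      -- Each point has a neighbourhood meeting `S` at most in that point, so finitely many
      -- conditions suffice on `K`.
      have hn := eventually_nhdsWithin_iff.1 (hiso κ (hKΛ hκ))
      refine ⟨_, mem_nhdsWithin_of_mem_nhds hn, ?_⟩
      by_cases hS : κ ∈ S
      · filter_upwards [hP κ ⟨hS, hκ⟩] with k hk κ' hκ' hκ'S
        by_cases he : κ' = κ
        · rwa [he]
        · exact absurd hκ'S.1 (hκ' he)
      · refine Eventually.of_forall fun k κ' hκ' hκ'S => ?_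
        by_cases he : κ' = κ
        · exact absurd (he ▸ hκ'S.1) hS
        · exact absurd hκ'S.1 (hκ' he)
  filter_upwards [h] with k hk κ hκ using hk κ hκ.2 hκ

variable {K : Set X}

theorem tendsto_iSup_infEDist_of_avoid
    (havoid : ∀ κ ∈ Λ, κ ∉ S → ∃ U ∈ 𝓝 κ, ∀ᶠ k in atTop, ∀ κ' ∈ U, κ' ∉ Sk k)
    (hK : IsCompact K) (hKΛ : K ⊆ Λ) :
    Tendsto (fun k => ⨆ κ ∈ Sk k ∩ K, Metric.infEDist κ (S ∩ K)) atTop (𝓝 0) := by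
  refine ENNReal.tendsto_nhds_zero.2 fun ε hε => ?_
  filter_upwards [eventually_infEDist_le_of_avoid havoid hK hKΛ hε] with k hk
  exact iSup₂_le hk

theorem tendsto_iSup_infEDist_of_approx (hiso : ∀ κ ∈ Λ, ∀ᶠ κ' in 𝓝[≠] κ, κ' ∉ S)
    (happrox : ∀ κ ∈ S, ∀ ε : ENNReal, 0 < ε → ∀ᶠ k in atTop, ∃ κ' ∈ Sk k, edist κ κ' < ε)
    (hK : IsCompact K) (hKΛ : K ⊆ Λ) :
    Tendsto (fun k => ⨆ κ ∈ S ∩ K, Metric.infEDist κ (Sk k)) atTop (𝓝 0) := by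
  refine ENNReal.tendsto_nhds_zero.2 fun ε hε => ?_
  filter_upwards [eventually_forall_of_isolated hiso hK hKΛ
    (P := fun k κ => Metric.infEDist κ (Sk k) ≤ ε) fun κ hκ => by
      filter_upwards [happrox κ hκ.1 ε hε] with k ⟨κ', hκ', hlt⟩
      exact (Metric.infEDist_le_edist_of_mem hκ').trans hlt.le] with k hk
  exact iSup₂_le hk

theorem tendsto_hausdorffEDist (hiso : ∀ κ ∈ Λ, ∀ᶠ κ' in 𝓝[≠] κ, κ' ∉ S)
    (havoid : ∀ κ ∈ Λ, κ ∉ S → ∃ U ∈ 𝓝 κ, ∀ᶠ k in atTop, ∀ κ' ∈ U, κ' ∉ Sk k)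
    (happrox : ∀ κ ∈ S, ∀ ε : ENNReal, 0 < ε → ∀ᶠ k in atTop, ∃ κ' ∈ Sk k, edist κ κ' < ε)
    (hK : IsCompact K) (hKΛ : K ⊆ Λ) (hfr : Disjoint S (frontier K)) :
    Tendsto (fun k => Metric.hausdorffEDist (S ∩ K) (Sk k ∩ K)) atTop (𝓝 0) := by
  refine ENNReal.tendsto_nhds_zero.2 fun ε hε => ?_
  have h : ∀ κ ∈ S ∩ K, ∀ᶠ k in atTop, Metric.infEDist κ (Sk k ∩ K) ≤ ε := by
    intro κ hκ
    -- The boundary condition enters here: an interior limit point has its approximating points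
    -- inside `K`.
    have hint : κ ∈ interior K := by
      by_contra hn
      exact disjoint_left.1 hfr hκ.1 ⟨subset_closure hκ.2, hn⟩
    obtain ⟨δ, hδ, hδK⟩ := Metric.nhds_basis_eball.mem_iff.1 (mem_interior_iff_mem_nhds.1 hint)
    filter_upwards [happrox κ hκ.1 (min ε δ) (lt_min hε hδ)] with k ⟨κ', hκ', hlt⟩
    have hmem : κ' ∈ K := hδK (by
      rw [Metric.mem_eball, edist_comm]
      exact hlt.trans_le (min_le_right _ _))
    exact (Metric.infEDist_le_edist_of_mem (mem_inter hκ' hmem)).trans (hlt.le.trans (min_le_left _ _))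
  filter_upwards [eventually_infEDist_le_of_avoid havoid hK hKΛ hε,
    eventually_forall_of_isolated hiso hK hKΛ h] with k hk hk'
  exact Metric.hausdorffEDist_le_of_infEDist hk' hk

end SetConvergence

/-! ### Eigenvalue sets of a holomorphic family of forms -/

section Spectrum

variable {V : Type*} [NormedAddCommGroup V] [InnerProductSpace ℂ V] [CompleteSpace V]
  {s : ℂ → V →L[ℂ] V →L⋆[ℂ] ℂ} {Λ : Set ℂ} {W : ℕ → Submodule ℂ V}

theorem mem_eigenvalueSet_top_iff {κ : ℂ} :
    κ ∈ eigenvalueSet Λ s ⊤ ↔ κ ∈ Λ ∧ ∃ u, u ≠ 0 ∧ formOperator (s κ) u = 0 := by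
  refine and_congr_right fun _ => exists_congr fun u => ?_
  constructor
  · rintro ⟨-, hu, h⟩
    refine ⟨hu, ext_inner_left ℂ fun v => ?_⟩
    rw [inner_formOperator, h v trivial, inner_zero_right]
  · rintro ⟨hu, h⟩
    refine ⟨trivial, hu, fun v _ => ?_⟩
    rw [← inner_formOperator, h, inner_zero_right]

theorem eventually_notMem_eigenvalueSet (hΛ : IsOpen Λ)
    (hA : DifferentiableOn ℂ (fun κ => formOperator (s κ)) Λ)
    (hG : ∀ κ ∈ Λ, ∃ T C α, TGarding (formOperator (s κ)) T C α)
    (hinv : ∀ κ₀ ∈ Λ, ∃ κ ∈ connectedComponentIn Λ κ₀, IsUnit (formOperator (s κ))) :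
    ∀ κ ∈ Λ, ∀ᶠ κ' in 𝓝[≠] κ, κ' ∉ eigenvalueSet Λ s ⊤ := by
  intro κ hκ
  filter_upwards [eventually_isUnit hΛ hA hG hinv hκ] with κ' hκ' hmem
  obtain ⟨-, u, hu, hu0⟩ := mem_eigenvalueSet_top_iff.1 hmem
  exact hu ((ContinuousLinearMap.isUnit_iff_bijective.1 hκ').1 (by simpa using hu0))

/-- A discrete eigenvector has residual zero, so it is excluded wherever uniform stability holds. -/
theorem eigenvalueSet_avoid (hΛ : IsOpen Λ)
    (hA : DifferentiableOn ℂ (fun κ => formOperator (s κ)) Λ) (hd : ApproximatesAll W)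
    (hG : ∀ κ ∈ Λ, ∃ T R C α Tk Rk, GalerkinGarding (formOperator (s κ)) T R C α W Tk Rk) :
    ∀ κ ∈ Λ, κ ∉ eigenvalueSet Λ s ⊤ →
      ∃ U ∈ 𝓝 κ, ∀ᶠ k in atTop, ∀ κ' ∈ U, κ' ∉ eigenvalueSet Λ s (W k) := by
  intro κ hκ hnot
  have hinj : ∀ u, formOperator (s κ) u = 0 → u = 0 := fun u hu => by
    by_contra hne
    exact hnot (mem_eigenvalueSet_top_iff.2 ⟨hκ, u, hne, hu⟩)
  obtain ⟨U, hU, c, hc, h⟩ := exists_stable_nhds hΛ hA.continuousOn hd hG hκ hinj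
  refine ⟨U, hU, ?_⟩
  filter_upwards [h] with k hk κ' hκ' ⟨_, u, huW, hu0, hu⟩
  refine hu0 (hk κ' hκ' u huW fun v hv => ?_)
  rw [inner_formOperator, hu v hv, norm_zero]
  positivity

theorem eigenvalueSet_approx (hΛ : IsOpen Λ)
    (hA : DifferentiableOn ℂ (fun κ => formOperator (s κ)) Λ) (hd : ApproximatesAll W)
    (hW : ∀ᶠ k in atTop, IsClosed (W k : Set V))
    (hG : ∀ κ ∈ Λ, ∃ T R C α Tk Rk, GalerkinGarding (formOperator (s κ)) T R C α W Tk Rk)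
    (hinv : ∀ κ₀ ∈ Λ, ∃ κ ∈ connectedComponentIn Λ κ₀, IsUnit (formOperator (s κ))) :
    ∀ κ ∈ eigenvalueSet Λ s ⊤, ∀ ε : ENNReal, 0 < ε →
      ∀ᶠ k in atTop, ∃ κ' ∈ eigenvalueSet Λ s (W k), edist κ κ' < ε := by
  intro κ hκ ε hε
  obtain ⟨hκΛ, u, hu, hu0⟩ := mem_eigenvalueSet_top_iff.1 hκ
  obtain ⟨δ, hδ, hδε⟩ := ENNReal.lt_iff_exists_nnreal_btwn.1 hε
  have hGt : ∀ κ ∈ Λ, ∃ T C α, TGarding (formOperator (s κ)) T C α := fun κ hκ => by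
    obtain ⟨T, R, C, α, Tk, Rk, h⟩ := hG κ hκ
    exact ⟨T, C, α, h.tGarding⟩
  have hiso : ∀ᶠ κ' in 𝓝[≠] κ, ∀ u, formOperator (s κ') u = 0 → u = 0 := by
    filter_upwards [eventually_isUnit hΛ hA hGt hinv hκΛ] with κ' hκ' u hu
    exact (ContinuousLinearMap.isUnit_iff_bijective.1 hκ').1 (by simpa using hu)
  filter_upwards [eventually_exists_galerkin_eigenvalue hΛ hA hd hW hG hκΛ hu hu0 hiso
    (ε := δ) (by exact_mod_cast hδ)] with k ⟨κ', hκ', hdist, v, hvW, hv0, hv⟩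
  refine ⟨κ', ⟨hκ', v, hvW, hv0, fun w hw => ?_⟩, lt_trans ?_ hδε⟩
  · rw [← inner_formOperator]
    exact hv w hw
  · rw [edist_comm, edist_lt_coe]
    exact_mod_cast hdist

end Spectrum

/-! ### Contractions of Hilbert space tensors -/

section HTensor

variable {E F E' F' G : Type*}
  [NormedAddCommGroup E] [InnerProductSpace ℂ E] [NormedAddCommGroup F] [InnerProductSpace ℂ F]
  [NormedAddCommGroup E'] [InnerProductSpace ℂ E'] [NormedAddCommGroup F'] [InnerProductSpace ℂ F']
  [NormedAddCommGroup G] [NormedSpace ℂ G]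

theorem HTensor.clm_ext {f g : HTensor E F →L[ℂ] G}
    (h : ∀ x y, f (HTensor.tmulL E F x y) = g (HTensor.tmulL E F x y)) : f = g := by
  refine ContinuousLinearMap.ext fun z => ?_
  refine UniformSpace.Completion.induction_on z (isClosed_eq f.continuous g.continuous) fun z => ?_
  induction z using TensorProduct.induction_on with
  | zero => rw [UniformSpace.Completion.coe_zero, map_zero, map_zero]
  | tmul x y => exact h x y
  | add z z' hz hz' => simp only [UniformSpace.Completion.coe_add, map_add, hz, hz']

theorem HTensor.ext_inner {z z' : HTensor E F}
    (h : ∀ x y, inner ℂ z (HTensor.tmulL E F x y) = inner ℂ z' (HTensor.tmulL E F x y)) :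
    z = z' := by
  have : innerSL ℂ z = innerSL ℂ z' := HTensor.clm_ext fun x y => by simpa using h x y
  exact ext_inner_right ℂ fun v => by simpa using congrArg (fun f => f v) this

theorem HTensor.inner_tmulL (x x' : E) (y y' : F) :
    inner ℂ (HTensor.tmulL E F x y) (HTensor.tmulL E F x' y') = inner ℂ x x' * inner ℂ y y' := by
  rw [HTensor.tmulL_apply, HTensor.tmulL_apply, UniformSpace.Completion.inner_coe,
    TensorProduct.inner_tmul]

theorem HTensor.norm_tmulL (x : E) (y : F) : ‖HTensor.tmulL E F x y‖ = ‖x‖ * ‖y‖ := by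
  rw [HTensor.tmulL_apply, UniformSpace.Completion.norm_coe, TensorProduct.norm_tmul]

/-- Contraction of the second factor with a vector. -/
noncomputable def HTensor.contractRight [CompleteSpace E] (y : F) : HTensor E F →L[ℂ] E :=
  ContinuousLinearMap.adjoint ((HTensor.tmulL E F).flip y)

/-- Contraction of the first factor with a vector. -/
noncomputable def HTensor.contractLeft [CompleteSpace F] (x : E) : HTensor E F →L[ℂ] F :=
  ContinuousLinearMap.adjoint (HTensor.tmulL E F x)

theorem HTensor.contractRight_tmulL [CompleteSpace E] (y : F) (x : E) (y' : F) :
    HTensor.contractRight y (HTensor.tmulL E F x y') = inner ℂ y y' • x := by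
  refine ext_inner_left ℂ fun v => ?_
  rw [HTensor.contractRight, ContinuousLinearMap.adjoint_inner_right,
    ContinuousLinearMap.flip_apply, HTensor.inner_tmulL, inner_smul_right, mul_comm]

theorem HTensor.contractLeft_tmulL [CompleteSpace F] (x x' : E) (y : F) :
    HTensor.contractLeft x (HTensor.tmulL E F x' y) = inner ℂ x x' • y := by
  refine ext_inner_left ℂ fun v => ?_
  rw [HTensor.contractLeft, ContinuousLinearMap.adjoint_inner_right, HTensor.inner_tmulL,
    inner_smul_right]

theorem HTensor.contractRight_map [CompleteSpace E] [CompleteSpace E'] (A : E →L[ℂ] E') (y : F)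
    (z : HTensor E F) : HTensor.contractRight y (HTensor.map A (ContinuousLinearMap.id ℂ F) z) =
      A (HTensor.contractRight y z) := by
  have : (HTensor.contractRight y).comp (HTensor.map A (ContinuousLinearMap.id ℂ F)) =
      A.comp (HTensor.contractRight y) := HTensor.clm_ext fun x y' => by
    simp [HTensor.map_tmulL, HTensor.contractRight_tmulL]
  exact congrArg (fun f => f z) this

theorem HTensor.contractLeft_map [CompleteSpace F] [CompleteSpace F'] (B : F →L[ℂ] F') (x : E)
    (z : HTensor E F) : HTensor.contractLeft x (HTensor.map (ContinuousLinearMap.id ℂ E) B z) =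
      B (HTensor.contractLeft x z) := by
  have : (HTensor.contractLeft x).comp (HTensor.map (ContinuousLinearMap.id ℂ E) B) =
      B.comp (HTensor.contractLeft x) := HTensor.clm_ext fun x' y => by
    simp [HTensor.map_tmulL, HTensor.contractLeft_tmulL]
  exact congrArg (fun f => f z) this

/-- A tensor is determined by its contractions with all vectors of one factor, and these commute
with an operator acting on the other factor. -/
theorem HTensor.map_id_right_injective [CompleteSpace E] [CompleteSpace E'] {A : E →L[ℂ] E'}
    (hA : Function.Injective A) :
    Function.Injective (HTensor.map A (ContinuousLinearMap.id ℂ F)) := by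
  refine (injective_iff_map_eq_zero _).2 fun z hz => HTensor.ext_inner fun x y => ?_
  have h : HTensor.contractRight y z = 0 := hA (by
    rw [← HTensor.contractRight_map, hz, map_zero, map_zero])
  rw [inner_zero_left, ← ContinuousLinearMap.flip_apply, ← ContinuousLinearMap.adjoint_inner_left]
  change inner ℂ (HTensor.contractRight y z) x = 0
  rw [h, inner_zero_left]

theorem HTensor.map_id_left_injective [CompleteSpace F] [CompleteSpace F'] {B : F →L[ℂ] F'}
    (hB : Function.Injective B) :
    Function.Injective (HTensor.map (ContinuousLinearMap.id ℂ E) B) := by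
  refine (injective_iff_map_eq_zero _).2 fun z hz => HTensor.ext_inner fun x y => ?_
  have h : HTensor.contractLeft x z = 0 := hB (by
    rw [← HTensor.contractLeft_map, hz, map_zero, map_zero])
  rw [inner_zero_left, ← ContinuousLinearMap.adjoint_inner_left]
  change inner ℂ (HTensor.contractLeft x z) y = 0
  rw [h, inner_zero_left]

end HTensor

/-! ### Pure tensors and closed tensor subspaces in a single waveguide -/

section WaveguideSpace

variable {X1 X2 Y1 Y2 : Type*}
  [NormedAddCommGroup X1] [InnerProductSpace ℂ X1] [NormedAddCommGroup X2] [InnerProductSpace ℂ X2]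
  [NormedAddCommGroup Y1] [InnerProductSpace ℂ Y1] [NormedAddCommGroup Y2] [InnerProductSpace ℂ Y2]
  (ιX : X2 →L[ℂ] X1) (ιY : Y2 →L[ℂ] Y1)

/-- The representative in `X2 ⊗ Y1` of an element of `X2 ⊗ Y1 ∩ X1 ⊗ Y2`. -/
noncomputable def WaveguideSpace.fst : WaveguideSpace ιX ιY →L[ℂ] HTensor X2 Y1 :=
  (WithLp.fstL 2 ℂ (HTensor X2 Y1) (HTensor X1 Y2)).comp (WaveguideSpace.incl ιX ιY)

/-- The representative in `X1 ⊗ Y2` of an element of `X2 ⊗ Y1 ∩ X1 ⊗ Y2`. -/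
noncomputable def WaveguideSpace.snd : WaveguideSpace ιX ιY →L[ℂ] HTensor X1 Y2 :=
  (WithLp.sndL 2 ℂ (HTensor X2 Y1) (HTensor X1 Y2)).comp (WaveguideSpace.incl ιX ιY)

variable {ιX ιY}

theorem WaveguideSpace.ext {w w' : WaveguideSpace ιX ιY}
    (h₁ : WaveguideSpace.fst ιX ιY w = WaveguideSpace.fst ιX ιY w')
    (h₂ : WaveguideSpace.snd ιX ιY w = WaveguideSpace.snd ιX ιY w') : w = w' :=
  Subtype.ext (WithLp.ofLp_injective 2 (Prod.ext h₁ h₂))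

theorem WaveguideSpace.inner_eq (w w' : WaveguideSpace ιX ιY) :
    inner ℂ w w' = inner ℂ (WaveguideSpace.fst ιX ιY w) (WaveguideSpace.fst ιX ιY w') +
      inner ℂ (WaveguideSpace.snd ιX ιY w) (WaveguideSpace.snd ιX ιY w') := rfl

theorem toTensor_eq_map_fst (w : WaveguideSpace ιX ιY) : toTensor ιX ιY w =
    HTensor.map ιX (ContinuousLinearMap.id ℂ Y1) (WaveguideSpace.fst ιX ιY w) := rfl

theorem toTensor_eq_map_snd (w : WaveguideSpace ιX ιY) : toTensor ιX ιY w =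
    HTensor.map (ContinuousLinearMap.id ℂ X1) ιY (WaveguideSpace.snd ιX ιY w) :=
  sub_eq_zero.1 w.2

theorem fst_pureTensor (x : X2) (y : Y2) :
    WaveguideSpace.fst ιX ιY (pureTensor ιX ιY x y) = HTensor.tmulL X2 Y1 x (ιY y) := rfl

theorem snd_pureTensor (x : X2) (y : Y2) :
    WaveguideSpace.snd ιX ιY (pureTensor ιX ιY x y) = HTensor.tmulL X1 Y2 (ιX x) y := rfl

theorem toTensor_pureTensor (x : X2) (y : Y2) :
    toTensor ιX ιY (pureTensor ιX ιY x y) = HTensor.tmulL X1 Y1 (ιX x) (ιY y) := by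
  rw [toTensor_eq_map_fst, fst_pureTensor, HTensor.map_tmulL]
  rfl

theorem inner_pureTensor (x x' : X2) (y y' : Y2) :
    inner ℂ (pureTensor ιX ιY x y) (pureTensor ιX ιY x' y') =
      inner ℂ x x' * inner ℂ (ιY y) (ιY y') + inner ℂ (ιX x) (ιX x') * inner ℂ y y' := by
  rw [WaveguideSpace.inner_eq]
  simp only [fst_pureTensor, snd_pureTensor, HTensor.inner_tmulL]

theorem toTensor_injective [CompleteSpace X1] [CompleteSpace X2] [CompleteSpace Y1]
    [CompleteSpace Y2] (hX : Function.Injective ιX) (hY : Function.Injective ιY) :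
    Function.Injective (toTensor ιX ιY) := fun w w' h => by
  refine WaveguideSpace.ext ?_ ?_
  · exact HTensor.map_id_right_injective hX h
  · refine HTensor.map_id_left_injective hY ?_
    rw [← toTensor_eq_map_snd, h, toTensor_eq_map_snd]

theorem WaveguideSpace.norm_le (w : WaveguideSpace ιX ιY) :
    ‖w‖ ≤ ‖WaveguideSpace.fst ιX ιY w‖ + ‖WaveguideSpace.snd ιX ιY w‖ := by
  have h : ‖w‖ = ‖WaveguideSpace.incl ιX ιY w‖ := rfl
  have h' : ‖WaveguideSpace.incl ιX ιY w‖ ^ 2 =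
    ‖WaveguideSpace.fst ιX ιY w‖ ^ 2 + ‖WaveguideSpace.snd ιX ιY w‖ ^ 2 :=
    WithLp.prod_norm_sq_eq_of_L2 _
  rw [h]
  refine (sq_le_sq₀ (norm_nonneg _) (by positivity)).1 ?_
  rw [h', add_sq]
  have := mul_nonneg (norm_nonneg (WaveguideSpace.fst ιX ιY w))
    (norm_nonneg (WaveguideSpace.snd ιX ιY w))
  linarith

variable (ιX ιY) in
/-- The pure tensors as a continuous bilinear map. -/
noncomputable def pureTensorL : X2 →L[ℂ] Y2 →L[ℂ] WaveguideSpace ιX ιY :=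
  LinearMap.mkContinuous₂
    (LinearMap.mk₂ ℂ (pureTensor ιX ιY)
      (fun x x' y => WaveguideSpace.ext (by simp [fst_pureTensor]) (by simp [snd_pureTensor]))
      (fun c x y => WaveguideSpace.ext (by simp [fst_pureTensor]) (by simp [snd_pureTensor]))
      (fun x y y' => WaveguideSpace.ext (by simp [fst_pureTensor]) (by simp [snd_pureTensor]))
      (fun c x y => WaveguideSpace.ext (by simp [fst_pureTensor]) (by simp [snd_pureTensor])))
    (‖ιY‖ + ‖ιX‖) fun x y => by
      refine (WaveguideSpace.norm_le _).trans ?_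
      simp only [LinearMap.mk₂_apply, fst_pureTensor, snd_pureTensor, HTensor.norm_tmulL]
      have h1 := mul_le_mul_of_nonneg_left (ιY.le_opNorm y) (norm_nonneg x)
      have h2 := mul_le_mul_of_nonneg_right (ιX.le_opNorm x) (norm_nonneg y)
      nlinarith

@[simp] theorem pureTensorL_apply (x : X2) (y : Y2) :
    pureTensorL ιX ιY x y = pureTensor ιX ιY x y := rfl

/-- An element of `X2 ⊗ Y1 ∩ X1 ⊗ Y2` which is a pure tensor `x ⊗ y` in `X1 ⊗ Y1` with `y ∈ Y2`
satisfies `x ∈ X2`. -/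
theorem exists_eq_pureTensor [CompleteSpace X1] [CompleteSpace X2] [CompleteSpace Y1]
    [CompleteSpace Y2] (hX : Function.Injective ιX) (hY : Function.Injective ιY)
    {w : WaveguideSpace ιX ιY} {x : X1} {y : Y2}
    (hw : toTensor ιX ιY w = HTensor.tmulL X1 Y1 x (ιY y)) : ∃ x', w = pureTensor ιX ιY x' y := by
  rcases eq_or_ne y 0 with rfl | hy
  · refine ⟨0, toTensor_injective hX hY ?_⟩
    rw [hw, toTensor_pureTensor]
    simp
  have hy' : (inner ℂ (ιY y) (ιY y) : ℂ) ≠ 0 := by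
    rw [inner_self_ne_zero]
    exact fun h => hy (hY (by simpa using h))
  -- The factor is recovered by contracting the representative in `X2 ⊗ Y1`, which automatically
  -- lands in `X2`, with the image of `y`.
  refine ⟨(inner ℂ (ιY y) (ιY y) : ℂ)⁻¹ •
    HTensor.contractRight (ιY y) (WaveguideSpace.fst ιX ιY w), toTensor_injective hX hY ?_⟩
  rw [toTensor_pureTensor, map_smul, ← HTensor.contractRight_map, ← toTensor_eq_map_fst, hw,
    HTensor.contractRight_tmulL, inv_smul_smul₀ hy']

/-- The tensor product of a closed and a finite dimensional subspace is closed. -/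
theorem isClosed_tensorSubmodule [CompleteSpace X2] (hY : Function.Injective ιY) {X : Submodule ℂ X2}
    (hX : IsClosed (X : Set X2)) (Y : Submodule ℂ Y2) [FiniteDimensional ℂ Y] :
    IsClosed (tensorSubmodule ιX ιY X Y : Set (WaveguideSpace ιX ιY)) := by
  let Y' : Submodule ℂ Y1 := Y.map ιY.toLinearMap
  let e := stdOrthonormalBasis ℂ Y'
  have hpre : ∀ j, ∃ y ∈ Y, ιY y = e j := fun j => (e j).2
  choose y hyY hye using hpre
  let c : _ → WaveguideSpace ιX ιY →L[ℂ] X2 := fun j =>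
    (HTensor.contractRight (e j : Y1)).comp (WaveguideSpace.fst ιX ιY)
  -- `Q` expands the second factor in an orthonormal basis of the image of `Y` in `Y1`. The
  -- algebraic tensor product then consists of the fixed points of `Q` whose coefficients lie in
  -- `X`, which are closed conditions.
  let Q : WaveguideSpace ιX ιY →L[ℂ] WaveguideSpace ιX ιY :=
    ∑ j, ((pureTensorL ιX ιY).flip (y j)).comp (c j)
  have hQ : ∀ w, Q w = ∑ j, pureTensor ιX ιY (c j w) (y j) := fun w => by
    simp [Q]
  have hc : ∀ j x z, c j (pureTensor ιX ιY x z) = inner ℂ (e j : Y1) (ιY z) • x := fun j x z => by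
    simp only [c, ContinuousLinearMap.comp_apply, fst_pureTensor, HTensor.contractRight_tmulL]
  have hsum : ∀ z ∈ Y, ∑ j, inner ℂ (e j : Y1) (ιY z) • y j = z := by
    intro z hz
    apply hY
    have h := congrArg (Subtype.val) (e.sum_repr' ⟨ιY z, z, hz, rfl⟩)
    simpa [hye] using h
  let N : Submodule ℂ (WaveguideSpace ιX ιY) :=
    (⨅ j, X.comap (c j).toLinearMap) ⊓ (ContinuousLinearMap.id ℂ _ - Q).ker
  have hN : tensorSubmodule ιX ιY X Y = N := by
    refine le_antisymm (Submodule.span_le.2 ?_) ?_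
    · rintro _ ⟨x, hx, z, hz, rfl⟩
      refine ⟨(Submodule.mem_iInf _).2 fun j => ?_, ?_⟩
      · change c j (pureTensor ιX ιY x z) ∈ X
        rw [hc]
        exact X.smul_mem _ hx
      · change pureTensor ιX ιY x z - Q (pureTensor ιX ιY x z) = 0
        rw [hQ, sub_eq_zero]
        simp only [hc]
        conv_lhs => rw [← hsum z hz]
        simp only [← pureTensorL_apply, map_sum, map_smul, _root_.smul_apply]
    · rintro w ⟨hw1, hw2⟩
      have hw : w = Q w := sub_eq_zero.1 hw2
      rw [hw, hQ]
      refine Submodule.sum_mem _ fun j _ => Submodule.subset_span ⟨_, ?_, _, hyY j, rfl⟩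
      exact (Submodule.mem_iInf _).1 hw1 j
  rw [hN]
  refine IsClosed.inter ?_ (ContinuousLinearMap.isClosed_ker _)
  rw [Submodule.coe_iInf]
  exact isClosed_iInter fun j => hX.preimage (c j).continuous

end WaveguideSpace

/-! ### The exterior space, its modes and the twist of the guided modes -/

section Exterior

variable {L : ℕ} {X1 X2 Y1 Y2 : Fin L → Type*}
  [∀ l, NormedAddCommGroup (X1 l)] [∀ l, InnerProductSpace ℂ (X1 l)]
  [∀ l, NormedAddCommGroup (X2 l)] [∀ l, InnerProductSpace ℂ (X2 l)]
  [∀ l, NormedAddCommGroup (Y1 l)] [∀ l, InnerProductSpace ℂ (Y1 l)]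
  [∀ l, NormedAddCommGroup (Y2 l)] [∀ l, InnerProductSpace ℂ (Y2 l)]
  (ιX : ∀ l, X2 l →L[ℂ] X1 l) (ιY : ∀ l, Y2 l →L[ℂ] Y1 l)

/-- The `l`-th component of an exterior function. -/
noncomputable def extComponent (l : Fin L) : ExtSpace ιX ιY →L[ℂ] WaveguideSpace (ιX l) (ιY l) :=
  PiLp.proj 2 (fun l => WaveguideSpace (ιX l) (ιY l)) l (𝕜 := ℂ)

/-- The exterior functions supported in the waveguide `l`. -/
noncomputable def extSingle (l : Fin L) : WaveguideSpace (ιX l) (ιY l) →L[ℂ] ExtSpace ιX ιY :=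
  (PiLp.continuousLinearEquiv 2 ℂ fun l => WaveguideSpace (ιX l) (ιY l)).symm.toContinuousLinearMap
    ∘L ContinuousLinearMap.single ℂ (fun l => WaveguideSpace (ιX l) (ιY l)) l

/-- The exterior functions `x ⊗ y` in the waveguide `l`. -/
noncomputable def extPure (l : Fin L) : X2 l →L[ℂ] Y2 l →L[ℂ] ExtSpace ιX ιY :=
  (ContinuousLinearMap.compL ℂ _ _ _ (extSingle ιX ιY l)).comp (pureTensorL (ιX l) (ιY l))

variable {ιX ιY}

theorem ext_of_component {u v : ExtSpace ιX ιY}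
    (h : ∀ l, extComponent ιX ιY l u = extComponent ιX ιY l v) : u = v := PiLp.ext h

theorem extComponent_extSingle_same (l : Fin L) (w : WaveguideSpace (ιX l) (ιY l)) :
    extComponent ιX ιY l (extSingle ιX ιY l w) = w := by
  change (Pi.single l w : ∀ l, WaveguideSpace (ιX l) (ιY l)) l = w
  rw [Pi.single_eq_same]

theorem extComponent_extSingle_of_ne {l l' : Fin L} (h : l' ≠ l)
    (w : WaveguideSpace (ιX l) (ιY l)) : extComponent ιX ιY l' (extSingle ιX ιY l w) = 0 := by
  change (Pi.single l w : ∀ l, WaveguideSpace (ιX l) (ιY l)) l' = 0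
  rw [Pi.single_eq_of_ne h]

theorem inner_extSingle (l : Fin L) (w : WaveguideSpace (ιX l) (ιY l)) (u : ExtSpace ιX ιY) :
    inner ℂ (extSingle ιX ιY l w) u = inner ℂ w (extComponent ιX ιY l u) := by
  have h : inner ℂ (extSingle ιX ιY l w) u =
      ∑ j, inner ℂ (extComponent ιX ιY j (extSingle ιX ιY l w)) (extComponent ιX ιY j u) := rfl
  rw [h, Finset.sum_eq_single l (fun j _ hj => by
    rw [extComponent_extSingle_of_ne hj, inner_zero_left]) (by simp), extComponent_extSingle_same]

theorem extPure_apply (l : Fin L) (x : X2 l) (y : Y2 l) :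
    extPure ιX ιY l x y = extSingle ιX ιY l (pureTensor (ιX l) (ιY l) x y) := rfl

theorem mem_discreteExt_iff {X : ∀ l, Submodule ℂ (X2 l)} {Y : ∀ l, Submodule ℂ (Y2 l)}
    {u : ExtSpace ιX ιY} : u ∈ discreteExt ιX ιY X Y ↔
      ∀ l, extComponent ιX ιY l u ∈ tensorSubmodule (ιX l) (ιY l) (X l) (Y l) :=
  Submodule.mem_iInf _

theorem extPure_mem_discreteExt {X : ∀ l, Submodule ℂ (X2 l)} {Y : ∀ l, Submodule ℂ (Y2 l)}
    {l : Fin L} {x : X2 l} {y : Y2 l} (hx : x ∈ X l) (hy : y ∈ Y l) :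
    extPure ιX ιY l x y ∈ discreteExt ιX ιY X Y := by
  refine mem_discreteExt_iff.2 fun j => ?_
  rw [extPure_apply]
  rcases eq_or_ne j l with rfl | hj
  · rw [extComponent_extSingle_same]
    exact Submodule.subset_span ⟨x, hx, y, hy, rfl⟩
  · rw [extComponent_extSingle_of_ne hj]
    exact Submodule.zero_mem _

theorem isClosed_discreteExt [∀ l, CompleteSpace (X2 l)] (hY : ∀ l, Function.Injective (ιY l))
    {X : ∀ l, Submodule ℂ (X2 l)} (hX : ∀ l, IsClosed (X l : Set (X2 l)))
    (Y : ∀ l, Submodule ℂ (Y2 l)) (hfin : ∀ l, FiniteDimensional ℂ (Y l)) :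
    IsClosed (discreteExt ιX ιY X Y : Set (ExtSpace ιX ιY)) := by
  have : (discreteExt ιX ιY X Y : Set (ExtSpace ιX ιY)) = ⋂ l, extComponent ιX ιY l ⁻¹'
      (tensorSubmodule (ιX l) (ιY l) (X l) (Y l) : Set _) := by
    ext u
    simp only [SetLike.mem_coe, mem_discreteExt_iff, mem_iInter, mem_preimage]
  rw [this]
  refine isClosed_iInter fun l => IsClosed.preimage (extComponent ιX ιY l).continuous ?_
  have := hfin l
  exact isClosed_tensorSubmodule (hY l) (hX l) (Y l)

section Coefficient

variable [∀ l, CompleteSpace (X2 l)]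

variable (ιX ιY) in
/-- The coefficient of `y` with respect to the inner product of `Y1 l`, in the waveguide `l`. -/
noncomputable def extCoeff (l : Fin L) (y : Y2 l) : ExtSpace ιX ιY →L[ℂ] X2 l :=
  (inner ℂ (ιY l y) (ιY l y) : ℂ)⁻¹ • (HTensor.contractRight (ιY l y)).comp
    ((WaveguideSpace.fst (ιX l) (ιY l)).comp (extComponent ιX ιY l))

theorem extCoeff_apply (l : Fin L) (y : Y2 l) (u : ExtSpace ιX ιY) :
    extCoeff ιX ιY l y u = (inner ℂ (ιY l y) (ιY l y) : ℂ)⁻¹ • HTensor.contractRight (ιY l y)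
      (WaveguideSpace.fst (ιX l) (ιY l) (extComponent ιX ιY l u)) := rfl

theorem extCoeff_extPure (l : Fin L) (y y' : Y2 l) (x : X2 l) :
    extCoeff ιX ιY l y (extPure ιX ιY l x y') =
      (inner ℂ (ιY l y) (ιY l y) : ℂ)⁻¹ • (inner ℂ (ιY l y) (ιY l y') : ℂ) • x := by
  rw [extCoeff_apply, extPure_apply, extComponent_extSingle_same, fst_pureTensor,
    HTensor.contractRight_tmulL]

/-- Contraction of the second factor leaves combinations of first factors, whatever `y` is; in
particular `y` need not belong to the discrete space. -/
theorem extCoeff_mem {X : ∀ l, Submodule ℂ (X2 l)} {Y : ∀ l, Submodule ℂ (Y2 l)}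
    {u : ExtSpace ιX ιY} (hu : u ∈ discreteExt ιX ιY X Y) (l : Fin L) (y : Y2 l) :
    extCoeff ιX ιY l y u ∈ X l := by
  have h : tensorSubmodule (ιX l) (ιY l) (X l) (Y l) ≤ (X l).comap
      ((HTensor.contractRight (ιY l y)).comp (WaveguideSpace.fst (ιX l) (ιY l))).toLinearMap := by
    refine Submodule.span_le.2 ?_
    rintro _ ⟨x, hx, z, -, rfl⟩
    change HTensor.contractRight (ιY l y) (WaveguideSpace.fst (ιX l) (ιY l)
      (pureTensor (ιX l) (ιY l) x z)) ∈ X l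
    rw [fst_pureTensor, HTensor.contractRight_tmulL]
    exact (X l).smul_mem _ hx
  rw [extCoeff_apply]
  exact (X l).smul_mem _ (h (mem_discreteExt_iff.1 hu l))

end Coefficient

section Modal

variable {φ : ℕ → PiLp 2 Y2} {lidx : ℕ → Fin L}

theorem mem_modalSpace_iff {n : ℕ} {u : ExtSpace ιX ιY} : u ∈ modalSpace ιX ιY φ lidx n ↔
    (∃ x, HTensor.tmulL (X1 (lidx n)) (Y1 (lidx n)) x (ιY (lidx n) (φ n (lidx n))) =
      toTensor (ιX (lidx n)) (ιY (lidx n)) (extComponent ιX ιY (lidx n) u)) ∧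
    ∀ j, j ≠ lidx n → extComponent ιX ιY j u = 0 := by
  refine and_congr Iff.rfl ?_
  change u ∈ (⨅ j ∈ {j : Fin L | j ≠ lidx n}, (extComponent ιX ιY j).ker) ↔ _
  simp only [Submodule.mem_iInf, Set.mem_ofPred_eq]
  rfl

theorem extPure_mem_modalSpace (n : ℕ) (x : X2 (lidx n)) :
    extPure ιX ιY (lidx n) x (φ n (lidx n)) ∈ modalSpace ιX ιY φ lidx n := by
  refine mem_modalSpace_iff.2 ⟨⟨ιX (lidx n) x, ?_⟩, fun j hj => ?_⟩
  · rw [extPure_apply, extComponent_extSingle_same, toTensor_pureTensor]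
  · rw [extPure_apply, extComponent_extSingle_of_ne hj]

variable {Z : Type*} [NormedAddCommGroup Z] [InnerProductSpace ℂ Z]
  {trp : ExtSpace ιX ιY →L[ℂ] Z} {sext : ExtSpace ιX ιY →L[ℂ] ExtSpace ιX ιY →L⋆[ℂ] ℂ}

theorem SeparationAssumption.clm_ext (hS : SeparationAssumption ιX ιY trp sext φ lidx)
    {G : Type*} [NormedAddCommGroup G] [NormedSpace ℂ G] {f g : ExtSpace ιX ιY →L[ℂ] G}
    (h : ∀ n, ∀ u ∈ modalSpace ιX ιY φ lidx n, f u = g u) : f = g := by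
  refine ContinuousLinearMap.ext_on (s := ⋃ n, (modalSpace ιX ιY φ lidx n : Set _)) ?_ ?_
  · rw [← Submodule.iSup_eq_span, Submodule.dense_iff_topologicalClosure_eq_top]
    exact hS.modal_dense
  · intro u hu
    obtain ⟨n, hn⟩ := mem_iUnion.1 hu
    exact h n u hn

variable [∀ l, CompleteSpace (X2 l)]

/-- The `n`-th coefficient of the modal expansion. -/
noncomputable abbrev modalCoeff (ιX : ∀ l, X2 l →L[ℂ] X1 l) (ιY : ∀ l, Y2 l →L[ℂ] Y1 l)
    (φ : ℕ → PiLp 2 Y2) (lidx : ℕ → Fin L) (n : ℕ) : ExtSpace ιX ιY →L[ℂ] X2 (lidx n) :=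
  extCoeff ιX ιY (lidx n) (φ n (lidx n))

/-- The operator `u ↦ u_n ⊗ y`, where `u_n` is the `n`-th modal coefficient of `u`. -/
noncomputable def modalReplace (ιX : ∀ l, X2 l →L[ℂ] X1 l) (ιY : ∀ l, Y2 l →L[ℂ] Y1 l)
    (φ : ℕ → PiLp 2 Y2) (lidx : ℕ → Fin L) (n : ℕ) (y : Y2 (lidx n)) :
    ExtSpace ιX ιY →L[ℂ] ExtSpace ιX ιY :=
  ((extPure ιX ιY (lidx n)).flip y).comp (modalCoeff ιX ιY φ lidx n)

theorem modalReplace_apply (n : ℕ) (y : Y2 (lidx n)) (u : ExtSpace ιX ιY) :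
    modalReplace ιX ιY φ lidx n y u =
      extPure ιX ιY (lidx n) (modalCoeff ιX ιY φ lidx n u) y := rfl

theorem modalReplace_mem_discreteExt {X : ∀ l, Submodule ℂ (X2 l)} {Y : ∀ l, Submodule ℂ (Y2 l)}
    {u : ExtSpace ιX ιY} (hu : u ∈ discreteExt ιX ιY X Y) {n : ℕ} {y : Y2 (lidx n)}
    (hy : y ∈ Y (lidx n)) : modalReplace ιX ιY φ lidx n y u ∈ discreteExt ιX ιY X Y :=
  extPure_mem_discreteExt (extCoeff_mem hu _ _) hy

theorem modalReplace_mem (n : ℕ) (u : ExtSpace ιX ιY) :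
    modalReplace ιX ιY φ lidx n (φ n (lidx n)) u ∈ modalSpace ιX ιY φ lidx n :=
  extPure_mem_modalSpace n _

/-- The modification of the first `M` modes: in the `n`-th mode `φ n` is replaced by
`φ n + (c n - 1) y n`. -/
noncomputable def modalTwist (ιX : ∀ l, X2 l →L[ℂ] X1 l) (ιY : ∀ l, Y2 l →L[ℂ] Y1 l)
    (φ : ℕ → PiLp 2 Y2) (lidx : ℕ → Fin L) (M : ℕ) (c : ℕ → ℂ) (y : ∀ n, Y2 (lidx n)) :
    ExtSpace ιX ιY →L[ℂ] ExtSpace ιX ιY :=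
  1 + ∑ n ∈ Finset.range M, (c n - 1) • modalReplace ιX ιY φ lidx n (y n)

theorem modalTwist_apply (M : ℕ) (c : ℕ → ℂ) (y : ∀ n, Y2 (lidx n)) (u : ExtSpace ιX ιY) :
    modalTwist ιX ιY φ lidx M c y u =
      u + ∑ n ∈ Finset.range M, (c n - 1) • modalReplace ιX ιY φ lidx n (y n) u := by
  simp [modalTwist]

theorem modalTwist_mem_discreteExt {X : ∀ l, Submodule ℂ (X2 l)} {Y : ∀ l, Submodule ℂ (Y2 l)}
    {u : ExtSpace ιX ιY} (hu : u ∈ discreteExt ιX ιY X Y) {M : ℕ} (c : ℕ → ℂ)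
    {y : ∀ n, Y2 (lidx n)} (hy : ∀ n, y n ∈ Y (lidx n)) :
    modalTwist ιX ιY φ lidx M c y u ∈ discreteExt ιX ιY X Y := by
  rw [modalTwist_apply]
  exact Submodule.add_mem _ hu (Submodule.sum_mem _ fun n _ => Submodule.smul_mem _ _
    (modalReplace_mem_discreteExt hu (hy n)))

theorem tendsto_modalReplace (n : ℕ) {yk : ℕ → Y2 (lidx n)} {y : Y2 (lidx n)}
    (h : Tendsto yk atTop (𝓝 y)) :
    Tendsto (fun k => modalReplace ιX ιY φ lidx n (yk k)) atTop
      (𝓝 (modalReplace ιX ιY φ lidx n y)) := by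
  have hc : Continuous fun y => modalReplace ιX ιY φ lidx n y :=
    (extPure ιX ιY (lidx n)).flip.continuous.clm_comp continuous_const
  exact (hc.tendsto y).comp h

theorem tendsto_modalTwist (M : ℕ) (c : ℕ → ℂ) {yk : ℕ → ∀ n, Y2 (lidx n)}
    {y : ∀ n, Y2 (lidx n)} (h : ∀ n, Tendsto (fun k => yk k n) atTop (𝓝 (y n))) :
    Tendsto (fun k => modalTwist ιX ιY φ lidx M c (yk k)) atTop
      (𝓝 (modalTwist ιX ιY φ lidx M c y)) :=
  (tendsto_finsetSum _ fun n _ => (tendsto_modalReplace n (h n)).const_smul _).const_add _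

variable [∀ l, CompleteSpace (X1 l)] [∀ l, CompleteSpace (Y1 l)] [∀ l, CompleteSpace (Y2 l)]

theorem exists_eq_extPure (hX : ∀ l, Function.Injective (ιX l))
    (hY : ∀ l, Function.Injective (ιY l)) {n : ℕ} {l : Fin L} (hl : lidx n = l)
    {u : ExtSpace ιX ιY} (hu : u ∈ modalSpace ιX ιY φ lidx n) :
    ∃ x, u = extPure ιX ιY l x (φ n l) := by
  subst hl
  obtain ⟨⟨x, hx⟩, h0⟩ := mem_modalSpace_iff.1 hu
  obtain ⟨x', hx'⟩ := exists_eq_pureTensor (hX _) (hY _) hx.symm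
  refine ⟨x', ext_of_component fun j => ?_⟩
  rw [extPure_apply]
  rcases eq_or_ne j (lidx n) with rfl | hj
  · rw [extComponent_extSingle_same, hx']
  · rw [extComponent_extSingle_of_ne hj, h0 j hj]

theorem extPure_modalCoeff (hX : ∀ l, Function.Injective (ιX l))
    (hY : ∀ l, Function.Injective (ιY l)) {n : ℕ} {u : ExtSpace ιX ιY}
    (hu : u ∈ modalSpace ιX ιY φ lidx n) :
    extPure ιX ιY (lidx n) (modalCoeff ιX ιY φ lidx n u) (φ n (lidx n)) = u := by
  obtain ⟨x, rfl⟩ := exists_eq_extPure hX hY rfl hu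
  rw [modalCoeff, extCoeff_extPure]
  -- Zero vectors are allowed in the system; they give zero modal spaces.
  rcases eq_or_ne (φ n (lidx n)) 0 with h | h
  · rw [h, map_zero, map_zero]
  · rw [inv_smul_smul₀]
    rw [inner_self_ne_zero]
    exact fun h' => h (hY _ (by simpa using h'))

/-- The coefficient is taken in `Y1`, while `φ` is orthogonal in `Y2`. For `x ⊗ φ n` and `x ⊗ φ m`
in the same waveguide, the inner product is a `Y1` part plus a `Y2` part. The latter vanishes, and
modal orthogonality then forces orthogonality in `Y1` unless `x = 0`. -/
theorem SeparationAssumption.modalCoeff_eq_zero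
    (hS : SeparationAssumption ιX ιY trp sext φ lidx) (hX : ∀ l, Function.Injective (ιX l))
    (hY : ∀ l, Function.Injective (ιY l)) {n m : ℕ} (hnm : n ≠ m) {u : ExtSpace ιX ιY}
    (hu : u ∈ modalSpace ιX ιY φ lidx m) : modalCoeff ιX ιY φ lidx n u = 0 := by
  rcases eq_or_ne (lidx m) (lidx n) with hl | hl
  · obtain ⟨x, rfl⟩ := exists_eq_extPure hX hY hl hu
    rw [modalCoeff, extCoeff_extPure]
    have h1 : inner ℂ (φ n (lidx n)) (φ m (lidx n)) = 0 := by
      have h2 := hS.orthogonal n m hnm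
      rwa [PiLp.inner_apply, Finset.sum_eq_single (lidx n) (fun j _ hj => by
        rw [hS.support n j hj, inner_zero_left]) (by simp)] at h2
    have h3 := hS.modal_orthogonal n m hnm _ (extPure_mem_modalSpace n x) _ hu
    rw [extPure_apply, inner_extSingle, extPure_apply, extComponent_extSingle_same,
      inner_pureTensor, h1, mul_zero, add_zero, mul_eq_zero, inner_self_eq_zero] at h3
    rcases h3 with h3 | h3
    · rw [h3, smul_zero, smul_zero]
    · rw [h3, zero_smul, smul_zero]
  · rw [modalCoeff, extCoeff_apply, (mem_modalSpace_iff.1 hu).2 _ hl.symm, map_zero, map_zero,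
      smul_zero]

theorem SeparationAssumption.modalReplace_apply_of_mem
    (hS : SeparationAssumption ιX ιY trp sext φ lidx) (hX : ∀ l, Function.Injective (ιX l))
    (hY : ∀ l, Function.Injective (ιY l)) {n m : ℕ} {u : ExtSpace ιX ιY}
    (hu : u ∈ modalSpace ιX ιY φ lidx m) :
    modalReplace ιX ιY φ lidx n (φ n (lidx n)) u = if n = m then u else 0 := by
  split_ifs with h
  · subst h
    exact extPure_modalCoeff hX hY hu
  · rw [modalReplace_apply, hS.modalCoeff_eq_zero hX hY h hu, map_zero]
    rfl

theorem SeparationAssumption.modalTwist_apply_of_mem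
    (hS : SeparationAssumption ιX ιY trp sext φ lidx) (hX : ∀ l, Function.Injective (ιX l))
    (hY : ∀ l, Function.Injective (ιY l)) (M : ℕ) (c : ℕ → ℂ) {m : ℕ} {u : ExtSpace ιX ιY}
    (hu : u ∈ modalSpace ιX ιY φ lidx m) :
    modalTwist ιX ιY φ lidx M c (fun n => φ n (lidx n)) u = if m < M then c m • u else u := by
  rw [modalTwist_apply]
  simp only [hS.modalReplace_apply_of_mem hX hY hu]
  split_ifs with h
  · rw [Finset.sum_eq_single m (fun n _ hn => by simp [hn]) (fun h' => by simp at h'; omega)]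
    simp [sub_smul]
  · rw [Finset.sum_eq_zero (fun n hn => by
      have : n ≠ m := by rintro rfl; exact h (Finset.mem_range.1 hn)
      simp [this]), add_zero]

theorem SeparationAssumption.modalTwist_mul
    (hS : SeparationAssumption ιX ιY trp sext φ lidx) (hX : ∀ l, Function.Injective (ιX l))
    (hY : ∀ l, Function.Injective (ιY l)) (M : ℕ) {c d : ℕ → ℂ} (h : ∀ n < M, c n * d n = 1) :
    modalTwist ιX ιY φ lidx M c (fun n => φ n (lidx n)) *
      modalTwist ιX ιY φ lidx M d (fun n => φ n (lidx n)) = 1 := by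
  refine hS.clm_ext fun m u hu => ?_
  rw [_root_.mul_apply_eq_comp, hS.modalTwist_apply_of_mem hX hY M d hu]
  split_ifs with hm
  · rw [map_smul, hS.modalTwist_apply_of_mem hX hY M c hu, if_pos hm, smul_smul, mul_comm, h m hm,
      one_smul]
    rfl
  · rw [hS.modalTwist_apply_of_mem hX hY M c hu, if_neg hm]
    rfl

variable {Vint : Type*} [NormedAddCommGroup Vint] [InnerProductSpace ℂ Vint]
  {sint : Vint →L[ℂ] Vint →L⋆[ℂ] ℂ}

/-- Coercivity of the exterior form after multiplication of the guided modes with `θ n`. -/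
theorem CoercivityAssumption.coercive_twist {M : ℕ} {Cs α : ℝ} {θ : ℕ → ℂ} {K : Vint →L[ℂ] Vint}
    (hC : CoercivityAssumption ιX ιY sint sext φ lidx M Cs α θ K)
    (hS : SeparationAssumption ιX ιY trp sext φ lidx) (hX : ∀ l, Function.Injective (ιX l))
    (hY : ∀ l, Function.Injective (ιY l)) (u : ExtSpace ιX ιY) :
    α * ‖u‖ ^ 2 ≤ (sext u (modalTwist ιX ιY φ lidx M (fun n => (starRingEnd ℂ) (θ n))
      (fun n => φ n (lidx n)) u)).re := by
  set T := modalTwist ιX ιY φ lidx M (fun n => (starRingEnd ℂ) (θ n)) (fun n => φ n (lidx n))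
    with hT
  -- The inequality is a closed condition, so finite sums of modes suffice; for these, orthogonality
  -- removes all cross terms.
  have hcl : IsClosed {u : ExtSpace ιX ιY | α * ‖u‖ ^ 2 ≤ (sext u (T u)).re} := by
    simp only [← inner_formOperator]
    exact isClosed_le (by fun_prop) (Complex.continuous_re.comp (by fun_prop))
  have hd : Dense ((⨆ n, modalSpace ιX ιY φ lidx n : Submodule ℂ (ExtSpace ιX ιY)) :
      Set (ExtSpace ιX ιY)) :=
    Submodule.dense_iff_topologicalClosure_eq_top.2 hS.modal_dense
  refine (hcl.closure_subset_iff (s := ((⨆ n, modalSpace ιX ιY φ lidx n :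
    Submodule ℂ (ExtSpace ιX ιY)) : Set (ExtSpace ιX ιY)))).2 ?_ (hd u)
  intro u hu
  obtain ⟨f, hf, rfl⟩ := (Submodule.mem_iSup_iff_exists_finsupp _ _).1 hu
  have hTf : ∀ n, T (f n) = if n < M then (starRingEnd ℂ) (θ n) • f n else f n := fun n =>
    hS.modalTwist_apply_of_mem hX hY M _ (hf n)
  have hTm : ∀ n, T (f n) ∈ modalSpace ιX ιY φ lidx n := fun n => by
    rw [hTf]
    split_ifs
    · exact Submodule.smul_mem _ _ (hf n)
    · exact hf n
  have h1 : ‖f.sum fun _ x => x‖ ^ 2 = ∑ n ∈ f.support, ‖f n‖ ^ 2 := by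
    have : inner ℂ (∑ n ∈ f.support, f n) (∑ n ∈ f.support, f n) =
        ∑ n ∈ f.support, inner ℂ (f n) (f n) := by
      rw [sum_inner]
      refine Finset.sum_congr rfl fun n hn => ?_
      rw [inner_sum]
      exact Finset.sum_eq_single n (fun m _ hm => hS.modal_orthogonal n m hm.symm _ (hf n) _ (hf m))
        fun h => absurd hn h
    rw [← Complex.ofReal_inj]
    simp only [inner_self_eq_norm_sq_to_K] at this
    simpa [Finsupp.sum] using this
  have h2 : sext (f.sum fun _ x => x) (T (f.sum fun _ x => x)) =
      ∑ n ∈ f.support, sext (f n) (T (f n)) := by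
    simp only [Finsupp.sum, map_sum, _root_.sum_apply]
    rw [Finset.sum_comm]
    refine Finset.sum_congr rfl fun n hn => ?_
    exact Finset.sum_eq_single n (fun m _ hm => hS.form_orthogonal n m hm.symm _ (hf n) _ (hTm m))
      fun h => absurd hn h
  change α * ‖f.sum fun _ x => x‖ ^ 2 ≤ (sext (f.sum fun _ x => x) (T (f.sum fun _ x => x))).re
  rw [h1, h2, Finset.mul_sum, Complex.re_sum]
  refine Finset.sum_le_sum fun n _ => ?_
  rw [hTf]
  split_ifs with hn
  -- The form is antilinear in the second argument, so the conjugate in the twist comes out as `θ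
  -- n`.
  · rw [map_smulₛₗ, Complex.conj_conj, smul_eq_mul]
    exact hC.coercive_guided n hn _ (hf n)
  · exact hC.coercive_evanescent n (not_lt.1 hn) _ (hf n)

end Modal

end Exterior

/-! ### Approximation along sequences of subspaces -/

section Limits

variable {V : Type*} [NormedAddCommGroup V] [NormedSpace ℂ V]

theorem exists_seq_of_eventually_dist_lt {W : ℕ → Submodule ℂ V} {u : V}
    (h : ∀ ε > 0, ∀ᶠ k in atTop, ∃ w ∈ W k, dist u w < ε) :
    ∃ w : ℕ → V, (∀ k, w k ∈ W k) ∧ Tendsto w atTop (𝓝 u) := by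
  have hne : ∀ k, (W k : Set V).Nonempty := fun k => ⟨0, (W k).zero_mem⟩
  -- Almost best approximations, with slack tending to zero, give one sequence that serves every
  -- `ε`.
  have hw : ∀ k, ∃ w ∈ W k, dist u w < Metric.infDist u (W k) + 1 / ((k : ℝ) + 1) := fun k =>
    (Metric.infDist_lt_iff (hne k)).1 (lt_add_of_pos_right _ (by positivity))
  choose w hwW hw using hw
  refine ⟨w, hwW, ?_⟩
  have h0 : Tendsto (fun k => Metric.infDist u (W k)) atTop (𝓝 0) := by
    refine Metric.tendsto_nhds.2 fun ε hε => ?_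
    filter_upwards [h ε hε] with k hk
    rw [Real.dist_0_eq_abs, abs_of_nonneg Metric.infDist_nonneg]
    exact (Metric.infDist_lt_iff (hne k)).2 hk
  rw [tendsto_iff_dist_tendsto_zero]
  refine squeeze_zero (fun k => dist_nonneg) (fun k => (dist_comm _ _).trans_le (hw k).le) ?_
  simpa using h0.add tendsto_one_div_add_atTop_nhds_zero_nat

/-- The limits of sequences with `k`-th term in `W k`. -/
def limitSubmodule (W : ℕ → Submodule ℂ V) : Submodule ℂ V where
  carrier := {u | ∃ w : ℕ → V, (∀ k, w k ∈ W k) ∧ Tendsto w atTop (𝓝 u)}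
  add_mem' := fun ⟨w, hw, hu⟩ ⟨w', hw', hu'⟩ =>
    ⟨fun k => w k + w' k, fun k => (W k).add_mem (hw k) (hw' k), hu.add hu'⟩
  zero_mem' := ⟨fun _ => 0, fun k => (W k).zero_mem, tendsto_const_nhds⟩
  smul_mem' := fun c _ ⟨w, hw, hu⟩ =>
    ⟨fun k => c • w k, fun k => (W k).smul_mem c (hw k), hu.const_smul c⟩

theorem mem_limitSubmodule_of_tendsto {W : ℕ → Submodule ℂ V} {u : V} {w : ℕ → V}
    (hw : ∀ k, w k ∈ W k) (hu : Tendsto w atTop (𝓝 u)) : u ∈ limitSubmodule W := ⟨w, hw, hu⟩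

theorem tendsto_apply_apply {E F : Type*} [NormedAddCommGroup E] [NormedSpace ℂ E]
    [NormedAddCommGroup F] [NormedSpace ℂ F] (f : E →L[ℂ] F →L[ℂ] V) {x : ℕ → E} {y : ℕ → F}
    {a : E} {b : F} (hx : Tendsto x atTop (𝓝 a)) (hy : Tendsto y atTop (𝓝 b)) :
    Tendsto (fun k => f (x k) (y k)) atTop (𝓝 (f a b)) :=
  (f.continuous₂.tendsto (a, b)).comp (hx.prodMk_nhds hy)

theorem isClosed_limitSubmodule (W : ℕ → Submodule ℂ V) :
    IsClosed (limitSubmodule W : Set V) := by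
  refine isClosed_of_closure_subset fun u hu => exists_seq_of_eventually_dist_lt fun ε hε => ?_
  obtain ⟨v, ⟨w, hw, hv⟩, huv⟩ := Metric.mem_closure_iff.1 hu (ε / 2) (half_pos hε)
  filter_upwards [Metric.tendsto_nhds.1 hv (ε / 2) (half_pos hε)] with k hk
  refine ⟨w k, hw k, (dist_triangle _ v _).trans_lt ?_⟩
  rw [dist_comm v]
  linarith

theorem exists_seq_of_dense_iUnion_pos {W : ℝ → Submodule ℂ V}
    (hmono : ∀ h h', 0 < h → h ≤ h' → W h' ≤ W h)
    (hdense : Dense (⋃ h ∈ Ioi (0 : ℝ), (W h : Set V))) {h : ℕ → ℝ}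
    (hh : Tendsto h atTop (𝓝[>] 0)) (u : V) :
    ∃ w : ℕ → V, (∀ k, w k ∈ W (h k)) ∧ Tendsto w atTop (𝓝 u) := by
  refine exists_seq_of_eventually_dist_lt fun ε hε => ?_
  obtain ⟨w, hw, huw⟩ := Metric.dense_iff.1 hdense u ε hε
  obtain ⟨h₀, hh₀, hw'⟩ := mem_iUnion₂.1 huw
  filter_upwards [hh.eventually (Ioc_mem_nhdsGT (mem_Ioi.1 hh₀))] with k hk
  exact ⟨w, hmono _ _ hk.1 hk.2 hw', by rw [dist_comm]; exact hw⟩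

theorem exists_seq_of_dense_iUnion_nat {W : ℕ → Submodule ℂ V}
    (hmono : ∀ N N', N ≤ N' → W N ≤ W N')
    (hdense : Dense (⋃ N, (W N : Set V))) {N : ℕ → ℕ} (hN : Tendsto N atTop atTop) (u : V) :
    ∃ w : ℕ → V, (∀ k, w k ∈ W (N k)) ∧ Tendsto w atTop (𝓝 u) := by
  refine exists_seq_of_eventually_dist_lt fun ε hε => ?_
  obtain ⟨w, hw, huw⟩ := Metric.dense_iff.1 hdense u ε hε
  obtain ⟨N₀, hw'⟩ := mem_iUnion.1 huw
  filter_upwards [hN.eventually_ge_atTop N₀] with k hk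
  exact ⟨w, hmono _ _ hk hw', by rw [dist_comm]; exact hw⟩

end Limits

/-! ### Strong convergence and operators of finite rank -/

section StrongConvergence

variable {U Z V : Type*} [NormedAddCommGroup U] [NormedSpace ℂ U] [NormedAddCommGroup Z]
  [NormedSpace ℂ Z] [NormedAddCommGroup V] [NormedSpace ℂ V]

theorem exists_norm_le_of_tendsto [CompleteSpace Z] {Dk : ℕ → Z →L[ℂ] V} {D : Z →L[ℂ] V}
    (hD : ∀ g, Tendsto (fun k => Dk k g) atTop (𝓝 (D g))) : ∃ C, ∀ k, ‖Dk k‖ ≤ C := by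
  refine banach_steinhaus fun g => ?_
  obtain ⟨C, hC⟩ := (Metric.isBounded_range_of_tendsto _ (hD g)).exists_norm_le
  exact ⟨C, fun k => hC _ (mem_range_self k)⟩

/-- By Banach-Steinhaus the `Dk` are uniformly bounded, so the moving argument contributes an error
that tends to zero. -/
theorem tendsto_apply_of_tendsto [CompleteSpace Z] {Dk : ℕ → Z →L[ℂ] V} {D : Z →L[ℂ] V}
    (hD : ∀ g, Tendsto (fun k => Dk k g) atTop (𝓝 (D g))) {gk : ℕ → Z} {g : Z}
    (hg : Tendsto gk atTop (𝓝 g)) : Tendsto (fun k => Dk k (gk k)) atTop (𝓝 (D g)) := by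
  obtain ⟨C, hC⟩ := exists_norm_le_of_tendsto hD
  have h1 : Tendsto (fun k => Dk k (gk k - g)) atTop (𝓝 0) := by
    refine squeeze_zero_norm (fun k => ((Dk k).le_opNorm _).trans
      (mul_le_mul_of_nonneg_right (hC k) (norm_nonneg _))) ?_
    simpa using (tendsto_iff_norm_sub_tendsto_zero.1 hg).const_mul C
  simpa using h1.add (hD g)

/-- Strong convergence becomes convergence in norm after composition with an operator of finite
rank. -/
theorem tendsto_comp_of_finite_range [CompleteSpace Z] {Dk : ℕ → Z →L[ℂ] V} {D : Z →L[ℂ] V}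
    (hD : ∀ g, Tendsto (fun k => Dk k g) atTop (𝓝 (D g))) {Fk : ℕ → U →L[ℂ] Z} {F : U →L[ℂ] Z}
    (hF : Tendsto Fk atTop (𝓝 F)) (E : Submodule ℂ Z) [FiniteDimensional ℂ E]
    (hFE : ∀ u, F u ∈ E) :
    Tendsto (fun k => (Dk k).comp (Fk k)) atTop (𝓝 (D.comp F)) := by
  obtain ⟨C, hC⟩ := exists_norm_le_of_tendsto hD
  let F' : U →L[ℂ] E := F.codRestrict E hFE
  let b := Module.finBasis ℂ E
  let f : Fin (Module.finrank ℂ E) → U →L[ℂ] ℂ := fun i =>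
    (LinearMap.toContinuousLinearMap (b.coord i)).comp F'
  -- In a basis of `E` the composition depends only on finitely many values `D (b i)`, where
  -- pointwise convergence is enough.
  have hrep : ∀ D : Z →L[ℂ] V, D.comp F =
      ∑ i, ContinuousLinearMap.smulRightL ℂ U V (f i) (D (b i)) := by
    intro D
    ext u
    have h1 : F u = ∑ i, b.repr (F' u) i • (b i : Z) := by
      calc F u = E.subtype (∑ i, b.repr (F' u) i • b i) := by rw [b.sum_repr]; rfl
        _ = _ := by rw [map_sum]; rfl
    rw [ContinuousLinearMap.comp_apply, h1, map_sum, _root_.sum_apply]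
    refine Finset.sum_congr rfl fun i _ => ?_
    rw [map_smul]
    rfl
  have h1 : Tendsto (fun k => (Dk k).comp F) atTop (𝓝 (D.comp F)) := by
    simp only [hrep]
    exact tendsto_finsetSum _ fun i _ =>
      ((ContinuousLinearMap.smulRightL ℂ U V (f i)).continuous.tendsto _).comp (hD _)
  have h2 : Tendsto (fun k => (Dk k).comp (Fk k - F)) atTop (𝓝 0) := by
    refine squeeze_zero_norm (fun k => ((Dk k).opNorm_comp_le _).trans
      (mul_le_mul_of_nonneg_right (hC k) (norm_nonneg _))) ?_
    simpa using (tendsto_iff_norm_sub_tendsto_zero.1 hF).const_mul C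
  have h3 := h2.add h1
  simpa only [ContinuousLinearMap.comp_sub, sub_add_cancel, zero_add] using h3

theorem isCompactOperator_of_finite_range {F : U →L[ℂ] Z} (E : Submodule ℂ Z)
    [FiniteDimensional ℂ E] (hFE : ∀ u, F u ∈ E) : IsCompactOperator F := by
  have : ProperSpace E := FiniteDimensional.proper ℂ E
  exact (isCompactOperator_of_locallyCompactSpace_dom (F.codRestrict E hFE)).clm_comp E.subtypeL

end StrongConvergence

/-! ### Lifting exterior operators to the coupled space -/

section Coupled

variable {Vint Vext Z : Type*}
  [NormedAddCommGroup Vint] [InnerProductSpace ℂ Vint]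
  [NormedAddCommGroup Vext] [InnerProductSpace ℂ Vext]
  [NormedAddCommGroup Z] [InnerProductSpace ℂ Z]
  {trm : Vint →L[ℂ] Z} {trp : Vext →L[ℂ] Z}

theorem CoupledSpace.ext {u v : CoupledSpace trm trp} (h₁ : intPart trm trp u = intPart trm trp v)
    (h₂ : extPart trm trp u = extPart trm trp v) : u = v :=
  Subtype.ext (WithLp.ofLp_injective 2 (Prod.ext h₁ h₂))

theorem CoupledSpace.trace_eq (u : CoupledSpace trm trp) :
    trm (intPart trm trp u) = trp (extPart trm trp u) :=
  sub_eq_zero.1 u.2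

theorem CoupledSpace.norm_sq (u : CoupledSpace trm trp) :
    ‖u‖ ^ 2 = ‖intPart trm trp u‖ ^ 2 + ‖extPart trm trp u‖ ^ 2 :=
  WithLp.prod_norm_sq_eq_of_L2 (CoupledSpace.incl trm trp u)

theorem CoupledSpace.norm_extPart_le (u : CoupledSpace trm trp) : ‖extPart trm trp u‖ ≤ ‖u‖ := by
  refine (sq_le_sq₀ (norm_nonneg _) (norm_nonneg _)).1 ?_
  rw [CoupledSpace.norm_sq u]
  exact le_add_of_nonneg_left (sq_nonneg _)

theorem CoupledSpace.norm_le (u : CoupledSpace trm trp) :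
    ‖u‖ ≤ ‖intPart trm trp u‖ + ‖extPart trm trp u‖ := by
  refine (sq_le_sq₀ (norm_nonneg _) (by positivity)).1 ?_
  rw [CoupledSpace.norm_sq u, add_sq]
  have := mul_nonneg (norm_nonneg (intPart trm trp u)) (norm_nonneg (extPart trm trp u))
  linarith

/-- The pair of two functions with equal traces. -/
def CoupledSpace.mk (a : Vint) (b : Vext) (h : trm a = trp b) : CoupledSpace trm trp :=
  ⟨WithLp.toLp 2 (a, b), sub_eq_zero.2 h⟩

/-- The operator `(a, b) ↦ (a + R b, T b)`. -/
noncomputable def coupledMap (R : Vext →L[ℂ] Vint) (T : Vext →L[ℂ] Vext)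
    (h : ∀ b, trm (R b) = trp (T b) - trp b) : CoupledSpace trm trp →L[ℂ] CoupledSpace trm trp :=
  ContinuousLinearMap.codRestrict
    ((WithLp.prodContinuousLinearEquiv 2 ℂ Vint Vext).symm.toContinuousLinearMap ∘L
      ((intPart trm trp + R.comp (extPart trm trp)).prod (T.comp (extPart trm trp))))
    (coupledSubmodule trm trp) fun u => sub_eq_zero.2 (by
      change trm (intPart trm trp u + R (extPart trm trp u)) = trp (T (extPart trm trp u))
      rw [map_add, h, CoupledSpace.trace_eq, add_sub_cancel])

theorem intPart_coupledMap {R : Vext →L[ℂ] Vint} {T : Vext →L[ℂ] Vext}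
    (h : ∀ b, trm (R b) = trp (T b) - trp b) (u : CoupledSpace trm trp) :
    intPart trm trp (coupledMap R T h u) = intPart trm trp u + R (extPart trm trp u) := rfl

theorem extPart_coupledMap {R : Vext →L[ℂ] Vint} {T : Vext →L[ℂ] Vext}
    (h : ∀ b, trm (R b) = trp (T b) - trp b) (u : CoupledSpace trm trp) :
    extPart trm trp (coupledMap R T h u) = T (extPart trm trp u) := rfl

theorem norm_coupledMap_sub_le {R R' : Vext →L[ℂ] Vint} {T T' : Vext →L[ℂ] Vext}
    (h : ∀ b, trm (R b) = trp (T b) - trp b) (h' : ∀ b, trm (R' b) = trp (T' b) - trp b) :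
    ‖coupledMap R T h - coupledMap R' T' h'‖ ≤ ‖R - R'‖ + ‖T - T'‖ := by
  refine ContinuousLinearMap.opNorm_le_bound _ (by positivity) fun u => ?_
  refine (CoupledSpace.norm_le _).trans ?_
  have h1 : intPart trm trp ((coupledMap R T h - coupledMap R' T' h') u) =
      (R - R') (extPart trm trp u) := by
    rw [_root_.sub_apply, map_sub, intPart_coupledMap, intPart_coupledMap, _root_.sub_apply]
    abel
  have h2 : extPart trm trp ((coupledMap R T h - coupledMap R' T' h') u) =
      (T - T') (extPart trm trp u) := by
    rw [_root_.sub_apply, map_sub, extPart_coupledMap, extPart_coupledMap, _root_.sub_apply]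
  rw [h1, h2, add_mul]
  have h3 := CoupledSpace.norm_extPart_le u
  exact add_le_add
    ((ContinuousLinearMap.le_opNorm _ _).trans (by gcongr))
    ((ContinuousLinearMap.le_opNorm _ _).trans (by gcongr))

variable {D : Z →L[ℂ] Vint}

/-- The extension of an operator `T` on the exterior space to the coupled space. The traces are
corrected by `D'` and, where `D'` is not a right inverse of the trace, by `D`. -/
noncomputable def coupledTwist (hD : ∀ g, trm (D g) = g) (D' : Z →L[ℂ] Vint)
    (T : Vext →L[ℂ] Vext) : CoupledSpace trm trp →L[ℂ] CoupledSpace trm trp :=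
  coupledMap (D'.comp (trp.comp (T - 1)) +
    D.comp (trp.comp (T - 1) - trm.comp (D'.comp (trp.comp (T - 1))))) T fun b => by
      simp [hD]

theorem extPart_coupledTwist (hD : ∀ g, trm (D g) = g) (D' : Z →L[ℂ] Vint)
    (T : Vext →L[ℂ] Vext) (u : CoupledSpace trm trp) :
    extPart trm trp (coupledTwist hD D' T u) = T (extPart trm trp u) := rfl

theorem intPart_coupledTwist_of_eq (hD : ∀ g, trm (D g) = g) {D' : Z →L[ℂ] Vint}
    {T : Vext →L[ℂ] Vext} {u : CoupledSpace trm trp}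
    (h : trm (D' (trp (T (extPart trm trp u) - extPart trm trp u))) =
      trp (T (extPart trm trp u) - extPart trm trp u)) :
    intPart trm trp (coupledTwist hD D' T u) =
      intPart trm trp u + D' (trp (T (extPart trm trp u) - extPart trm trp u)) := by
  have h1 : intPart trm trp (coupledTwist hD D' T u) = intPart trm trp u +
      (D' (trp (T (extPart trm trp u) - extPart trm trp u)) +
        D (trp (T (extPart trm trp u) - extPart trm trp u) -
          trm (D' (trp (T (extPart trm trp u) - extPart trm trp u))))) := rfl
  rw [h1, h, sub_self, map_zero, add_zero]

theorem intPart_coupledTwist (hD : ∀ g, trm (D g) = g)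
    (T : Vext →L[ℂ] Vext) (u : CoupledSpace trm trp) :
    intPart trm trp (coupledTwist hD D T u) =
      intPart trm trp u + D (trp (T (extPart trm trp u) - extPart trm trp u)) :=
  intPart_coupledTwist_of_eq hD (hD _)

/-- The interior corrections `D tr₊(S b - b)` and `D tr₊(T S b - S b)` add up to zero because `T S b
= b`. -/
theorem coupledTwist_mul (hD : ∀ g, trm (D g) = g) {T S : Vext →L[ℂ] Vext} (h : T * S = 1) :
    (coupledTwist hD D T * coupledTwist hD D S : CoupledSpace trm trp →L[ℂ] _) = 1 := by
  refine ContinuousLinearMap.ext fun u => ?_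
  have h' : ∀ b, T (S b) = b := fun b => by
    rw [← _root_.mul_apply_eq_comp, h]
    rfl
  refine CoupledSpace.ext ?_ ?_
  · rw [_root_.mul_apply_eq_comp, intPart_coupledTwist, extPart_coupledTwist, h',
      intPart_coupledTwist, add_assoc, ← map_add, ← map_add]
    simp
  · rw [_root_.mul_apply_eq_comp, extPart_coupledTwist, extPart_coupledTwist, h']
    rfl

/-- The `Dk` converge only strongly, but they are applied to operators converging in norm to the
finite rank operator `tr₊(T - 1)`. -/
theorem tendsto_coupledTwist [CompleteSpace Z] (hD : ∀ g, trm (D g) = g) {Dk : ℕ → Z →L[ℂ] Vint}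
    (hDk : ∀ g, Tendsto (fun k => Dk k g) atTop (𝓝 (D g))) {Tk : ℕ → Vext →L[ℂ] Vext}
    {T : Vext →L[ℂ] Vext} (hT : Tendsto Tk atTop (𝓝 T)) (E : Submodule ℂ Z)
    [FiniteDimensional ℂ E] (hE : ∀ b, trp (T b - b) ∈ E) :
    Tendsto (fun k => (coupledTwist hD (Dk k) (Tk k) : CoupledSpace trm trp →L[ℂ] _)) atTop
      (𝓝 (coupledTwist hD D T)) := by
  rw [tendsto_iff_norm_sub_tendsto_zero]
  refine squeeze_zero (fun k => norm_nonneg _) (fun k => norm_coupledMap_sub_le _ _) ?_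
  have hG : Tendsto (fun k => trp.comp (Tk k - 1)) atTop (𝓝 (trp.comp (T - 1))) :=
    ((continuous_const.clm_comp continuous_id).tendsto (T - 1)).comp (hT.sub_const 1)
  have hDG := tendsto_comp_of_finite_range hDk hG E hE
  have h1 : Tendsto (fun k => trm.comp ((Dk k).comp (trp.comp (Tk k - 1)))) atTop
      (𝓝 (trm.comp (D.comp (trp.comp (T - 1))))) :=
    ((continuous_const.clm_comp continuous_id).tendsto _).comp hDG
  have h2 := ((continuous_const (y := D)).clm_comp continuous_id).tendsto
    (trp.comp (T - 1) - trm.comp (D.comp (trp.comp (T - 1))))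
  have h3 := hDG.add (h2.comp (hG.sub h1))
  simpa using (tendsto_iff_norm_sub_tendsto_zero.1 h3).add (tendsto_iff_norm_sub_tendsto_zero.1 hT)

/-- The trace defect of a discrete function is a trace of an element of `A`. There `D'` is an exact
right inverse, so the remaining correction by `D`, which could leave `A`, vanishes. -/
theorem coupledTwist_mem_discreteCoupled (hD : ∀ g, trm (D g) = g) {D' : Z →L[ℂ] Vint}
    {T : Vext →L[ℂ] Vext} {A : Submodule ℂ Vint} {B : Submodule ℂ Vext}
    (htr : B.map trp.toLinearMap = A.map trm.toLinearMap) (hDA : ∀ g, D' g ∈ A)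
    (hDD : ∀ u ∈ A, trm (D' (trm u)) = trm u) (hT : ∀ b ∈ B, T b ∈ B)
    {u : CoupledSpace trm trp} (hu : u ∈ discreteCoupled trm trp A B) :
    coupledTwist hD D' T u ∈ discreteCoupled trm trp A B := by
  obtain ⟨h1, h2⟩ := hu
  change intPart trm trp u ∈ A at h1
  change extPart trm trp u ∈ B at h2
  refine ⟨?_, hT _ h2⟩
  change intPart trm trp (coupledTwist hD D' T u) ∈ A
  have hmem : trp (T (extPart trm trp u) - extPart trm trp u) ∈ A.map trm.toLinearMap := by
    rw [← htr]
    exact ⟨_, B.sub_mem (hT _ h2) h2, rfl⟩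
  obtain ⟨a, ha, hat⟩ := hmem
  rw [intPart_coupledTwist_of_eq hD]
  · exact A.add_mem h1 (hDA _)
  · rw [← hat]
    exact hDD a ha

theorem approximatesAll_discreteCoupled [CompleteSpace Z] {Dk : ℕ → Z →L[ℂ] Vint}
    (hDk : ∀ g, Tendsto (fun k => Dk k g) atTop (𝓝 (D g)))
    {A : ℕ → Submodule ℂ Vint} {B : ℕ → Submodule ℂ Vext}
    (htr : ∀ᶠ k in atTop, (B k).map trp.toLinearMap = (A k).map trm.toLinearMap)
    (hDA : ∀ᶠ k in atTop, ∀ g, Dk k g ∈ A k)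
    (hDD : ∀ᶠ k in atTop, ∀ u ∈ A k, trm (Dk k (trm u)) = trm u)
    (hA : ∀ a, ∃ w : ℕ → Vint, (∀ k, w k ∈ A k) ∧ Tendsto w atTop (𝓝 a))
    (hB : ∀ b, ∃ w : ℕ → Vext, (∀ k, w k ∈ B k) ∧ Tendsto w atTop (𝓝 b)) :
    ApproximatesAll fun k => discreteCoupled trm trp (A k) (B k) := by
  classical
  intro u
  obtain ⟨a, haA, ha⟩ := hA (intPart trm trp u)
  obtain ⟨b, hbB, hb⟩ := hB (extPart trm trp u)
  -- The interior approximation is corrected so that its trace matches that of `b k`. The correction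
  -- tends to zero since the two limits have equal traces.
  let a' : ℕ → Vint := fun k => a k + Dk k (trp (b k) - trm (a k))
  have ha' : Tendsto a' atTop (𝓝 (intPart trm trp u)) := by
    have h1 : Tendsto (fun k => trp (b k) - trm (a k)) atTop (𝓝 0) := by
      have := ((trp.continuous.tendsto _).comp hb).sub ((trm.continuous.tendsto _).comp ha)
      rwa [CoupledSpace.trace_eq, sub_self] at this
    simpa [a'] using ha.add (tendsto_apply_of_tendsto hDk h1)
  have htr' : ∀ᶠ k in atTop, a' k ∈ A k ∧ trm (a' k) = trp (b k) := by
    filter_upwards [htr, hDA, hDD] with k h1 h2 h3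
    refine ⟨(A k).add_mem (haA k) (h2 _), ?_⟩
    have hmem : trp (b k) ∈ (A k).map trm.toLinearMap := by
      rw [← h1]
      exact ⟨_, hbB k, rfl⟩
    obtain ⟨c, hc, hct⟩ := hmem
    have hct' : trm c = trp (b k) := hct
    have h4 := h3 _ ((A k).sub_mem hc (haA k))
    rw [map_sub, hct'] at h4
    simp only [a']
    rw [map_add, h4, add_sub_cancel]
  let w : ℕ → CoupledSpace trm trp := fun k =>
    if h : trm (a' k) = trp (b k) then CoupledSpace.mk (a' k) (b k) h else 0
  have hw : ∀ᶠ k in atTop, w k ∈ discreteCoupled trm trp (A k) (B k) ∧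
      intPart trm trp (w k) = a' k ∧ extPart trm trp (w k) = b k := by
    filter_upwards [htr'] with k hk
    simp only [w, dif_pos hk.2]
    exact ⟨⟨hk.1, hbB k⟩, rfl, rfl⟩
  refine ⟨w, hw.mono fun k hk => hk.1, ?_⟩
  rw [tendsto_iff_norm_sub_tendsto_zero]
  have h5 := (tendsto_iff_norm_sub_tendsto_zero.1 ha').add (tendsto_iff_norm_sub_tendsto_zero.1 hb)
  rw [add_zero] at h5
  refine squeeze_zero' (Eventually.of_forall fun k => norm_nonneg _) ?_ h5
  filter_upwards [hw] with k hk
  have h6 := CoupledSpace.norm_le (w k - u)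
  rwa [map_sub, map_sub, hk.2.1, hk.2.2] at h6

theorem isClosed_discreteCoupled {A : Submodule ℂ Vint} {B : Submodule ℂ Vext}
    (hA : IsClosed (A : Set Vint)) (hB : IsClosed (B : Set Vext)) :
    IsClosed (discreteCoupled trm trp A B : Set (CoupledSpace trm trp)) :=
  (hA.preimage (intPart trm trp).continuous).inter (hB.preimage (extPart trm trp).continuous)

variable [CompleteSpace Vint] [CompleteSpace Vext]

/-- A Gårding inequality for the coupled form. -/
theorem exists_compact_garding (hD : ∀ g, trm (D g) = g)
    {sint : Vint →L[ℂ] Vint →L⋆[ℂ] ℂ} {sext : Vext →L[ℂ] Vext →L⋆[ℂ] ℂ}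
    {T : Vext →L[ℂ] Vext} {α : ℝ} {K : Vint →L[ℂ] Vint} (hK : IsCompactOperator K)
    (hint : ∀ a, α * ‖a‖ ^ 2 ≤ (sint a a).re + (inner ℂ a (K a)).re)
    (hext : ∀ b, α * ‖b‖ ^ 2 ≤ (sext b (T b)).re) (E : Submodule ℂ Z) [FiniteDimensional ℂ E]
    (hE : ∀ b, trp (T b - b) ∈ E) :
    ∃ C : CoupledSpace trm trp →L[ℂ] CoupledSpace trm trp, IsCompactOperator C ∧
      ∀ u, α * ‖u‖ ^ 2 ≤ (inner ℂ (coupledTwist hD D T u)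
        (formOperator (coupledForm trm trp sint sext) u)).re + (inner ℂ u (C u)).re := by
  let G : Vext →L[ℂ] Z := trp.comp (T - 1)
  have hG : IsCompactOperator G := isCompactOperator_of_finite_range E hE
  let J := intPart trm trp
  let P := extPart trm trp
  -- Besides `K`, the compact part must cancel the cross term `sint(J u, D G P u)` of the trace
  -- correction. It is compact because `G` has finite rank.
  let N : CoupledSpace trm trp →L[ℂ] Vint :=
    K.comp J - (ContinuousLinearMap.adjoint (formOperator sint)).comp (D.comp (G.comp P))
  refine ⟨(ContinuousLinearMap.adjoint J).comp N, ?_, fun u => ?_⟩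
  · refine IsCompactOperator.clm_comp ?_ (ContinuousLinearMap.adjoint J)
    exact (hK.comp_clm J).sub (((hG.clm_comp D).comp_clm P).clm_comp
      (ContinuousLinearMap.adjoint (formOperator sint)))
  · have h1 : inner ℂ (coupledTwist hD D T u) (formOperator (coupledForm trm trp sint sext) u) =
        sint (J u) (J u) + sint (J u) (D (G (P u))) + sext (P u) (T (P u)) := by
      rw [inner_formOperator, coupledForm_apply, intPart_coupledTwist, extPart_coupledTwist,
        map_add]
      rfl
    have h2 : (inner ℂ u ((ContinuousLinearMap.adjoint J).comp N u)).re =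
        (inner ℂ (J u) (K (J u))).re - (sint (J u) (D (G (P u)))).re := by
      rw [ContinuousLinearMap.comp_apply, ContinuousLinearMap.adjoint_inner_right]
      have h3 : N u = K (J u) - ContinuousLinearMap.adjoint (formOperator sint) (D (G (P u))) := rfl
      rw [h3, inner_sub_right, ContinuousLinearMap.adjoint_inner_right, Complex.sub_re,
        ← inner_formOperator, ← inner_conj_symm (formOperator sint (J u)), Complex.conj_re]
    have h4 := hint (J u)
    have h5 := hext (P u)
    rw [h1, h2, CoupledSpace.norm_sq, Complex.add_re, Complex.add_re]
    change α * (‖J u‖ ^ 2 + ‖P u‖ ^ 2) ≤ _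
    linarith

end Coupled

/-! ### Gårding inequalities and density for the waveguide discretisation -/

section Waveguide

variable {L : ℕ} {X1 X2 Y1 Y2 : Fin L → Type*} {Vint Z : Type*}
  [∀ l, NormedAddCommGroup (X1 l)] [∀ l, InnerProductSpace ℂ (X1 l)]
  [∀ l, NormedAddCommGroup (X2 l)] [∀ l, InnerProductSpace ℂ (X2 l)] [∀ l, CompleteSpace (X2 l)]
  [∀ l, NormedAddCommGroup (Y1 l)] [∀ l, InnerProductSpace ℂ (Y1 l)]
  [∀ l, NormedAddCommGroup (Y2 l)] [∀ l, InnerProductSpace ℂ (Y2 l)]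
  [NormedAddCommGroup Vint] [InnerProductSpace ℂ Vint]
  [NormedAddCommGroup Z] [InnerProductSpace ℂ Z]
  {ιX : ∀ l, X2 l →L[ℂ] X1 l} {ιY : ∀ l, Y2 l →L[ℂ] Y1 l}
  {trm : Vint →L[ℂ] Z} {trp : ExtSpace ιX ιY →L[ℂ] Z}
  {sint : Vint →L[ℂ] Vint →L⋆[ℂ] ℂ} {sext : ExtSpace ιX ιY →L[ℂ] ExtSpace ιX ιY →L⋆[ℂ] ℂ}
  {Vh : ℝ → Submodule ℂ Vint} {Yh : ℝ → ∀ l, Submodule ℂ (Y2 l)}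
  {XN : ℕ → ∀ l, Submodule ℂ (X2 l)} {φ : ℕ → PiLp 2 Y2} {lidx : ℕ → Fin L}
  {h : ℕ → ℝ} {N : ℕ → ℕ}

/-- The twist changes only the modes below `M`, each with a finite dimensional trace space. One `E`
serves all multipliers `c`, hence both the twist and its inverse. -/
theorem SeparationAssumption.exists_finiteDimensional_trace
    (hS : SeparationAssumption ιX ιY trp sext φ lidx) (M : ℕ) :
    ∃ (E : Submodule ℂ Z) (_ : FiniteDimensional ℂ E), ∀ (c : ℕ → ℂ) (b : ExtSpace ιX ιY),
      trp (modalTwist ιX ιY φ lidx M c (fun n => φ n (lidx n)) b - b) ∈ E := by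
  have := hS.trace_finite
  refine ⟨(Finset.range M).sup fun n => (modalSpace ιX ιY φ lidx n).map trp.toLinearMap,
    Submodule.finiteDimensional_finset_sup _ _, fun c b => ?_⟩
  rw [modalTwist_apply, add_sub_cancel_left, map_sum]
  refine Submodule.sum_mem _ fun n hn => ?_
  rw [map_smul]
  exact Submodule.smul_mem _ _ (Finset.le_sup
    (f := fun n => (modalSpace ιX ιY φ lidx n).map trp.toLinearMap) hn
    ⟨_, modalReplace_mem n b, rfl⟩)

theorem eventually_isClosed_discrete (hY : ∀ l, Function.Injective (ιY l))
    (hdisc : DiscreteAssumption ιX ιY trm trp Vh Yh XN) (hh : Tendsto h atTop (𝓝[>] 0)) :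
    ∀ᶠ k in atTop, IsClosed (discreteCoupled trm trp (Vh (h k))
      (discreteExt ιX ιY (XN (N k)) (Yh (h k))) : Set (CoupledSpace trm trp)) := by
  filter_upwards [hh.eventually self_mem_nhdsWithin] with k hk
  have := hdisc.finite_V (h k) hk
  exact isClosed_discreteCoupled (Submodule.closed_of_finiteDimensional _)
    (isClosed_discreteExt hY (hdisc.closed_X (N k)) _ (hdisc.finite_Y _ hk))

variable [∀ l, CompleteSpace (X1 l)] [∀ l, CompleteSpace (Y1 l)] [∀ l, CompleteSpace (Y2 l)]

/-- The exterior functions are approximated by the discrete exterior spaces. -/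
theorem exists_seq_discreteExt (hX : ∀ l, Function.Injective (ιX l))
    (hY : ∀ l, Function.Injective (ιY l)) (hS : SeparationAssumption ιX ιY trp sext φ lidx)
    (hdisc : DiscreteAssumption ιX ιY trm trp Vh Yh XN) (hh : Tendsto h atTop (𝓝[>] 0))
    (hN : Tendsto N atTop atTop) (u : ExtSpace ιX ιY) :
    ∃ w : ℕ → ExtSpace ιX ιY, (∀ k, w k ∈ discreteExt ιX ιY (XN (N k)) (Yh (h k))) ∧
      Tendsto w atTop (𝓝 u) := by
  let W : ℕ → Submodule ℂ (ExtSpace ιX ιY) := fun k => discreteExt ιX ιY (XN (N k)) (Yh (h k))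
  -- Limits of discrete functions form a closed subspace, and the modes span a dense one, so only `x
  -- ⊗ φ n` must be approximated, which is done factor by factor.
  have hle : (⨆ n, modalSpace ιX ιY φ lidx n) ≤ limitSubmodule W := by
    refine iSup_le fun n v hv => ?_
    obtain ⟨x, rfl⟩ := exists_eq_extPure hX hY rfl hv
    obtain ⟨xk, hxk, hx⟩ := exists_seq_of_dense_iUnion_nat
      (fun N N' hNN => hdisc.nested_X N N' hNN (lidx n)) (hdisc.dense_X (lidx n)) hN x
    obtain ⟨yk, hyk, hy⟩ := exists_seq_of_dense_iUnion_pos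
      (fun h h' hpos hhh => hdisc.nested_Y h h' hpos hhh (lidx n)) (hdisc.dense_Y (lidx n)) hh
      (φ n (lidx n))
    have hmem : ∀ k, extPure ιX ιY (lidx n) (xk k) (yk k) ∈ W k :=
      fun k => extPure_mem_discreteExt (hxk k) (hyk k)
    exact mem_limitSubmodule_of_tendsto hmem (tendsto_apply_apply _ hx hy)
  have htop := Submodule.topologicalClosure_minimal _ hle (isClosed_limitSubmodule W)
  rw [hS.modal_dense] at htop
  exact htop trivial

theorem approximatesAll_discrete [CompleteSpace Z] (hX : ∀ l, Function.Injective (ιX l))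
    (hY : ∀ l, Function.Injective (ιY l)) (hS : SeparationAssumption ιX ιY trp sext φ lidx)
    (hdisc : DiscreteAssumption ιX ιY trm trp Vh Yh XN) (hh : Tendsto h atTop (𝓝[>] 0))
    (hN : Tendsto N atTop atTop) :
    ApproximatesAll fun k => discreteCoupled trm trp (Vh (h k))
      (discreteExt ιX ιY (XN (N k)) (Yh (h k))) := by
  obtain ⟨D, Dh, -, hDh, hDD, hDlim⟩ := hdisc.exists_right_inverse
  have hpos : ∀ᶠ k in atTop, 0 < h k := hh.eventually self_mem_nhdsWithin
  refine approximatesAll_discreteCoupled (Dk := fun k => Dh (h k)) (D := D) (fun g => ?_)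
    (hpos.mono fun k hk => hdisc.trace_eq _ hk _) (hpos.mono fun k hk => hDh _ hk)
    (hpos.mono fun k hk => hDD _ hk)
    (exists_seq_of_dense_iUnion_pos hdisc.nested_V hdisc.dense_V hh)
    (exists_seq_discreteExt hX hY hS hdisc hh hN)
  rw [tendsto_iff_norm_sub_tendsto_zero]
  simpa only [Function.comp_def, norm_sub_rev] using (hDlim g).comp hh

/-- The discrete Gårding inequalities for the coupled waveguide problem. -/
theorem exists_galerkinGarding [CompleteSpace Vint] [CompleteSpace Z]
    (hX : ∀ l, Function.Injective (ιX l))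
    (hY : ∀ l, Function.Injective (ιY l)) (hS : SeparationAssumption ιX ιY trp sext φ lidx)
    {M : ℕ} {Cs α : ℝ} {θ : ℕ → ℂ} {K : Vint →L[ℂ] Vint}
    (hC : CoercivityAssumption ιX ιY sint sext φ lidx M Cs α θ K)
    (hdisc : DiscreteAssumption ιX ιY trm trp Vh Yh XN) (hh : Tendsto h atTop (𝓝[>] 0)) :
    ∃ T R C α Tk Rk, GalerkinGarding (formOperator (coupledForm trm trp sint sext)) T R C α
      (fun k => discreteCoupled trm trp (Vh (h k)) (discreteExt ιX ιY (XN (N k)) (Yh (h k))))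
      Tk Rk := by
  obtain ⟨D, Dh, hD, hDh, hDD, hDlim⟩ := hdisc.exists_right_inverse
  have hpos : ∀ᶠ k in atTop, 0 < h k := hh.eventually self_mem_nhdsWithin
  have hDk : ∀ g, Tendsto (fun k => Dh (h k) g) atTop (𝓝 (D g)) := fun g => by
    rw [tendsto_iff_norm_sub_tendsto_zero]
    simpa only [Function.comp_def, norm_sub_rev] using (hDlim g).comp hh
  obtain ⟨E, _, hE⟩ := hS.exists_finiteDimensional_trace M
  have hy : ∀ n, ∃ y : ℕ → Y2 (lidx n), (∀ k, y k ∈ Yh (h k) (lidx n)) ∧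
      Tendsto y atTop (𝓝 (φ n (lidx n))) := fun n => exists_seq_of_dense_iUnion_pos
    (fun h h' hpos hhh => hdisc.nested_Y h h' hpos hhh (lidx n)) (hdisc.dense_Y (lidx n)) hh _
  choose y hyY hy using hy
  let T : (ℕ → ℂ) → ExtSpace ιX ιY →L[ℂ] ExtSpace ιX ιY := fun c =>
    modalTwist ιX ιY φ lidx M c fun n => φ n (lidx n)
  -- The multiplier is kept as a parameter: `conj (θ n)` gives the twist and `θ n` its inverse, each
  -- with its own discrete version.
  let Tk : (ℕ → ℂ) → ℕ → ExtSpace ιX ιY →L[ℂ] ExtSpace ιX ιY := fun c k =>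
    modalTwist ιX ιY φ lidx M c fun n => y n k
  have hTk : ∀ c, Tendsto (Tk c) atTop (𝓝 (T c)) := fun c => tendsto_modalTwist M c hy
  have hmem : ∀ c, ∀ᶠ k in atTop, ∀ u ∈ discreteCoupled trm trp (Vh (h k))
      (discreteExt ιX ιY (XN (N k)) (Yh (h k))), coupledTwist hD (Dh (h k)) (Tk c k) u ∈
        discreteCoupled trm trp (Vh (h k)) (discreteExt ιX ιY (XN (N k)) (Yh (h k))) := by
    intro c
    filter_upwards [hpos] with k hk u hu
    exact coupledTwist_mem_discreteCoupled hD (hdisc.trace_eq _ hk _) (hDh _ hk) (hDD _ hk)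
      (fun b hb => modalTwist_mem_discreteExt hb c fun n => hyY n k) hu
  have hθ : ∀ n < M, (starRingEnd ℂ) (θ n) * θ n = 1 := fun n hn => by
    rw [Complex.conj_mul', hC.norm_theta n hn]
    simp
  obtain ⟨C, hCc, hCg⟩ := exists_compact_garding (trm := trm) (trp := trp) hD
    (T := T fun n => (starRingEnd ℂ) (θ n)) hC.compact hC.garding
    (hC.coercive_twist hS hX hY) E (hE _)
  exact ⟨coupledTwist hD D (T fun n => (starRingEnd ℂ) (θ n)), coupledTwist hD D (T θ), C, α,
    fun k => coupledTwist hD (Dh (h k)) (Tk (fun n => (starRingEnd ℂ) (θ n)) k),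
    fun k => coupledTwist hD (Dh (h k)) (Tk θ k),
    { pos := hC.alpha_pos
      mul_eq_one := coupledTwist_mul hD (hS.modalTwist_mul hX hY M hθ)
      mul_eq_one' := coupledTwist_mul hD (hS.modalTwist_mul hX hY M fun n hn => by
        rw [mul_comm, hθ n hn])
      compact := hCc
      garding := hCg
      tendsto := tendsto_coupledTwist hD hDk (hTk _) E (hE _)
      tendsto' := tendsto_coupledTwist hD hDk (hTk _) E (hE _)
      mem := hmem _
      mem' := hmem _ }⟩

end Waveguide

end Waveguide

/-! ### The main theorem -/

theorem theorem2 {L : ℕ} {X1 X2 Y1 Y2 : Fin L → Type*} {Vint Z : Type*}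
    -- the Hilbert spaces
    [∀ l, NormedAddCommGroup (X1 l)] [∀ l, InnerProductSpace ℂ (X1 l)] [∀ l, CompleteSpace (X1 l)]
    [∀ l, NormedAddCommGroup (X2 l)] [∀ l, InnerProductSpace ℂ (X2 l)] [∀ l, CompleteSpace (X2 l)]
    [∀ l, NormedAddCommGroup (Y1 l)] [∀ l, InnerProductSpace ℂ (Y1 l)] [∀ l, CompleteSpace (Y1 l)]
    [∀ l, NormedAddCommGroup (Y2 l)] [∀ l, InnerProductSpace ℂ (Y2 l)] [∀ l, CompleteSpace (Y2 l)]
    [NormedAddCommGroup Vint] [InnerProductSpace ℂ Vint] [CompleteSpace Vint]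
    [NormedAddCommGroup Z] [InnerProductSpace ℂ Z] [CompleteSpace Z]
    -- the dense embeddings and the trace operators
    (ιX : ∀ l, X2 l →L[ℂ] X1 l) (hιX : ∀ l, IsDenseInclusion (ιX l))
    (ιY : ∀ l, Y2 l →L[ℂ] Y1 l) (hιY : ∀ l, IsDenseInclusion (ιY l))
    (trm : Vint →L[ℂ] Z) (htrm : Function.Surjective trm)
    (trp : ExtSpace ιX ιY →L[ℂ] Z) (htrp : Function.Surjective trp)
    -- the sesquilinear forms, depending on the parameter in the open set `Λ`
    (Λ : Set ℂ) (hΛ : IsOpen Λ)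
    (sint : ℂ → Vint →L[ℂ] Vint →L⋆[ℂ] ℂ)
    (sext : ℂ → ExtSpace ιX ιY →L[ℂ] ExtSpace ιX ιY →L⋆[ℂ] ℂ)
    -- separation and coercivity, with locally uniform data
    (hloc : ∀ κ₀ ∈ Λ, ∃ U ∈ 𝓝 κ₀, U ⊆ Λ ∧
      ∃ (φ : ℕ → PiLp 2 Y2) (lidx : ℕ → Fin L) (M : ℕ) (Cs α : ℝ) (θ : ℕ → ℂ)
        (K : Vint →L[ℂ] Vint), ∀ κ ∈ U,
          SeparationAssumption ιX ιY trp (sext κ) φ lidx ∧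
          CoercivityAssumption ιX ιY (sint κ) (sext κ) φ lidx M Cs α θ K)
    -- the discrete subspaces
    (Vh : ℝ → Submodule ℂ Vint) (Yh : ℝ → ∀ l, Submodule ℂ (Y2 l))
    (XN : ℕ → ∀ l, Submodule ℂ (X2 l))
    (hdisc : DiscreteAssumption ιX ιY trm trp Vh Yh XN)
    -- holomorphic dependence on the parameter, in operator norm
    (hhol : DifferentiableOn ℂ
      (fun κ => formOperator (coupledForm trm trp (sint κ) (sext κ))) Λ)
    -- every connected component of `Λ` contains a parameter for which the operator is invertible
    (hinv : ∀ κ₀ ∈ Λ, ∃ κ ∈ connectedComponentIn Λ κ₀,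
      IsUnit (formOperator (coupledForm trm trp (sint κ) (sext κ))))
    -- the eigenvalues and the discrete eigenvalues
    (S : Set ℂ)
    (hS : S = eigenvalueSet Λ (fun κ => coupledForm trm trp (sint κ) (sext κ)) ⊤)
    (ShN : ℝ → ℕ → Set ℂ)
    (hShN : ∀ h N, ShN h N = eigenvalueSet Λ (fun κ => coupledForm trm trp (sint κ) (sext κ))
      (discreteCoupled trm trp (Vh h) (discreteExt ιX ιY (XN N) (Yh h)))) :
    (IsDiscrete S ∧ ∀ κ ∈ Λ, ¬ AccPt κ (𝓟 S)) ∧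
    ∀ Λ' : Set ℂ, IsCompact Λ' → Λ' ⊆ Λ →
      -- Hausdorff convergence in `Λ'` if no eigenvalue lies on its boundary
      (Disjoint S (frontier Λ') →
        Tendsto (fun p : ℝ × ℕ => Metric.hausdorffEDist (S ∩ Λ') (ShN p.1 p.2 ∩ Λ'))
          (𝓝[>] 0 ×ˢ atTop) (𝓝 0)) ∧
      -- for arbitrary `Λ'`: the discrete eigenvalues in `Λ'` approach the eigenvalues in `Λ'`, and
      -- the eigenvalues in `Λ'` are approximated by discrete eigenvalues
      Tendsto (fun p : ℝ × ℕ => ⨆ κ ∈ ShN p.1 p.2 ∩ Λ', Metric.infEDist κ (S ∩ Λ'))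
        (𝓝[>] 0 ×ˢ atTop) (𝓝 0) ∧
      Tendsto (fun p : ℝ × ℕ => ⨆ κ ∈ S ∩ Λ', Metric.infEDist κ (ShN p.1 p.2))
        (𝓝[>] 0 ×ˢ atTop) (𝓝 0) := by
  have hX := fun l => (hιX l).injective
  have hY := fun l => (hιY l).injective
  have hsep : ∀ κ ∈ Λ, ∃ (φ : ℕ → PiLp 2 Y2) (lidx : ℕ → Fin L) (M : ℕ) (Cs α : ℝ) (θ : ℕ → ℂ)
      (K : Vint →L[ℂ] Vint), SeparationAssumption ιX ιY trp (sext κ) φ lidx ∧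
        CoercivityAssumption ιX ιY (sint κ) (sext κ) φ lidx M Cs α θ K := by
    intro κ hκ
    obtain ⟨U, hU, -, φ, lidx, M, Cs, α, θ, K, h⟩ := hloc κ hκ
    exact ⟨φ, lidx, M, Cs, α, θ, K, h κ (mem_of_mem_nhds hU)⟩
  have hG : ∀ (h : ℕ → ℝ) (N : ℕ → ℕ), Tendsto h atTop (𝓝[>] 0) → ∀ κ ∈ Λ,
      ∃ T R C α Tk Rk, GalerkinGarding
        (formOperator (coupledForm trm trp (sint κ) (sext κ))) T R C α
        (fun k => discreteCoupled trm trp (Vh (h k)) (discreteExt ιX ιY (XN (N k)) (Yh (h k))))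
        Tk Rk := by
    intro h N hh κ hκ
    obtain ⟨φ, lidx, M, Cs, α, θ, K, hS, hC⟩ := hsep κ hκ
    exact exists_galerkinGarding hX hY hS hC hdisc hh
  have hGt : ∀ κ ∈ Λ, ∃ T C α,
      TGarding (formOperator (coupledForm trm trp (sint κ) (sext κ))) T C α := by
    intro κ hκ
    -- The continuous Gårding inequality does not involve the discretisation, so any admissible
    -- sequence may be inserted.
    obtain ⟨T, R, C, α, Tk, Rk, h⟩ := hG (fun k => 1 / ((k : ℝ) + 1)) (fun k => k)
      (tendsto_nhdsWithin_iff.2 ⟨tendsto_one_div_add_atTop_nhds_zero_nat,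
        Eventually.of_forall fun k => mem_Ioi.2 (by positivity)⟩) κ hκ
    exact ⟨T, C, α, h.tGarding⟩
  have hiso : ∀ κ ∈ Λ, ∀ᶠ κ' in 𝓝[≠] κ, κ' ∉ S :=
    hS ▸ eventually_notMem_eigenvalueSet hΛ hhol hGt hinv
  have hSΛ : S ⊆ Λ := hS ▸ fun κ hκ => hκ.1
  -- The filter in `(h, N)` is countably generated, so all limits can be tested along sequences.
  have hseq : ∀ x : ℕ → ℝ × ℕ, Tendsto x atTop (𝓝[>] 0 ×ˢ atTop) →
      (∀ κ ∈ Λ, κ ∉ S → ∃ U ∈ 𝓝 κ, ∀ᶠ k in atTop, ∀ κ' ∈ U, κ' ∉ ShN (x k).1 (x k).2) ∧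
      ∀ κ ∈ S, ∀ ε : ENNReal, 0 < ε →
        ∀ᶠ k in atTop, ∃ κ' ∈ ShN (x k).1 (x k).2, edist κ κ' < ε := by
    intro x hx
    have hh : Tendsto (fun k => (x k).1) atTop (𝓝[>] 0) := tendsto_fst.comp hx
    have hN : Tendsto (fun k => (x k).2) atTop atTop := tendsto_snd.comp hx
    rcases Λ.eq_empty_or_nonempty with rfl | ⟨κ₁, hκ₁⟩
    · exact ⟨fun κ hκ => absurd hκ (notMem_empty κ), fun κ hκ => absurd (hSΛ hκ) (notMem_empty κ)⟩
    -- Density of the discrete spaces does not depend on the parameter, so the modes at a single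
    -- point of `Λ` suffice.
    obtain ⟨φ, lidx, -, -, -, -, -, hSep, -⟩ := hsep κ₁ hκ₁
    have hd := approximatesAll_discrete hX hY hSep hdisc hh hN
    simp only [hShN, hS]
    exact ⟨eigenvalueSet_avoid hΛ hhol hd (hG _ _ hh), eigenvalueSet_approx hΛ hhol hd
      (eventually_isClosed_discrete hY hdisc hh) (hG _ _ hh) hinv⟩
  refine ⟨isDiscrete_and_not_accPt hSΛ hiso, fun Λ' hΛ' hΛ'Λ => ⟨fun hfr => ?_, ?_, ?_⟩⟩
  · exact tendsto_of_seq_tendsto fun x hx =>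
      tendsto_hausdorffEDist hiso (hseq x hx).1 (hseq x hx).2 hΛ' hΛ'Λ hfr
  · exact tendsto_of_seq_tendsto fun x hx =>
      tendsto_iSup_infEDist_of_avoid (hseq x hx).1 hΛ' hΛ'Λ
  · exact tendsto_of_seq_tendsto fun x hx =>
      tendsto_iSup_infEDist_of_approx hiso (hseq x hx).2 hΛ' hΛ'Λ
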